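/- Let $d\ge 1$, $\mathbb{R}^d_+=(0,\infty)^d$ with Lebesgue measure, $L^p=L^p(\mathbb{R}^d_+,dx)$ (real- or complex-valued functions), and $\alpha\in[-1/2,\infty)^d$. For $k\in\mathbb{N}^d$ let $\varphi_k^\alpha(x)=\prod_{i=1}^d\varphi_{k_i}^{\alpha_i}(x_i)$, where, for $a>-1$, $n\in\mathbb{N}$, $u>0$, $$\varphi_n^{a}(u)=\sqrt2\,\Big(\frac{\Gamma(n+1)}{\Gamma(n+a+1)}\Big)^{1/2}L_n^{a}(u^2)\,u^{a+1/2}e^{-u^2/2},$$ and $L_n^a$ is the Laguerre polynomial of degree $n$ and order $a$. These functions form an orthonormal basis of $L^2$. Let $L_\alpha^\varphi$ be the self-adjoint extension of $-\Delta+\|x\|^2+\sum_{i=1}^d x_i^{-2}(\alpha_i^2-\tfrac14)$ whose spectral decomposition is given by $L_\alpha^\varphi\varphi_k^\alpha=(4|k|+2|\alpha|+2d)\varphi_k^\alpha$, where $|k|=\sum_i k_i$ and $|\alpha|=\sum_i\alpha_i$. For $t>0$ put $$G_t^{\alpha,\varphi}(x,y)=\sum_{k\in\mathbb{N}^d}e^{-t(4|k|+2|\alpha|+2d)}\varphi_k^\alpha(x)\varphi_k^\alpha(y),\qquad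 T_t^{\alpha,\varphi}f(x)=\int_{\mathbb{R}^d_+}G_t^{\alpha,\varphi}(x,y)f(y)\,dy,$$ for $f\in L^1+L^\infty$, and $T_0^{\alpha,\varphi}=\mathrm{Id}$. A symmetric diffusion semigroup is a family $\{T_t\}_{t\ge0}$ of linear operators from $L^1+L^\infty$ into the measurable functions, with $T_0=\mathrm{Id}$, such that (i) for all $1\le p\le\infty$ every $T_t$ is a contraction on $L^p$ and $\{T_t\}$ is a semigroup there; (ii) every $T_t$ is self-adjoint on $L^2$; (iii) $T_tf\to f$ in $L^2$ as $t\to0^+$ for every $f\in L^2$. It is Markovian if in addition (iv) $T_tf\ge0$ whenever $f\ge0$, and (v) $T_t\mathbf{1}=\mathbf{1}$ for all $t$; it is submarkovian if (i)-(iv) hold and $T_t\mathbf{1}\le\mathbf{1}$ for all $t$. The family $\{T_t\}$ is called $L^p$-contractive if $\|T_tf\|_p\le\|f\|_p$ for all $1\le p\le\infty$, all $t\ge0$ and all $f\in L^2\cap L^p$. All relations between functions are understood almost everywhere. Theorem. The series defining $G_t^{\alpha,\varphi}(x,y)$ converges absolutely for all $t>0$ and $x,y\in\mathbb{R}^d_+$;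 the integral defining $T_t^{\alpha,\varphi}f(x)$ converges absolutely for all $t>0$, $f\in L^1+L^\infty$ and $x\in\mathbb{R}^d_+$; and on $L^2$ the operators $T_t^{\alpha,\varphi}$ coincide with $\exp(-tL_\alpha^\varphi)$, that is, $T_t^{\alpha,\varphi}f=\sum_k e^{-t(4|k|+2|\alpha|+2d)}\langle f,\varphi_k^\alpha\rangle\varphi_k^\alpha$ in $L^2$ for all $t\ge0$ and $f\in L^2$. Moreover: (a) If $\alpha_i\in\{-1/2\}\cup[1/2,\infty)$ for every $i$, then $\{T_t^{\alpha,\varphi}\}$ is a submarkovian, but not Markovian, symmetric diffusion semigroup, and for all $1\le p\le\infty$ $$\|T_t^{\alpha,\varphi}\|_{p\to p}\le(\cosh 2t)^{-d/2},\qquad t>0.$$ (b) If $\alpha_i\in(-1/2,1/2)$ for some $i$, then $\{T_t^{\alpha,\varphi}\}$ is not $L^p$-contractive, but there is a constant $c=c(\alpha)>1$ such that for all $1\le p\le\infty$ $$\|T_t^{\alpha,\varphi}\|_{p\to p}\le c\,(\cosh 2t)^{-d/2},\qquad t>0.$$ -/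

import Mathlib

open MeasureTheory Filter Topology
open scoped ENNReal NNReal ComplexOrder ComplexConjugate

noncomputable section

/-! ### Symmetric diffusion semigroups

Operators act on functions `X → 𝕜`, regarded modulo `μ`-a.e. equality.
A family `{T_t}_{t ≥ 0}` is indexed by `t : ℝ≥0`. -/

section Semigroups

/-- `f` belongs to `L¹(μ) + L^∞(μ)`, the common domain of the semigroups considered. -/
def MemL1AddLinfty {X 𝕜 : Type*} [MeasurableSpace X] [RCLike 𝕜]
    (μ : Measure X) (f : X → 𝕜) : Prop :=
  ∃ g h : X → 𝕜, MemLp g 1 μ ∧ MemLp h ∞ μ ∧ f = g + h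

/-- `S` maps `L^p(μ)` into itself and its operator norm there satisfies `‖S‖_{p→p} ≤ C`. -/
def LpOpNormLE {X 𝕜 : Type*} [MeasurableSpace X] [RCLike 𝕜]
    (μ : Measure X) (p : ℝ≥0∞) (S : (X → 𝕜) → X → 𝕜) (C : ℝ) : Prop :=
  ∀ f : X → 𝕜, MemLp f p μ →
    MemLp (S f) p μ ∧ eLpNorm (S f) p μ ≤ ENNReal.ofReal C * eLpNorm f p μ

/-- Symmetric diffusion semigroup, with the common domain `L¹ + L^∞`. -/
structure IsSymmetricDiffusionSemigroup {X 𝕜 : Type*} [MeasurableSpace X] [RCLike 𝕜]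
    (μ : Measure X) (T : ℝ≥0 → (X → 𝕜) → X → 𝕜) : Prop where
  /-- Each `T_t` maps `L¹ + L^∞` into the measurable functions. -/
  measurable : ∀ t f, MemL1AddLinfty μ f → AEStronglyMeasurable (T t f) μ
  /-- Each `T_t` is well defined on a.e. classes. -/
  congr : ∀ t f g, MemL1AddLinfty μ f → f =ᵐ[μ] g → T t f =ᵐ[μ] T t g
  map_add : ∀ t f g, MemL1AddLinfty μ f → MemL1AddLinfty μ g →
    T t (f + g) =ᵐ[μ] T t f + T t g
  map_smul : ∀ t (c : 𝕜) f, MemL1AddLinfty μ f → T t (c • f) =ᵐ[μ] c • T t f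
  map_zero_time : ∀ f, MemL1AddLinfty μ f → T 0 f =ᵐ[μ] f
  /-- (i) Each `T_t` is a contraction on every `L^p`, `1 ≤ p ≤ ∞`. -/
  contraction : ∀ p : ℝ≥0∞, 1 ≤ p → ∀ t, LpOpNormLE μ p (T t) 1
  /-- (i) The semigroup property on every `L^p`, `1 ≤ p ≤ ∞`. -/
  semigroup : ∀ p : ℝ≥0∞, 1 ≤ p → ∀ s t f, MemLp f p μ → T (s + t) f =ᵐ[μ] T s (T t f)
  /-- (ii) Each `T_t`, a bounded operator on `L²` by (i), is self-adjoint. -/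
  selfAdjoint : ∀ t f g, MemLp f 2 μ → MemLp g 2 μ →
    ∫ x, conj (T t f x) * g x ∂μ = ∫ x, conj (f x) * T t g x ∂μ
  /-- (iii) `T_t f → f` in `L²` as `t → 0⁺`. -/
  strongContinuity : ∀ f, MemLp f 2 μ →
    Tendsto (fun t : ℝ≥0 => eLpNorm (T t f - f) 2 μ) (𝓝[>] 0) (𝓝 0)

/-- (iv) Each `T_t` is positive. -/
def IsPositiveFamily {X 𝕜 : Type*} [MeasurableSpace X] [RCLike 𝕜]
    (μ : Measure X) (T : ℝ≥0 → (X → 𝕜) → X → 𝕜) : Prop :=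
  ∀ t f, MemL1AddLinfty μ f → (∀ᵐ x ∂μ, 0 ≤ f x) → ∀ᵐ x ∂μ, 0 ≤ T t f x

/-- Markovian: (i)-(iv) and `T_t 1 = 1` for all `t`. -/
def IsMarkovianSemigroup {X 𝕜 : Type*} [MeasurableSpace X] [RCLike 𝕜]
    (μ : Measure X) (T : ℝ≥0 → (X → 𝕜) → X → 𝕜) : Prop :=
  IsSymmetricDiffusionSemigroup μ T ∧ IsPositiveFamily μ T ∧
    ∀ t, ∀ᵐ x ∂μ, T t (fun _ => 1) x = 1

/-- Submarkovian: (i)-(iv) and `T_t 1 ≤ 1` for all `t`. -/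
def IsSubmarkovianSemigroup {X 𝕜 : Type*} [MeasurableSpace X] [RCLike 𝕜]
    (μ : Measure X) (T : ℝ≥0 → (X → 𝕜) → X → 𝕜) : Prop :=
  IsSymmetricDiffusionSemigroup μ T ∧ IsPositiveFamily μ T ∧
    ∀ t, ∀ᵐ x ∂μ, T t (fun _ => 1) x ≤ 1

/-- `L^p`-contractive semigroup: `‖T_t f‖_p ≤ ‖f‖_p` for all `1 ≤ p ≤ ∞`, all `t ≥ 0` and all
`f ∈ L² ∩ L^p`. -/
def IsLpContractiveSemigroup {X 𝕜 : Type*} [MeasurableSpace X] [RCLike 𝕜]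
    (μ : Measure X) (T : ℝ≥0 → (X → 𝕜) → X → 𝕜) : Prop :=
  ∀ p : ℝ≥0∞, 1 ≤ p → ∀ t f, MemLp f 2 μ → MemLp f p μ → eLpNorm (T t f) p μ ≤ eLpNorm f p μ

end Semigroups

/-! ### The Laguerre semigroup of Hermite type -/

section Laguerre

/-- The Laguerre polynomial `L_k^a(x)` of degree `k` and order `a > -1`. -/
def laguerrePoly (k : ℕ) (a x : ℝ) : ℝ :=
  ∑ j ∈ Finset.range (k + 1),
    Real.Gamma (k + a + 1) / (Real.Gamma (j + a + 1) * (j.factorial : ℝ) * ((k - j).factorial : ℝ))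
      * (-x) ^ j

/-- The normalized Laguerre polynomial `(Γ(k+1)/Γ(k+a+1))^{1/2} L_k^a(x)`. -/
def laguerreNormalized (k : ℕ) (a x : ℝ) : ℝ :=
  Real.sqrt (Real.Gamma (k + 1) / Real.Gamma (k + a + 1)) * laguerrePoly k a x

/-- The one-dimensional Laguerre function of Hermite type `φ_k^a(x)`, `x > 0`. -/
def laguerreHermite1 (k : ℕ) (a x : ℝ) : ℝ :=
  Real.sqrt 2 * laguerreNormalized k a (x ^ 2) * x ^ (a + 1 / 2) * Real.exp (-x ^ 2 / 2)

/-- The open orthant `ℝ₊^d = (0,∞)^d`. -/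
def orthant (d : ℕ) : Set (Fin d → ℝ) := {x | ∀ i, 0 < x i}

/-- Lebesgue measure on `ℝ₊^d`. -/
def orthantMeasure (d : ℕ) : Measure (Fin d → ℝ) := volume.restrict (orthant d)

/-- The tensor product `φ_k^α(x) = ∏ φ_{k_i}^{α_i}(x_i)`. -/
def laguerreHermite {d : ℕ} (α : Fin d → ℝ) (k : Fin d → ℕ) (x : Fin d → ℝ) : ℝ :=
  ∏ i, laguerreHermite1 (k i) (α i) (x i)

/-- The eigenvalue `4|k| + 2|α| + 2d` of `-Δ + ‖x‖² + ∑ (α_i² - 1/4)/x_i²` on `φ_k^α`. -/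
def laguerreEigenvalue {d : ℕ} (α : Fin d → ℝ) (k : Fin d → ℕ) : ℝ :=
  4 * (∑ i, (k i : ℝ)) + 2 * (∑ i, α i) + 2 * (d : ℝ)

/-- The terms `e^{-t(4|k|+2|α|+2d)} φ_k^α(x) φ_k^α(y)` of the heat kernel series. -/
def laguerreKernelTerm {d : ℕ} (α : Fin d → ℝ) (t : ℝ) (x y : Fin d → ℝ) (k : Fin d → ℕ) : ℝ :=
  Real.exp (-t * laguerreEigenvalue α k) * laguerreHermite α k x * laguerreHermite α k y

/-- The heat kernel `G_t^{α,φ}(x,y)`. -/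
def laguerreHeatKernel {d : ℕ} (α : Fin d → ℝ) (t : ℝ) (x y : Fin d → ℝ) : ℝ :=
  ∑' k : Fin d → ℕ, laguerreKernelTerm α t x y k

/-- The operators `T_t^{α,φ}` on `L¹ + L^∞`: the identity for `t = 0`, and integration against the
heat kernel for `t > 0`. -/
def laguerreSemigroup {𝕜 : Type*} [RCLike 𝕜] {d : ℕ} (α : Fin d → ℝ) (t : ℝ≥0)
    (f : (Fin d → ℝ) → 𝕜) (x : Fin d → ℝ) : 𝕜 :=
  if t = 0 then f x else ∫ y, laguerreHeatKernel α t x y • f y ∂(orthantMeasure d)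

/-- The Fourier-Laguerre coefficient `⟨f, φ_k^α⟩` (the functions `φ_k^α` are real). -/
def laguerreCoeff {𝕜 : Type*} [RCLike 𝕜] {d : ℕ} (α : Fin d → ℝ)
    (f : (Fin d → ℝ) → 𝕜) (k : Fin d → ℕ) : 𝕜 :=
  ∫ y, laguerreHermite α k y • f y ∂(orthantMeasure d)

/-- `g = exp(-t L_α^φ) f` for `f ∈ L²`, where `L_α^φ` is the self-adjoint operator with spectral
decomposition given by the `φ_k^α`: the series `∑ e^{-t(4|k|+2|α|+2d)} ⟨f, φ_k^α⟩ φ_k^α`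
converges (unconditionally) to `g` in `L²(ℝ₊^d)`. -/
def IsSpectralHeatFlow {𝕜 : Type*} [RCLike 𝕜] {d : ℕ} (α : Fin d → ℝ) (t : ℝ)
    (f g : (Fin d → ℝ) → 𝕜) : Prop :=
  MemLp g 2 (orthantMeasure d) ∧
  Tendsto (fun s : Finset (Fin d → ℕ) =>
      eLpNorm (fun x => g x - ∑ k ∈ s,
        (Real.exp (-t * laguerreEigenvalue α k) * laguerreHermite α k x) • laguerreCoeff α f k)
        2 (orthantMeasure d))
    atTop (𝓝 0)

end Laguerre

end

/-!
For `t > 0` the Hille–Hardy formula sums the one-dimensional heat kernel to an elementary factor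
times a modified Bessel function, so the kernel on the orthant is a product of positive functions
with Gaussian decay, and the symmetry, positivity and semigroup property of `T_t` can be read off
from it. By Schur's test, the norms of `T_t` on all `L^p` are bounded by the supremum over `x` of
the mass `∫ G_t(x, y) dy`, again a product over the coordinates.

Integrating the one-dimensional series for `G_t` term by term gives the mass
`(cosh 2t)^{-1/2} exp(-(x²/2) tanh 2t) M(w)` with `w = x² / (2 sinh 2t cosh 2t)`. Here `M = 1` for
`a = -1/2`, and otherwise, with `δ = a/2 + 1/4`, `M(w)` is the expectation of `(1 - σ)₊ ^ (δ - 1/2)`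
for a random variable `σ` following the Gamma distribution of shape `δ` and rate `w`. It is at most
one if `δ = 0` or `1/2 ≤ δ`, and bounded for every `δ ≥ 0`. For `0 < δ < 1/2` the integrand has
derivative `1/2 - δ > 0` at `σ = 0`, near which `σ` concentrates as `w → ∞`, so that `M(w) > 1` for
large `w`. As `t → 0⁺` with `w` fixed the other factors of the mass tend to one, and the mass
exceeds one.

The Laguerre functions are complete in `L²`: their generating functions show that a function
orthogonal to all of them is orthogonal to `φ_0(x) exp(-∑ n_i x_i²)` for every multi-index `n`, and
the polynomials in `exp(-x_i²)` form an algebra separating points. The spectral expansion of `T_t`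
then follows from the expansion of `f`, the case of a single `φ_k` and the boundedness of `T_t`.
-/

noncomputable section

/-! ### Rearranging double series -/

section DoubleSeries

lemma hasSum_comm_of_summable {β γ M : Type*} [AddCommMonoid M] [TopologicalSpace M]
    [ContinuousAdd M] [T3Space M] {F : β → γ → M} {g : β → M} {f : γ → M} {S : M}
    (hF : Summable fun p : β × γ => F p.1 p.2) (hg : ∀ j, HasSum (F j) (g j))
    (hf : ∀ n, HasSum (fun j => F j n) (f n)) (hS : HasSum g S) : HasSum f S := by
  have hsum : HasSum (fun p : β × γ => F p.1 p.2) S :=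
    (hF.hasSum.prod_fiberwise hg).unique hS ▸ hF.hasSum
  exact HasSum.prod_fiberwise ((Equiv.prodComm γ β).hasSum_iff.2 hsum) hf

lemma summable_prod_of_norm_hasSum {β γ E : Type*} [NormedAddCommGroup E] [CompleteSpace E]
    {F : β → γ → E} {g : β → ℝ} (hF : ∀ j, HasSum (fun n => ‖F j n‖) (g j)) (hg : Summable g) :
    Summable fun p : β × γ => F p.1 p.2 := by
  refine Summable.of_norm ((summable_prod_of_nonneg fun p => norm_nonneg _).2
    ⟨fun j => (hF j).summable, hg.congr fun j => (hF j).tsum_eq.symm⟩)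

lemma hasSum_choose_mul {R : Type*} [Semiring R] [TopologicalSpace R] (f : ℕ → R) (n : ℕ) :
    HasSum (fun j => (n.choose j : R) * f j) (∑ j ∈ Finset.range (n + 1), (n.choose j : R) * f j) :=
  hasSum_sum_of_ne_finset_zero fun j hj => by
    rw [Nat.choose_eq_zero_of_lt (by simpa using hj), Nat.cast_zero, zero_mul]

lemma hasSum_choose_mul_pow_mul_pow {R : Type*} [CommSemiring R] [TopologicalSpace R] (x y : R)
    (n : ℕ) : HasSum (fun j => (n.choose j : R) * (x ^ (n - j) * y ^ j)) ((x + y) ^ n) := by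
  convert hasSum_choose_mul (fun j => x ^ (n - j) * y ^ j) n using 1
  rw [add_comm x y, add_pow]
  exact Finset.sum_congr rfl fun j _ => by ring

lemma summable_mul_choose_mul_pow_mul_pow {c : ℕ → ℝ} {x y : ℝ}
    (hc : Summable fun n => |c n| * (|x| + |y|) ^ n) :
    Summable fun p : ℕ × ℕ => c p.1 * ((p.1.choose p.2 : ℝ) * (x ^ (p.1 - p.2) * y ^ p.2)) := by
  refine summable_prod_of_norm_hasSum
    (F := fun n j : ℕ => c n * ((n.choose j : ℝ) * (x ^ (n - j) * y ^ j))) (fun n => ?_) hc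
  simpa only [Real.norm_eq_abs, abs_mul, abs_pow, Nat.abs_cast] using
    (hasSum_choose_mul_pow_mul_pow |x| |y| n).mul_left |c n|

lemma eq_of_eventually_hasSum_mul_pow {b b' : ℕ → ℝ} {f : ℝ → ℝ}
    (hb : ∀ᶠ z in 𝓝 (0 : ℝ), HasSum (fun n => b n * z ^ n) (f z))
    (hb' : ∀ᶠ z in 𝓝 (0 : ℝ), HasSum (fun n => b' n * z ^ n) (f z)) : b = b' := by
  have hasFPowerSeriesAt {b : ℕ → ℝ} (hb : ∀ᶠ z in 𝓝 (0 : ℝ), HasSum (fun n => b n * z ^ n) (f z)) :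
      HasFPowerSeriesAt f (FormalMultilinearSeries.ofScalars ℝ b) 0 := by
    rw [hasFPowerSeriesAt_iff]
    filter_upwards [hb] with z hz
    simpa [FormalMultilinearSeries.coeff_ofScalars, mul_comm] using hz
  exact (FormalMultilinearSeries.ofScalars_series_injective ℝ ℝ)
    ((hasFPowerSeriesAt hb).eq_formalMultilinearSeries (hasFPowerSeriesAt hb'))

/-- Expand `(r + h) ^ n` by the binomial theorem and compare the coefficients of `h ^ j`. -/
lemma hasSum_choose_mul_pow_of_eventually_hasSum {c b : ℕ → ℝ} {R r : ℝ} (hr : |r| < R)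
    (hc : ∀ s, 0 ≤ s → s < R → Summable fun n => |c n| * s ^ n)
    (hb : ∀ᶠ h in 𝓝 (0 : ℝ), HasSum (fun j => b j * h ^ j) (∑' n, c n * (r + h) ^ n)) (j : ℕ) :
    HasSum (fun n => (n.choose j : ℝ) * r ^ (n - j) * c n) (b j) := by
  have summable_expansion {h : ℝ} (hh : |r| + |h| < R) :=
    summable_mul_choose_mul_pow_mul_pow (hc _ (by positivity) hh)
  have summable_coeff (j : ℕ) : Summable fun n : ℕ => (n.choose j : ℝ) * r ^ (n - j) * c n := by
    have hδ : 0 < (R - |r|) / 2 := by linarith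
    have hsection := (summable_expansion (h := (R - |r|) / 2)
      (by rw [abs_of_pos hδ]; linarith)).prod_symm.prod_factor j
    refine (hsection.mul_left (((R - |r|) / 2) ^ j)⁻¹).congr fun n => ?_
    simp only [Prod.swap]
    field_simp
  have near_zero : ∀ᶠ h in 𝓝 (0 : ℝ), |r| + |h| < R :=
    (by fun_prop : Continuous fun h : ℝ => |r| + |h|).continuousAt.eventually_lt_const
      (by simpa using hr)
  have expansion : ∀ᶠ h in 𝓝 (0 : ℝ), HasSum
      (fun j => (∑' n : ℕ, (n.choose j : ℝ) * r ^ (n - j) * c n) * h ^ j)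
      (∑' n, c n * (r + h) ^ n) := by
    filter_upwards [near_zero] with h hh
    have summable_at : Summable fun n => c n * (r + h) ^ n :=
      .of_norm <| (hc _ (abs_nonneg _) ((abs_add_le r h).trans_lt hh)).congr fun n => by
        rw [Real.norm_eq_abs, abs_mul, abs_pow]
    refine hasSum_comm_of_summable (summable_expansion hh)
      (fun n => (hasSum_choose_mul_pow_mul_pow r h n).mul_left (c n)) (fun j => ?_)
      summable_at.hasSum
    exact ((summable_coeff j).hasSum.mul_right (h ^ j)).congr_fun fun n => by ring
  rw [← congrFun (eq_of_eventually_hasSum_mul_pow expansion hb) j]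
  exact (summable_coeff j).hasSum

end DoubleSeries

/-! ### The Hille–Hardy formula -/

section HilleHardy

/-- The Laguerre polynomial `L_n^a` divided by `Γ(n+a+1)/n!`, see `laguerrePoly_eq`. In this
normalization the coefficients depend on `n` only through the binomial coefficient. -/
def laguerreReduced (a : ℝ) (n : ℕ) (X : ℝ) : ℝ :=
  ∑ j ∈ Finset.range (n + 1), (n.choose j : ℝ) * ((-X) ^ j / Real.Gamma (j + a + 1))

/-- The constant `Γ(n+a+1)/n!`, which is both the factor between `L_n^a` and `laguerreReduced a n`
and the square norm of `L_n^a` in `L²(x^a e^{-x} dx)`. -/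
def laguerreWeight (a : ℝ) (n : ℕ) : ℝ := Real.Gamma (n + a + 1) / (n.factorial : ℝ)

/-- The entire function `∑ z^m / (m! Γ(m+a+1))`, which is `z^{-a/2} I_a(2√z)` in terms of the
modified Bessel function `I_a`. -/
def besselSeries (a z : ℝ) : ℝ :=
  ∑' m : ℕ, z ^ m / ((m.factorial : ℝ) * Real.Gamma (m + a + 1))

lemma laguerrePoly_eq (n : ℕ) (a x : ℝ) :
    laguerrePoly n a x = laguerreWeight a n * laguerreReduced a n x := by
  rw [laguerrePoly, laguerreReduced, laguerreWeight, Finset.mul_sum]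
  refine Finset.sum_congr rfl fun j hj => ?_
  rw [Nat.cast_choose ℝ (Finset.mem_range_succ_iff.1 hj)]
  field_simp [Nat.factorial_ne_zero]

variable {a r : ℝ}

lemma Gamma_nat_add_pos (ha : -1 < a) (n : ℕ) : 0 < Real.Gamma (n + a + 1) :=
  Real.Gamma_pos_of_pos (by linarith [n.cast_nonneg (α := ℝ)])

lemma Gamma_nat_succ_add (ha : -1 < a) (n : ℕ) :
    Real.Gamma ((n + 1 : ℕ) + a + 1) = (n + a + 1) * Real.Gamma (n + a + 1) := by
  rw [← Real.Gamma_add_one (by linarith [n.cast_nonneg (α := ℝ)])]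
  congr 1
  push_cast
  ring

lemma Gamma_nat_add_eq_ascPochhammer_mul {b : ℝ} (hb : 0 < b) (n : ℕ) :
    Real.Gamma (n + b) = (ascPochhammer ℝ n).eval b * Real.Gamma b := by
  induction n with
  | zero => simp
  | succ n ih =>
    rw [ascPochhammer_succ_eval, Nat.cast_succ, add_right_comm, Real.Gamma_add_one (by positivity),
      ih]
    ring

lemma hasSum_Gamma_div_factorial_mul_pow {b : ℝ} (hb : 0 < b) (hr : |r| < 1) :
    HasSum (fun m : ℕ => Real.Gamma (m + b) / (m.factorial : ℝ) * r ^ m)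
      (Real.Gamma b * (1 - r) ^ (-b)) := by
  have hbinomial := (Real.one_div_one_sub_rpow_hasFPowerSeriesOnBall_zero b).hasSum
    (y := r) (by simpa [enorm_eq_nnnorm, ← NNReal.coe_lt_coe] using hr)
  simp only [FormalMultilinearSeries.ofScalars_apply_eq, zero_add, one_div] at hbinomial
  rw [Real.rpow_neg (by linarith [(abs_lt.1 hr).2])]
  refine (hbinomial.mul_left (Real.Gamma b)).congr_fun fun m => ?_
  have hpochhammer := Ring.factorial_nsmul_multichoose_eq_ascPochhammer b m
  rw [Ring.multichoose_eq, nsmul_eq_mul, Polynomial.ascPochhammer_smeval_eq_eval] at hpochhammer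
  rw [Gamma_nat_add_eq_ascPochhammer_mul hb m, ← hpochhammer, smul_eq_mul]
  field_simp [Nat.factorial_ne_zero]

lemma laguerreWeight_pos (ha : -1 < a) (n : ℕ) : 0 < laguerreWeight a n :=
  div_pos (Gamma_nat_add_pos ha n) (by positivity)

lemma abs_laguerreReduced_le (ha : -1 < a) (n : ℕ) (X : ℝ) :
    |laguerreReduced a n X| ≤ laguerreReduced a n (-|X|) := by
  refine (Finset.abs_sum_le_sum_abs _ _).trans_eq (Finset.sum_congr rfl fun j _ => ?_)
  rw [abs_mul, abs_div, abs_pow, abs_neg, neg_neg, abs_of_pos (Gamma_nat_add_pos ha j),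
    Nat.abs_cast]

lemma laguerreReduced_nonneg (ha : -1 < a) (n : ℕ) {X : ℝ} (hX : X ≤ 0) :
    0 ≤ laguerreReduced a n X :=
  Finset.sum_nonneg fun j _ => mul_nonneg (by positivity)
    (div_nonneg (pow_nonneg (by linarith) _) (Gamma_nat_add_pos ha j).le)

lemma hasSum_laguerreReduced (a : ℝ) (n : ℕ) (X : ℝ) :
    HasSum (fun j : ℕ => (n.choose j : ℝ) * ((-X) ^ j / Real.Gamma (j + a + 1)))
      (laguerreReduced a n X) :=
  hasSum_choose_mul _ n

lemma hasSum_laguerreWeight_mul_pow_mul_choose (ha : -1 < a) (hr : |r| < 1) (j : ℕ) :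
    HasSum (fun n : ℕ => laguerreWeight a n * r ^ n * (n.choose j : ℝ))
      (r ^ j / (j.factorial : ℝ) * (Real.Gamma (j + a + 1) * (1 - r) ^ (-(j + a + 1)))) := by
  have hnegBinomial := (hasSum_Gamma_div_factorial_mul_pow (b := j + a + 1)
    (by linarith [j.cast_nonneg (α := ℝ)]) hr).mul_left (r ^ j / (j.factorial : ℝ))
  refine ((add_left_injective j).hasSum_iff fun n hn => ?_).1
    (hnegBinomial.congr_fun fun m => ?_)
  · have hnj : n < j := not_le.1 fun hjn => hn ⟨n - j, Nat.sub_add_cancel hjn⟩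
    rw [Nat.choose_eq_zero_of_lt hnj, Nat.cast_zero, mul_zero]
  · simp only [Function.comp, laguerreWeight]
    rw [Nat.cast_choose ℝ (Nat.le_add_left j m), Nat.add_sub_cancel, pow_add,
      show ((m + j : ℕ) : ℝ) + a + 1 = m + (j + a + 1) by push_cast; ring]
    field_simp [Nat.factorial_ne_zero]

lemma hasSum_laguerre_generating_by_degree (ha : -1 < a) (hr : |r| < 1) (X : ℝ) :
    HasSum (fun j : ℕ => (-X) ^ j / Real.Gamma (j + a + 1) *
      (r ^ j / (j.factorial : ℝ) * (Real.Gamma (j + a + 1) * (1 - r) ^ (-(j + a + 1)))))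
      ((1 - r) ^ (-(a + 1)) * Real.exp (-X * r / (1 - r))) := by
  have hr1 : 0 < 1 - r := by linarith [(abs_lt.1 hr).2]
  have hexp := (NormedSpace.expSeries_div_hasSum_exp (-X * r / (1 - r))).mul_left
    ((1 - r) ^ (-(a + 1)))
  rw [← Real.exp_eq_exp_ℝ] at hexp
  refine hexp.congr_fun fun j => ?_
  have hΓ := (Gamma_nat_add_pos ha j).ne'
  rw [show -((j : ℝ) + a + 1) = -(a + 1) - j by ring, Real.rpow_sub hr1, Real.rpow_natCast,
    div_pow, mul_pow]
  field_simp

lemma hasSum_laguerre_generating (ha : -1 < a) (hr : |r| < 1) (X : ℝ) :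
    HasSum (fun n : ℕ => laguerreWeight a n * laguerreReduced a n X * r ^ n)
      ((1 - r) ^ (-(a + 1)) * Real.exp (-X * r / (1 - r))) := by
  let F (j n : ℕ) : ℝ :=
    (-X) ^ j / Real.Gamma (j + a + 1) * (laguerreWeight a n * r ^ n * (n.choose j : ℝ))
  have hr' : |(|r|)| < 1 := by rwa [abs_abs]
  have hasSum_norm (j : ℕ) : HasSum (fun n => ‖F j n‖) _ :=
    ((hasSum_laguerreWeight_mul_pow_mul_choose ha hr' j).mul_left
      ((-(-|X|)) ^ j / Real.Gamma (j + a + 1))).congr_fun fun n => by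
        simp only [F]
        rw [Real.norm_eq_abs, abs_mul, abs_mul, abs_mul, abs_div, abs_pow, abs_pow, abs_neg,
          neg_neg, Nat.abs_cast, abs_of_pos (Gamma_nat_add_pos ha j),
          abs_of_pos (laguerreWeight_pos ha n)]
  refine hasSum_comm_of_summable
    (summable_prod_of_norm_hasSum hasSum_norm
      (hasSum_laguerre_generating_by_degree ha hr' (-|X|)).summable)
    (fun j => (hasSum_laguerreWeight_mul_pow_mul_choose ha hr j).mul_left _) (fun n => ?_)
    (hasSum_laguerre_generating_by_degree ha hr X)
  rw [mul_right_comm]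
  exact ((hasSum_laguerreReduced a n X).mul_left (laguerreWeight a n * r ^ n)).congr_fun
    fun j => by simp only [F]; ring

lemma summable_laguerreWeight_mul_abs_laguerreReduced (ha : -1 < a) (hr0 : 0 ≤ r) (hr1 : r < 1)
    (X : ℝ) : Summable fun n : ℕ => laguerreWeight a n * |laguerreReduced a n X| * r ^ n := by
  have hw n := (laguerreWeight_pos ha n).le
  refine Summable.of_nonneg_of_le
    (fun n => mul_nonneg (mul_nonneg (hw n) (abs_nonneg _)) (pow_nonneg hr0 n)) (fun n => ?_)
    (hasSum_laguerre_generating ha (abs_lt.2 ⟨by linarith, hr1⟩) (-|X|)).summable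
  have := hw n
  gcongr
  exact abs_laguerreReduced_le ha n X

lemma summable_inv_laguerreWeight_mul_pow (ha : -1 < a) (hr0 : 0 ≤ r) (hr1 : r < 1) :
    Summable fun n : ℕ => (laguerreWeight a n)⁻¹ * r ^ n := by
  rcases hr0.eq_or_lt with rfl | hr0
  · exact summable_of_ne_finset_zero (s := {0}) fun n hn => by
      rw [zero_pow (by simpa using hn), mul_zero]
  have hterm n : 0 < (laguerreWeight a n)⁻¹ * r ^ n :=
    mul_pos (inv_pos.2 (laguerreWeight_pos ha n)) (pow_pos hr0 n)
  refine summable_of_ratio_test_tendsto_lt_one hr1 (.of_forall fun n => (hterm n).ne') ?_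
  have hratio : Tendsto (fun n : ℕ => (1 + 1 * (n : ℝ)) / (a + 1 + 1 * n) * r) atTop (𝓝 r) := by
    simpa only [div_one, one_mul] using
      (tendsto_add_mul_div_add_mul_atTop_nhds (1 : ℝ) (a + 1) 1 one_ne_zero).mul_const r
  refine hratio.congr fun n => ?_
  have hna : (0 : ℝ) < n + a + 1 := by linarith [n.cast_nonneg (α := ℝ)]
  rw [show a + 1 + 1 * (n : ℝ) = n + a + 1 by ring]
  rw [Real.norm_of_nonneg (hterm _).le, Real.norm_of_nonneg (hterm _).le, laguerreWeight,
    laguerreWeight, Gamma_nat_succ_add ha, Nat.factorial_succ, pow_succ]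
  push_cast
  field_simp
  ring

lemma exists_inv_laguerreWeight_mul_pow_le (ha : -1 < a) (hr0 : 0 ≤ r) (hr1 : r < 1) :
    ∃ K : ℝ, ∀ n : ℕ, (laguerreWeight a n)⁻¹ * r ^ n ≤ K :=
  ⟨_, fun n => (summable_inv_laguerreWeight_mul_pow ha hr0 hr1).le_tsum n fun m _ =>
    mul_nonneg (inv_nonneg.2 (laguerreWeight_pos ha m).le) (pow_nonneg hr0 m)⟩

lemma summable_besselSeries (ha : -1 < a) (z : ℝ) :
    Summable fun m : ℕ => ‖z ^ m / ((m.factorial : ℝ) * Real.Gamma (m + a + 1))‖ := by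
  obtain ⟨K, hK⟩ := exists_inv_laguerreWeight_mul_pow_le ha (r := 1 / 2) (by norm_num) (by norm_num)
  refine Summable.of_nonneg_of_le (fun m => norm_nonneg _) (fun m => ?_)
    ((Real.summable_pow_div_factorial (2 * |z|)).mul_left K)
  have hΓ := Gamma_nat_add_pos ha m
  have hfact : (1 : ℝ) ≤ m.factorial := by exact_mod_cast Nat.factorial_pos m
  calc ‖z ^ m / ((m.factorial : ℝ) * Real.Gamma (m + a + 1))‖
      = (laguerreWeight a m)⁻¹ * (1 / 2) ^ m *
          ((2 * |z|) ^ m / (m.factorial * m.factorial : ℝ)) := by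
        rw [Real.norm_eq_abs, abs_div, abs_pow, abs_of_pos (by positivity :
          0 < (m.factorial : ℝ) * Real.Gamma (m + a + 1)), laguerreWeight, mul_pow, one_div,
          inv_pow]
        field_simp
    _ ≤ K * ((2 * |z|) ^ m / m.factorial) := by
        have hK0 := (mul_pos (inv_pos.2 (laguerreWeight_pos ha m))
          (by positivity : (0 : ℝ) < (1 / 2) ^ m)).le
        refine mul_le_mul (hK m) ?_ (by positivity) (hK0.trans (hK m))
        gcongr
        exact le_mul_of_one_le_left (by positivity) hfact

lemma besselSeries_nonneg (ha : -1 < a) {z : ℝ} (hz : 0 ≤ z) : 0 ≤ besselSeries a z :=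
  tsum_nonneg fun m => div_nonneg (by positivity)
    (mul_nonneg (by positivity) (Gamma_nat_add_pos ha m).le)

lemma Gamma_mul_factorial_two_mul_le (ha : -1 / 2 ≤ a) (m : ℕ) :
    Real.Gamma (a + 1) * ((2 * m).factorial : ℝ) ≤
      Real.Gamma (m + a + 1) * (m.factorial : ℝ) * 4 ^ m := by
  induction m with
  | zero => simp
  | succ m ih =>
    rw [Gamma_nat_succ_add (by linarith), show 2 * (m + 1) = 2 * m + 1 + 1 by ring,
      Nat.factorial_succ, Nat.factorial_succ, Nat.factorial_succ]
    push_cast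
    calc Real.Gamma (a + 1) * ((2 * m + 1 + 1) * ((2 * m + 1) * ((2 * m).factorial : ℝ)))
        = (2 * m + 1 + 1) * (2 * m + 1) * (Real.Gamma (a + 1) * ((2 * m).factorial : ℝ)) := by ring
      _ ≤ (2 * m + 1 + 1) * (2 * (m + a + 1)) *
          (Real.Gamma (m + a + 1) * (m.factorial : ℝ) * 4 ^ m) := by
        have hΓ0 : 0 < Real.Gamma (a + 1) := Real.Gamma_pos_of_pos (by linarith)
        refine mul_le_mul (mul_le_mul_of_nonneg_left ?_ (by positivity)) ih (by positivity) ?_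
        · linarith
        · exact mul_nonneg (by positivity) (by linarith [m.cast_nonneg (α := ℝ)])
      _ = _ := by ring

lemma besselSeries_sq_le (ha : -1 / 2 ≤ a) (w : ℝ) :
    besselSeries a (w ^ 2) ≤ 1 / Real.Gamma (a + 1) * Real.cosh (2 * w) := by
  have hcosh := (Real.hasSum_cosh (2 * w)).mul_left (1 / Real.Gamma (a + 1))
  rw [← hcosh.tsum_eq]
  refine (summable_besselSeries (by linarith) (w ^ 2)).of_norm.tsum_le_tsum (fun m => ?_)
    hcosh.summable
  have hΓ := Gamma_nat_add_pos (by linarith : -1 < a) m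
  have hΓ0 : 0 < Real.Gamma (a + 1) := Real.Gamma_pos_of_pos (by linarith)
  rw [one_div_mul_eq_div, div_div, div_le_div_iff₀ (by positivity) (by positivity)]
  calc (w ^ 2) ^ m * ((2 * m).factorial * Real.Gamma (a + 1))
      = (w ^ 2) ^ m * (Real.Gamma (a + 1) * (2 * m).factorial) := by ring
    _ ≤ (w ^ 2) ^ m * (Real.Gamma (m + a + 1) * m.factorial * 4 ^ m) := by
        exact mul_le_mul_of_nonneg_left (Gamma_mul_factorial_two_mul_le ha m) (by positivity)
    _ = (2 * w) ^ (2 * m) * (m.factorial * Real.Gamma (m + a + 1)) := by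
        rw [pow_mul, mul_pow, mul_pow]
        norm_num
        ring

lemma besselSeries_sq_le_exp (ha : -1 / 2 ≤ a) {w : ℝ} (hw : 0 ≤ w) :
    besselSeries a (w ^ 2) ≤ 1 / Real.Gamma (a + 1) * Real.exp (2 * w) := by
  refine (besselSeries_sq_le ha w).trans ?_
  have hΓ : 0 < Real.Gamma (a + 1) := Real.Gamma_pos_of_pos (by linarith)
  gcongr
  rw [← Real.cosh_add_sinh]
  exact le_add_of_nonneg_right (Real.sinh_nonneg_iff.2 (by positivity))

lemma hasSum_laguerreReduced_mul_pow_div_factorial (ha : -1 < a) (X s : ℝ) :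
    HasSum (fun n : ℕ => laguerreReduced a n X * s ^ n / (n.factorial : ℝ))
      (Real.exp s * besselSeries a (-X * s)) := by
  have hcauchy := hasSum_sum_range_mul_of_summable_norm (summable_besselSeries ha (-X * s))
    (NormedSpace.expSeries_div_hasSum_exp s).summable.norm
  rw [mul_comm, Real.exp_eq_exp_ℝ, ← (NormedSpace.expSeries_div_hasSum_exp s).tsum_eq]
  refine hcauchy.congr_fun fun n => ?_
  rw [laguerreReduced, Finset.sum_mul, Finset.sum_div]
  refine Finset.sum_congr rfl fun j hj => ?_
  have hjn : j ≤ n := Finset.mem_range_succ_iff.1 hj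
  have hΓ := (Gamma_nat_add_pos ha j).ne'
  rw [Nat.cast_choose ℝ hjn, mul_pow, ← pow_mul_pow_sub s hjn]
  field_simp [Nat.factorial_ne_zero]

/-- The generating function at `r + h` is the one at `r` times the one with parameters
`X / (1 - r)` and `h / (1 - r)`. -/
lemma hasSum_laguerre_generating_recentered (ha : -1 < a) {h : ℝ} (hrh : |r| + |h| < 1) (X : ℝ) :
    HasSum (fun j => (1 - r) ^ (-(a + 1)) * Real.exp (-X * r / (1 - r)) *
        (laguerreWeight a j * laguerreReduced a j (X / (1 - r)) / (1 - r) ^ j) * h ^ j)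
      ((1 - (r + h)) ^ (-(a + 1)) * Real.exp (-X * (r + h) / (1 - (r + h)))) := by
  have hr1 : 0 < 1 - r := by linarith [le_abs_self r, abs_nonneg h]
  have hlt : |h / (1 - r)| < 1 := by
    rw [abs_div, abs_of_pos hr1, div_lt_one hr1]
    linarith [le_abs_self r]
  have hpos : 0 < 1 - h / (1 - r) := by linarith [(abs_lt.1 hlt).2]
  have factor : 1 - (r + h) = (1 - r) * (1 - h / (1 - r)) := by field_simp; ring
  have exponent : -X * (r + h) / (1 - (r + h)) = -X * r / (1 - r) +
      -(X / (1 - r)) * (h / (1 - r)) / (1 - h / (1 - r)) := by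
    have hne : 1 - r - h ≠ 0 := by rw [sub_sub, factor]; positivity
    rw [show 1 - h / (1 - r) = (1 - r - h) / (1 - r) by field_simp, ← sub_sub]
    field_simp
    ring
  rw [exponent, Real.exp_add, factor, Real.mul_rpow hr1.le hpos.le, mul_mul_mul_comm]
  refine ((hasSum_laguerre_generating ha hlt (X / (1 - r))).mul_left _).congr_fun fun j => ?_
  rw [div_pow]
  ring

lemma hasSum_choose_mul_pow_mul_laguerre (ha : -1 < a) (hr : |r| < 1) (X : ℝ) (j : ℕ) :
    HasSum (fun n : ℕ => (n.choose j : ℝ) * r ^ (n - j) *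
        (laguerreWeight a n * laguerreReduced a n X))
      ((1 - r) ^ (-(a + 1)) * Real.exp (-X * r / (1 - r)) *
        (laguerreWeight a j * laguerreReduced a j (X / (1 - r)) / (1 - r) ^ j)) := by
  refine hasSum_choose_mul_pow_of_eventually_hasSum
    (c := fun n => laguerreWeight a n * laguerreReduced a n X)
    (b := fun j => (1 - r) ^ (-(a + 1)) * Real.exp (-X * r / (1 - r)) *
      (laguerreWeight a j * laguerreReduced a j (X / (1 - r)) / (1 - r) ^ j))
    hr (fun s hs0 hs1 => ?_) ?_ j
  · exact (summable_laguerreWeight_mul_abs_laguerreReduced ha hs0 hs1 X).congr fun n => by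
      rw [abs_mul, abs_of_pos (laguerreWeight_pos ha n)]
  · have near_zero : ∀ᶠ h in 𝓝 (0 : ℝ), |r| + |h| < 1 :=
      (by fun_prop : Continuous fun h : ℝ => |r| + |h|).continuousAt.eventually_lt_const
        (by simpa using hr)
    filter_upwards [near_zero] with h hh
    rw [(hasSum_laguerre_generating ha ((abs_add_le r h).trans_lt hh) X).tsum_eq]
    exact hasSum_laguerre_generating_recentered ha hh X

lemma summable_laguerreReduced_mul_laguerreReduced (ha : -1 < a) (hr0 : 0 ≤ r) (hr1 : r < 1)
    (X Y : ℝ) : Summable fun n : ℕ =>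
      laguerreWeight a n * |laguerreReduced a n X| * |laguerreReduced a n Y| * r ^ n := by
  obtain ⟨ρ, hρ0, hρ1, rfl⟩ : ∃ ρ : ℝ, 0 ≤ ρ ∧ ρ < 1 ∧ ρ ^ 3 = r :=
    ⟨r ^ ((3 : ℕ) : ℝ)⁻¹, Real.rpow_nonneg hr0 _,
      Real.rpow_lt_one hr0 hr1 (by positivity), Real.rpow_inv_natCast_pow hr0 (by norm_num)⟩
  obtain ⟨K, hK⟩ := exists_inv_laguerreWeight_mul_pow_le ha hρ0 hρ1
  have summable_X := summable_laguerreWeight_mul_abs_laguerreReduced ha hρ0 hρ1 X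
  have summable_Y := summable_laguerreWeight_mul_abs_laguerreReduced ha hρ0 hρ1 Y
  have hw := laguerreWeight_pos ha
  have nonneg_Y n : 0 ≤ laguerreWeight a n * |laguerreReduced a n Y| * ρ ^ n := by
    have := (hw n).le
    positivity
  refine Summable.of_nonneg_of_le (fun n => by have := (hw n).le; positivity) (fun n => ?_)
    (summable_X.mul_right ((∑' n, laguerreWeight a n * |laguerreReduced a n Y| * ρ ^ n) * K))
  have hwn := hw n
  calc laguerreWeight a n * |laguerreReduced a n X| * |laguerreReduced a n Y| * (ρ ^ 3) ^ n
      = (laguerreWeight a n * |laguerreReduced a n X| * ρ ^ n) *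
        ((laguerreWeight a n * |laguerreReduced a n Y| * ρ ^ n) *
          ((laguerreWeight a n)⁻¹ * ρ ^ n)) := by
        rw [← pow_mul, mul_comm 3 n, pow_mul]
        field_simp
    _ ≤ _ := by
        refine mul_le_mul_of_nonneg_left (mul_le_mul ?_ (hK n) (by positivity) ?_) (by positivity)
        · exact summable_Y.le_tsum n fun m _ => nonneg_Y m
        · exact tsum_nonneg nonneg_Y

lemma summable_sqrt_laguerreWeight_mul_abs_laguerreReduced (ha : -1 < a) (hr0 : 0 ≤ r)
    (hr1 : r < 1) (X : ℝ) :
    Summable fun n : ℕ => √(laguerreWeight a n) * |laguerreReduced a n X| * r ^ n := by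
  obtain ⟨ρ, hρ0, hρ1, rfl⟩ : ∃ ρ : ℝ, 0 ≤ ρ ∧ ρ < 1 ∧ ρ ^ 2 = r :=
    ⟨√r, Real.sqrt_nonneg r, by rwa [Real.sqrt_lt' one_pos, one_pow], Real.sq_sqrt hr0⟩
  obtain ⟨K, hK⟩ := exists_inv_laguerreWeight_mul_pow_le ha hρ0 hρ1
  have hw := laguerreWeight_pos ha
  refine Summable.of_nonneg_of_le (fun n => by have := (hw n).le; positivity) (fun n => ?_)
    ((summable_laguerreWeight_mul_abs_laguerreReduced ha hρ0 hρ1 X).mul_right (1 + K))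
  have hwn := hw n
  have sqrt_le : √(laguerreWeight a n) ≤ laguerreWeight a n * (1 + (laguerreWeight a n)⁻¹) := by
    rw [mul_add, mul_inv_cancel₀ hwn.ne', mul_one]
    nlinarith [Real.sq_sqrt hwn.le, sq_nonneg (√(laguerreWeight a n) - 1)]
  calc √(laguerreWeight a n) * |laguerreReduced a n X| * (ρ ^ 2) ^ n
      ≤ laguerreWeight a n * (1 + (laguerreWeight a n)⁻¹) * |laguerreReduced a n X| *
        (ρ ^ 2) ^ n := by gcongr
    _ = (laguerreWeight a n * |laguerreReduced a n X| * ρ ^ n) *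
          (ρ ^ n + (laguerreWeight a n)⁻¹ * ρ ^ n) := by
        rw [← pow_mul, mul_comm 2 n, pow_mul]
        ring
    _ ≤ _ := by
        gcongr
        · exact pow_le_one₀ hρ0 hρ1.le
        · exact hK n

lemma pow_mul_choose_mul_pow_sub {R : Type*} [CommSemiring R] (r : R) (n j : ℕ) :
    r ^ j * ((n.choose j : R) * r ^ (n - j)) = (n.choose j : R) * r ^ n := by
  rcases le_or_gt j n with hjn | hnj
  · rw [← pow_mul_pow_sub r hjn]
    ring
  · simp [Nat.choose_eq_zero_of_lt hnj]

lemma summable_hille_hardy_expansion (ha : -1 < a) (hr : |r| < 1) (X Y : ℝ) :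
    Summable fun p : ℕ × ℕ => laguerreWeight a p.1 * laguerreReduced a p.1 X * r ^ p.1 *
      ((p.1.choose p.2 : ℝ) * ((-Y) ^ p.2 / Real.Gamma (p.2 + a + 1))) := by
  have hsum : Summable fun n =>
      laguerreWeight a n * |laguerreReduced a n X| * |r| ^ n * laguerreReduced a n (-|Y|) := by
    refine (summable_laguerreReduced_mul_laguerreReduced ha (abs_nonneg r) hr X (-|Y|)).congr
      fun n => ?_
    rw [abs_of_nonneg (laguerreReduced_nonneg ha n (by simp : -|Y| ≤ 0))]
    ring
  refine summable_prod_of_norm_hasSum (F := fun n j : ℕ =>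
    laguerreWeight a n * laguerreReduced a n X * r ^ n *
      ((n.choose j : ℝ) * ((-Y) ^ j / Real.Gamma (j + a + 1)))) (fun n => ?_) hsum
  refine ((hasSum_laguerreReduced a n (-|Y|)).mul_left _).congr_fun fun j => ?_
  rw [Real.norm_eq_abs, abs_mul, abs_mul, abs_mul, abs_mul, abs_div, abs_pow, abs_pow, abs_neg,
    neg_neg, Nat.abs_cast, abs_of_pos (laguerreWeight_pos ha _),
    abs_of_pos (Gamma_nat_add_pos ha _)]

/-- Expand `laguerreReduced a n Y` in powers of `Y` and sum over `n` first. -/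
theorem hasSum_hille_hardy (ha : -1 < a) (hr : |r| < 1) (X Y : ℝ) :
    HasSum (fun n : ℕ => laguerreWeight a n * laguerreReduced a n X * laguerreReduced a n Y * r ^ n)
      ((1 - r) ^ (-(a + 1)) * Real.exp (-(X + Y) * r / (1 - r)) *
        besselSeries a (X * Y * r / (1 - r) ^ 2)) := by
  have hr1 : 0 < 1 - r := by linarith [(abs_lt.1 hr).2]
  have inner_sum (j : ℕ) : HasSum (fun n : ℕ => laguerreWeight a n * laguerreReduced a n X * r ^ n *
      ((n.choose j : ℝ) * ((-Y) ^ j / Real.Gamma (j + a + 1)))) _ :=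
    ((hasSum_choose_mul_pow_mul_laguerre ha hr X j).mul_left
      ((-Y) ^ j / Real.Gamma (j + a + 1) * r ^ j)).congr_fun fun n => by
        linear_combination -(laguerreWeight a n * laguerreReduced a n X *
          ((-Y) ^ j / Real.Gamma (j + a + 1))) * pow_mul_choose_mul_pow_sub r n j
  refine hasSum_comm_of_summable (summable_hille_hardy_expansion ha hr X Y).prod_symm inner_sum
    (fun n => ?_) ?_
  · simpa only [mul_right_comm _ (r ^ n)] using (hasSum_laguerreReduced a n Y).mul_left
      (laguerreWeight a n * laguerreReduced a n X * r ^ n)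
  · have hbessel := (hasSum_laguerreReduced_mul_pow_div_factorial ha (X / (1 - r))
      (-Y * r / (1 - r))).mul_left ((1 - r) ^ (-(a + 1)) * Real.exp (-X * r / (1 - r)))
    rw [show -(X + Y) * r / (1 - r) = -X * r / (1 - r) + -Y * r / (1 - r) by ring, Real.exp_add,
      ← mul_assoc, mul_assoc _ (Real.exp (-Y * r / (1 - r))),
      show X * Y * r / (1 - r) ^ 2 = -(X / (1 - r)) * (-Y * r / (1 - r)) by field_simp]
    refine hbessel.congr_fun fun j => ?_
    have hΓ := (Gamma_nat_add_pos ha j).ne'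
    simp only [laguerreWeight, div_pow, mul_pow]
    field_simp

end HilleHardy

/-! ### Laguerre functions on the half-line -/

section LaguerreFunctions

variable {a : ℝ}

lemma laguerreHermite1_eq (n : ℕ) (a u : ℝ) :
    laguerreHermite1 n a u = √2 * √(laguerreWeight a n) * laguerreReduced a n (u ^ 2) *
      u ^ (a + 1 / 2) * Real.exp (-u ^ 2 / 2) := by
  have normalization : √(Real.Gamma (n + 1) / Real.Gamma (n + a + 1)) * laguerreWeight a n
      = √(laguerreWeight a n) := by
    rw [Real.Gamma_nat_eq_factorial, ← inv_div, Real.sqrt_inv]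
    change (√(laguerreWeight a n))⁻¹ * laguerreWeight a n = _
    rw [inv_mul_eq_div, Real.div_sqrt]
  rw [laguerreHermite1, laguerreNormalized, laguerrePoly_eq, ← normalization]
  ring

lemma measurable_laguerreHermite1 (n : ℕ) (a : ℝ) : Measurable (laguerreHermite1 n a) := by
  unfold laguerreHermite1 laguerreNormalized laguerrePoly
  fun_prop

lemma summable_abs_laguerreHermite1_mul_pow {r : ℝ} (ha : -1 < a) (hr0 : 0 ≤ r) (hr1 : r < 1)
    (u : ℝ) : Summable fun n : ℕ => |laguerreHermite1 n a u| * r ^ n := by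
  refine ((summable_sqrt_laguerreWeight_mul_abs_laguerreReduced ha hr0 hr1 (u ^ 2)).mul_left
    (√2 * |u ^ (a + 1 / 2)| * Real.exp (-u ^ 2 / 2))).congr fun n => ?_
  rw [laguerreHermite1_eq, abs_mul, abs_mul, abs_mul, abs_mul,
    abs_of_nonneg (Real.sqrt_nonneg _), abs_of_nonneg (Real.sqrt_nonneg _), Real.abs_exp]
  ring

lemma fwdDiff_iter_ascPochhammer {n j : ℕ} (hj : j ≤ n) (y : ℝ) :
    (fwdDiff (1 : ℝ))^[n] (ascPochhammer ℝ j).eval y = if j = n then (n.factorial : ℝ) else 0 := by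
  split_ifs with h
  · subst h
    have leading := congrFun (Polynomial.fwdDiff_iter_degree_eq_factorial (ascPochhammer ℝ j)) y
    rw [ascPochhammer_natDegree, (monic_ascPochhammer ℝ j).leadingCoeff] at leading
    simpa using leading
  · rw [Polynomial.fwdDiff_iter_eq_zero_of_degree_lt (by rw [ascPochhammer_natDegree]; omega),
      Pi.zero_apply]

lemma sum_neg_one_pow_mul_choose_mul_ascPochhammer {n j : ℕ} (hj : j ≤ n) (y : ℝ) :
    ∑ i ∈ Finset.range (n + 1), (-1 : ℝ) ^ i * (n.choose i : ℝ) *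
      (ascPochhammer ℝ j).eval (i + y) = if j = n then (-1) ^ n * (n.factorial : ℝ) else 0 := by
  rw [← mul_ite_zero, ← fwdDiff_iter_ascPochhammer hj y, fwdDiff_iter_eq_sum_shift, Finset.mul_sum]
  refine Finset.sum_congr rfl fun i hi => ?_
  have hin : i ≤ n := Finset.mem_range_succ_iff.1 hi
  have sign : (-1 : ℝ) ^ n * (-1) ^ (n - i) = (-1) ^ i := by
    rw [← pow_mul_pow_sub _ hin, mul_assoc, ← mul_pow, neg_one_mul, neg_neg, one_pow, mul_one]
  rw [zsmul_eq_mul, nsmul_eq_mul, mul_one, add_comm y, ← sign]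
  push_cast
  ring

lemma integrableOn_rpow_mul_exp_neg_sq {s : ℝ} (hs : -1 < s) :
    IntegrableOn (fun u : ℝ => u ^ s * Real.exp (-u ^ 2)) (Set.Ioi 0) := by
  simpa using integrableOn_rpow_mul_exp_neg_mul_sq one_pos hs

lemma integral_rpow_mul_exp_neg_sq {s : ℝ} (hs : -1 < s) :
    ∫ u in Set.Ioi (0 : ℝ), u ^ s * Real.exp (-u ^ 2) = 1 / 2 * Real.Gamma ((s + 1) / 2) := by
  simpa using integral_rpow_mul_exp_neg_rpow (p := 2) two_pos hs

lemma neg_one_lt_gaussian_exponent (ha : -1 < a) (i j : ℕ) :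
    -1 < (2 * i + 2 * j + 2 * a + 1 : ℝ) := by
  linarith [i.cast_nonneg (α := ℝ), j.cast_nonneg (α := ℝ)]

lemma laguerreReduced_mul_gaussian_eq_sum (a : ℝ) (n j : ℕ) {u : ℝ} (hu : 0 < u) :
    laguerreReduced a n (u ^ 2) * (u ^ (2 * j + 2 * a + 1) * Real.exp (-u ^ 2)) =
      ∑ i ∈ Finset.range (n + 1), (n.choose i : ℝ) * (-1) ^ i / Real.Gamma (i + a + 1) *
        (u ^ (2 * i + 2 * j + 2 * a + 1) * Real.exp (-u ^ 2)) := by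
  rw [laguerreReduced, Finset.sum_mul]
  refine Finset.sum_congr rfl fun i _ => ?_
  rw [show (2 * i + 2 * j + 2 * a + 1 : ℝ) = (2 * i : ℕ) + (2 * j + 2 * a + 1) by push_cast; ring,
    Real.rpow_add hu (2 * i : ℕ), Real.rpow_natCast, neg_pow, pow_mul]
  ring

lemma integrableOn_laguerreReduced_mul_gaussian (ha : -1 < a) (n j : ℕ) :
    IntegrableOn (fun u : ℝ => laguerreReduced a n (u ^ 2) *
      (u ^ (2 * j + 2 * a + 1) * Real.exp (-u ^ 2))) (Set.Ioi 0) :=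
  IntegrableOn.congr_fun
    (integrable_finsetSum _ fun i _ =>
      (integrableOn_rpow_mul_exp_neg_sq (neg_one_lt_gaussian_exponent ha i j)).const_mul _)
    (fun _ hu => (laguerreReduced_mul_gaussian_eq_sum a n j hu).symm) measurableSet_Ioi

/-- The moments of order `j` are `n`-th finite differences of a polynomial of degree `j`. -/
lemma integral_laguerreReduced_mul_gaussian (ha : -1 < a) {n j : ℕ} (hj : j ≤ n) :
    ∫ u in Set.Ioi (0 : ℝ), laguerreReduced a n (u ^ 2) *
      (u ^ (2 * j + 2 * a + 1) * Real.exp (-u ^ 2)) =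
      if j = n then (-1) ^ n * (n.factorial : ℝ) / 2 else 0 := by
  rw [setIntegral_congr_fun measurableSet_Ioi fun u hu =>
      laguerreReduced_mul_gaussian_eq_sum a n j hu, integral_finsetSum _ fun i _ =>
      (integrableOn_rpow_mul_exp_neg_sq (neg_one_lt_gaussian_exponent ha i j)).const_mul _,
    show (if j = n then (-1) ^ n * (n.factorial : ℝ) / 2 else 0) =
      (if j = n then (-1) ^ n * (n.factorial : ℝ) else 0) / 2 by rw [ite_div, zero_div],
    ← sum_neg_one_pow_mul_choose_mul_ascPochhammer hj (a + 1), Finset.sum_div]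
  refine Finset.sum_congr rfl fun i _ => ?_
  have hΓ := Gamma_nat_add_pos ha i
  rw [integral_const_mul, integral_rpow_mul_exp_neg_sq (neg_one_lt_gaussian_exponent ha i j),
    show ((2 * i + 2 * j + 2 * a + 1 + 1) / 2 : ℝ) = j + (i + a + 1) by ring,
    Gamma_nat_add_eq_ascPochhammer_mul (by linarith [i.cast_nonneg (α := ℝ)]), ← add_assoc (i : ℝ)]
  field_simp

lemma laguerreHermite1_mul_eq_sum (a : ℝ) (n m : ℕ) {u : ℝ} (hu : 0 < u) :
    laguerreHermite1 n a u * laguerreHermite1 m a u =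
      2 * √(laguerreWeight a n) * √(laguerreWeight a m) * ∑ j ∈ Finset.range (m + 1),
        (m.choose j : ℝ) * (-1) ^ j / Real.Gamma (j + a + 1) * (laguerreReduced a n (u ^ 2) *
        (u ^ (2 * j + 2 * a + 1) * Real.exp (-u ^ 2))) := by
  have expansion : laguerreReduced a m (u ^ 2) * (u ^ (2 * a + 1) * Real.exp (-u ^ 2)) =
      ∑ j ∈ Finset.range (m + 1), (m.choose j : ℝ) * (-1) ^ j / Real.Gamma (j + a + 1) *
        (u ^ (2 * j + 2 * a + 1) * Real.exp (-u ^ 2)) := by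
    simpa using laguerreReduced_mul_gaussian_eq_sum a m 0 hu
  have rpow_split : u ^ (2 * a + 1) = u ^ (a + 1 / 2) * u ^ (a + 1 / 2) := by
    rw [← Real.rpow_add hu]
    ring_nf
  have exp_split : Real.exp (-u ^ 2) = Real.exp (-u ^ 2 / 2) * Real.exp (-u ^ 2 / 2) := by
    rw [← Real.exp_add, add_halves]
  simp only [mul_left_comm _ (laguerreReduced a n (u ^ 2))]
  rw [← Finset.mul_sum, ← expansion, laguerreHermite1_eq, laguerreHermite1_eq, rpow_split,
    exp_split]
  linear_combination (√(laguerreWeight a n) * √(laguerreWeight a m) * laguerreReduced a n (u ^ 2) *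
    laguerreReduced a m (u ^ 2) * u ^ (a + 1 / 2) * u ^ (a + 1 / 2) * Real.exp (-u ^ 2 / 2) *
    Real.exp (-u ^ 2 / 2)) * (Real.mul_self_sqrt (zero_le_two : (0 : ℝ) ≤ 2))

lemma integrableOn_laguerreHermite1_mul (ha : -1 < a) (n m : ℕ) :
    IntegrableOn (fun u => laguerreHermite1 n a u * laguerreHermite1 m a u) (Set.Ioi 0) :=
  IntegrableOn.congr_fun ((integrable_finsetSum _ fun i _ =>
      (integrableOn_laguerreReduced_mul_gaussian ha n i).const_mul _).const_mul _)
    (fun _ hu => (laguerreHermite1_mul_eq_sum a n m hu).symm) measurableSet_Ioi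

/-- `laguerreHermite1 n a` is orthogonal to all lower-order terms of `laguerreHermite1 m a`, so
only the leading one, present when `m = n`, contributes. -/
lemma integral_laguerreHermite1_mul (ha : -1 < a) (n m : ℕ) :
    ∫ u in Set.Ioi (0 : ℝ), laguerreHermite1 n a u * laguerreHermite1 m a u =
      if n = m then 1 else 0 := by
  wlog hmn : m ≤ n generalizing n m
  · have swapped := this m n (by omega)
    simp only [mul_comm (laguerreHermite1 m a _), eq_comm (a := m)] at swapped
    exact swapped
  rw [setIntegral_congr_fun measurableSet_Ioi fun u hu => laguerreHermite1_mul_eq_sum a n m hu,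
    integral_const_mul, integral_finsetSum _ fun i _ =>
    (integrableOn_laguerreReduced_mul_gaussian ha n i).const_mul _]
  have moment_eq : ∀ j ∈ Finset.range (m + 1), ∫ u in Set.Ioi (0 : ℝ),
      (m.choose j : ℝ) * (-1) ^ j / Real.Gamma (j + a + 1) * (laguerreReduced a n (u ^ 2) *
        (u ^ (2 * j + 2 * a + 1) * Real.exp (-u ^ 2))) =
          if j = n then (2 * laguerreWeight a n)⁻¹ else 0 := by
    intro j hj
    have hjm : j ≤ m := Finset.mem_range_succ_iff.1 hj
    rw [integral_const_mul, integral_laguerreReduced_mul_gaussian ha (hjm.trans hmn)]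
    split_ifs with hjn
    · obtain rfl : m = n := by omega
      subst hjn
      have hΓ := Gamma_nat_add_pos ha j
      have sign : (-1 : ℝ) ^ j * (-1) ^ j = 1 := by rw [← mul_pow, neg_one_mul, neg_neg, one_pow]
      rw [Nat.choose_self, laguerreWeight]
      field_simp
      linear_combination sign
    · rw [mul_zero]
  rw [Finset.sum_congr rfl moment_eq, Finset.sum_ite_eq']
  rcases hmn.eq_or_lt with rfl | hlt
  · have hw := laguerreWeight_pos ha m
    rw [if_pos (Finset.self_mem_range_succ m), if_pos rfl, mul_assoc 2, Real.mul_self_sqrt hw.le]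
    field_simp
  · rw [if_neg (by simpa using hlt), if_neg hlt.ne', mul_zero]

end LaguerreFunctions

/-! ### The one-dimensional heat kernel -/

section HeatKernel

variable {a t : ℝ}

/-- The closed form of the one-dimensional heat kernel, which the Hille–Hardy formula identifies
with the series `∑ e^{-t(4n+2a+2)} φ_n^a(x) φ_n^a(y)` for `x, y > 0`. -/
def laguerreKernel1 (a t x y : ℝ) : ℝ :=
  2 * (2 * Real.sinh (2 * t)) ^ (-(a + 1)) *
    Real.exp (-(Real.cosh (2 * t) / (2 * Real.sinh (2 * t))) * (x ^ 2 + y ^ 2)) *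
    |x * y| ^ (a + 1 / 2) * besselSeries a ((x * y / (2 * Real.sinh (2 * t))) ^ 2)

lemma laguerreKernel1_nonneg (ha : -1 < a) (ht : 0 ≤ t) (x y : ℝ) :
    0 ≤ laguerreKernel1 a t x y := by
  have : 0 ≤ Real.sinh (2 * t) := Real.sinh_nonneg_iff.2 (by linarith)
  have := besselSeries_nonneg ha (sq_nonneg (x * y / (2 * Real.sinh (2 * t))))
  unfold laguerreKernel1
  positivity

lemma laguerreKernel1_comm (a t x y : ℝ) : laguerreKernel1 a t x y = laguerreKernel1 a t y x := by
  unfold laguerreKernel1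
  rw [mul_comm x y, add_comm (x ^ 2)]

lemma measurable_besselSeries (a : ℝ) : Measurable (besselSeries a) := by
  unfold besselSeries
  exact Measurable.tsum fun m => by fun_prop

lemma measurable_laguerreKernel1 (a t : ℝ) :
    Measurable fun p : ℝ × ℝ => laguerreKernel1 a t p.1 p.2 := by
  have bessel_factor : Measurable fun p : ℝ × ℝ =>
      besselSeries a ((p.1 * p.2 / (2 * Real.sinh (2 * t))) ^ 2) :=
    (measurable_besselSeries a).comp (by fun_prop)
  have power_factor : Measurable fun p : ℝ × ℝ => |p.1 * p.2| ^ (a + 1 / 2) := by fun_prop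
  unfold laguerreKernel1
  exact ((measurable_const.mul (by fun_prop)).mul power_factor).mul bessel_factor

lemma laguerreKernel1_eq_of_exp_eq {q x y : ℝ} (ht : 0 < t) (hq : Real.exp (-(2 * t)) = q)
    (hx : 0 < x) (hy : 0 < y) :
    laguerreKernel1 a t x y = 2 * q⁻¹ ^ (-(a + 1)) * x ^ (a + 1 / 2) * y ^ (a + 1 / 2) *
      Real.exp (-x ^ 2 / 2) * Real.exp (-y ^ 2 / 2) *
      ((1 - q ^ 2) ^ (-(a + 1)) * Real.exp (-(x ^ 2 + y ^ 2) * q ^ 2 / (1 - q ^ 2)) *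
        besselSeries a (x ^ 2 * y ^ 2 * q ^ 2 / (1 - q ^ 2) ^ 2)) := by
  have hq0 : 0 < q := hq ▸ Real.exp_pos _
  have hq1 : 0 < 1 - q ^ 2 :=
    sub_pos.2 (pow_lt_one₀ hq0.le (hq ▸ Real.exp_lt_one_iff.2 (by linarith)) two_ne_zero)
  have two_sinh : 2 * Real.sinh (2 * t) = q⁻¹ * (1 - q ^ 2) := by
    rw [Real.sinh_eq, hq, ← neg_neg (2 * t), Real.exp_neg, hq]
    field_simp
  have cosh_eq : Real.cosh (2 * t) = (q⁻¹ + q) / 2 := by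
    rw [Real.cosh_eq, ← hq, Real.exp_neg, inv_inv]
  have gaussian_exponent : -((q⁻¹ + q) / 2 / (q⁻¹ * (1 - q ^ 2))) * (x ^ 2 + y ^ 2) =
      -(x ^ 2 + y ^ 2) * q ^ 2 / (1 - q ^ 2) + -x ^ 2 / 2 + -y ^ 2 / 2 := by
    field_simp
    ring
  have bessel_argument : (x * y / (q⁻¹ * (1 - q ^ 2))) ^ 2 =
      x ^ 2 * y ^ 2 * q ^ 2 / (1 - q ^ 2) ^ 2 := by
    field_simp
  rw [laguerreKernel1, two_sinh, cosh_eq, Real.mul_rpow (inv_nonneg.2 hq0.le) hq1.le,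
    abs_of_pos (by positivity), Real.mul_rpow hx.le hy.le, gaussian_exponent, Real.exp_add,
    Real.exp_add, bessel_argument]
  ring

/-- The Hille–Hardy formula with `r = e^{-4t}`. -/
lemma hasSum_laguerreKernel1 {x y : ℝ} (ha : -1 < a) (ht : 0 < t) (hx : 0 < x) (hy : 0 < y) :
    HasSum (fun n : ℕ => Real.exp (-t * (4 * n + 2 * a + 2)) *
      laguerreHermite1 n a x * laguerreHermite1 n a y) (laguerreKernel1 a t x y) := by
  set q := Real.exp (-(2 * t)) with hq
  have hr : |q ^ 2| < 1 := by
    rw [abs_of_nonneg (sq_nonneg q)]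
    exact pow_lt_one₀ (Real.exp_nonneg _) (Real.exp_lt_one_iff.2 (by linarith)) two_ne_zero
  rw [laguerreKernel1_eq_of_exp_eq ht hq.symm hx hy]
  refine ((hasSum_hille_hardy ha hr (x ^ 2) (y ^ 2)).mul_left _).congr_fun fun n => ?_
  have exp_eigenvalue : Real.exp (-t * (4 * n + 2 * a + 2)) = q⁻¹ ^ (-(a + 1)) * (q ^ 2) ^ n := by
    rw [hq, ← Real.exp_neg, neg_neg, ← Real.exp_mul, ← pow_mul, ← Real.exp_nat_mul, ← Real.exp_add]
    congr 1
    push_cast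
    ring
  rw [exp_eigenvalue, laguerreHermite1_eq, laguerreHermite1_eq]
  linear_combination (q⁻¹ ^ (-(a + 1)) * (q ^ 2) ^ n * laguerreReduced a n (x ^ 2) *
    laguerreReduced a n (y ^ 2) * x ^ (a + 1 / 2) * y ^ (a + 1 / 2) * Real.exp (-x ^ 2 / 2) *
    Real.exp (-y ^ 2 / 2)) * (√(laguerreWeight a n) ^ 2 * Real.sq_sqrt (zero_le_two : (0 : ℝ) ≤ 2)
    + 2 * Real.sq_sqrt (laguerreWeight_pos ha n).le)

/-- The cross terms `|xy|^{a+1/2}` and `cosh (xy/sinh 2t)` grow at most exponentially in `y`, so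
the Gaussian factor dominates; the constant comes from completing the square. -/
lemma exists_laguerreKernel1_le (ha : -1 / 2 ≤ a) (ht : 0 < t) {x : ℝ} (hx : 0 < x) :
    ∃ K : ℝ, ∀ y, 0 < y → laguerreKernel1 a t x y ≤ K := by
  have hS : 0 < Real.sinh (2 * t) := Real.sinh_pos_iff.2 (by linarith)
  have hΓ : 0 < Real.Gamma (a + 1) := Real.Gamma_pos_of_pos (by linarith)
  set S := Real.sinh (2 * t)
  set b := Real.cosh (2 * t) / (2 * S)
  have hb : 0 < b := by positivity
  set D := (a + 1 / 2 + 1 / S) * x with hD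
  refine ⟨2 * (2 * S) ^ (-(a + 1)) * (1 / Real.Gamma (a + 1)) * Real.exp (D ^ 2 / (4 * b)),
    fun y hy => ?_⟩
  have hxy : 0 < x * y := mul_pos hx hy
  have power_le : |x * y| ^ (a + 1 / 2) ≤ Real.exp ((a + 1 / 2) * (x * y)) := by
    rw [abs_of_pos hxy, mul_comm (a + 1 / 2), Real.exp_mul]
    exact Real.rpow_le_rpow hxy.le (by linarith [Real.add_one_le_exp (x * y)]) (by linarith)
  have bessel_le : besselSeries a ((x * y / (2 * S)) ^ 2) ≤
      1 / Real.Gamma (a + 1) * Real.exp (1 / S * (x * y)) := by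
    rw [show 1 / S * (x * y) = 2 * (x * y / (2 * S)) by field_simp]
    exact besselSeries_sq_le_exp ha (by positivity)
  have completed_square : D ^ 2 / (4 * b) -
      (-b * (x ^ 2 + y ^ 2) + (a + 1 / 2) * (x * y) + 1 / S * (x * y)) =
        b * x ^ 2 + (2 * b * y - D) ^ 2 / (4 * b) := by
    rw [hD]
    field_simp
    ring
  have exp_le : Real.exp (-b * (x ^ 2 + y ^ 2)) * Real.exp ((a + 1 / 2) * (x * y)) *
      Real.exp (1 / S * (x * y)) ≤ Real.exp (D ^ 2 / (4 * b)) := by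
    rw [← Real.exp_add, ← Real.exp_add, Real.exp_le_exp, ← sub_nonneg, completed_square]
    positivity
  calc laguerreKernel1 a t x y = 2 * (2 * S) ^ (-(a + 1)) * Real.exp (-b * (x ^ 2 + y ^ 2)) *
        |x * y| ^ (a + 1 / 2) * besselSeries a ((x * y / (2 * S)) ^ 2) := rfl
    _ ≤ 2 * (2 * S) ^ (-(a + 1)) * Real.exp (-b * (x ^ 2 + y ^ 2)) *
        Real.exp ((a + 1 / 2) * (x * y)) *
        (1 / Real.Gamma (a + 1) * Real.exp (1 / S * (x * y))) := by
        have := besselSeries_nonneg (by linarith : -1 < a) (sq_nonneg (x * y / (2 * S)))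
        gcongr
    _ = 2 * (2 * S) ^ (-(a + 1)) * (1 / Real.Gamma (a + 1)) *
        (Real.exp (-b * (x ^ 2 + y ^ 2)) * Real.exp ((a + 1 / 2) * (x * y)) *
        Real.exp (1 / S * (x * y))) := by ring
    _ ≤ _ := by gcongr

end HeatKernel

/-! ### The mass of the one-dimensional heat kernel -/

section Mass

variable {δ w : ℝ}

/-- With `δ = a/2 + 1/4` and `w = x²/(2 sinh 2t cosh 2t)`, the quotient of `∫ G_t(x,y) dy` and
`(cosh 2t)^{-1/2} exp(-(sinh 2t)² w)`. It is `e^{-w} w^δ` times a confluent hypergeometric series,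
and bounded by one exactly when the kernel is submarkovian. -/
def laguerreMass (δ w : ℝ) : ℝ≥0∞ :=
  ∑' m : ℕ, ENNReal.ofReal (Real.exp (-w) * w ^ δ *
    (w ^ m * Real.Gamma (m + δ + 1 / 2) / ((m.factorial : ℝ) * Real.Gamma (m + 2 * δ + 1 / 2))))

lemma lintegral_rpow_mul_exp_neg_mul_sq {s b : ℝ} (hs : -1 < s) (hb : 0 < b) :
    ∫⁻ y in Set.Ioi (0 : ℝ), ENNReal.ofReal (y ^ s * Real.exp (-b * y ^ 2)) =
      ENNReal.ofReal (b ^ (-(s + 1) / 2) * (1 / 2) * Real.Gamma ((s + 1) / 2)) := by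
  have real_integral := integral_rpow_mul_exp_neg_mul_rpow (p := 2) two_pos hs hb
  simp only [Real.rpow_ofNat] at real_integral
  rw [← real_integral,
    ofReal_integral_eq_lintegral_ofReal (integrableOn_rpow_mul_exp_neg_mul_sq hb hs)]
  filter_upwards [ae_restrict_mem measurableSet_Ioi] with y (hy : 0 < y)
  positivity

lemma ofReal_laguerreKernel1_eq_tsum {a t x y : ℝ} (ha : -1 < a) (ht : 0 < t) (hx : 0 < x)
    (hy : 0 < y) : ENNReal.ofReal (laguerreKernel1 a t x y) =
      ∑' m : ℕ, ENNReal.ofReal (2 * (2 * Real.sinh (2 * t)) ^ (-(a + 1)) *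
        Real.exp (-(Real.cosh (2 * t) / (2 * Real.sinh (2 * t))) * x ^ 2) * x ^ (a + 1 / 2) *
        ((x / (2 * Real.sinh (2 * t))) ^ 2) ^ m / ((m.factorial : ℝ) * Real.Gamma (m + a + 1))) *
      ENNReal.ofReal (y ^ (2 * m + (a + 1 / 2)) *
        Real.exp (-(Real.cosh (2 * t) / (2 * Real.sinh (2 * t))) * y ^ 2)) := by
  have hΓ := Gamma_nat_add_pos ha
  have : 0 < Real.sinh (2 * t) := Real.sinh_pos_iff.2 (by linarith)
  rw [laguerreKernel1, besselSeries, ← tsum_mul_left, ENNReal.ofReal_tsum_of_nonneg]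
  · refine tsum_congr fun m => ?_
    have := hΓ m
    rw [← ENNReal.ofReal_mul (by positivity), abs_of_pos (mul_pos hx hy),
      Real.mul_rpow hx.le hy.le, Real.rpow_add hy (2 * m), mul_add, Real.exp_add,
      show (2 * m : ℝ) = (2 * m : ℕ) by push_cast; ring, Real.rpow_natCast, pow_mul,
      mul_div_right_comm, mul_pow, mul_pow]
    congr 1
    field_simp
  · intro m
    have := hΓ m
    positivity
  · exact (summable_besselSeries ha _).of_norm.mul_left _

lemma laguerreMass_prefactor {S C x : ℝ} (a : ℝ) (hS : 0 < S) (hC : 0 < C) (hx : 0 < x) :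
    (2 * S) ^ (-(a + 1)) * x ^ (a + 1 / 2) * (C / (2 * S)) ^ (-(a / 2 + 1 / 4 + 1 / 2)) =
      C ^ (-1 / 2 : ℝ) * (x ^ 2 / (2 * S * C)) ^ (a / 2 + 1 / 4) := by
  have h2S : 0 < 2 * S := by positivity
  have rpow_x : (x ^ 2) ^ (a / 2 + 1 / 4) = x ^ (a + 1 / 2) := by
    rw [← Real.rpow_natCast, ← Real.rpow_mul hx.le]
    ring_nf
  have rpow_sinh : (2 * S) ^ (-(a + 1)) =
      ((2 * S) ^ (a / 2 + 1 / 4))⁻¹ * ((2 * S) ^ (a / 2 + 1 / 4 + 1 / 2))⁻¹ := by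
    rw [← mul_inv, ← Real.rpow_add h2S, ← Real.rpow_neg h2S.le]
    ring_nf
  have rpow_cosh : C ^ (-1 / 2 : ℝ) = C ^ (a / 2 + 1 / 4) * (C ^ (a / 2 + 1 / 4 + 1 / 2))⁻¹ := by
    rw [← Real.rpow_neg hC.le, ← Real.rpow_add hC]
    ring_nf
  rw [rpow_sinh, rpow_cosh, Real.rpow_neg (by positivity), Real.div_rpow hC.le h2S.le,
    Real.div_rpow (sq_nonneg x) (by positivity), Real.mul_rpow h2S.le hC.le, rpow_x]
  field_simp

/-- The `m`-th term of the kernel, integrated in `y`, is the `m`-th term of the mass. -/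
lemma laguerreMass_term {a S C x : ℝ} (hS : 0 < S) (hC : 0 < C) (hCS : C ^ 2 = S ^ 2 + 1)
    (hx : 0 < x) (m : ℕ) :
    2 * (2 * S) ^ (-(a + 1)) * Real.exp (-(C / (2 * S)) * x ^ 2) * x ^ (a + 1 / 2) *
        ((x / (2 * S)) ^ 2) ^ m / ((m.factorial : ℝ) * Real.Gamma (m + a + 1)) *
      ((C / (2 * S)) ^ (-(2 * m + (a + 1 / 2) + 1) / 2) * (1 / 2) *
        Real.Gamma ((2 * m + (a + 1 / 2) + 1) / 2)) =
    C ^ (-1 / 2 : ℝ) * Real.exp (-S ^ 2 * (x ^ 2 / (2 * S * C))) *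
      (Real.exp (-(x ^ 2 / (2 * S * C))) * (x ^ 2 / (2 * S * C)) ^ (a / 2 + 1 / 4) *
        ((x ^ 2 / (2 * S * C)) ^ m * Real.Gamma (m + (a / 2 + 1 / 4) + 1 / 2) /
          ((m.factorial : ℝ) * Real.Gamma (m + 2 * (a / 2 + 1 / 4) + 1 / 2)))) := by
  have hb : 0 < C / (2 * S) := by positivity
  have gaussian_split : Real.exp (-(C / (2 * S)) * x ^ 2) =
      Real.exp (-S ^ 2 * (x ^ 2 / (2 * S * C))) * Real.exp (-(x ^ 2 / (2 * S * C))) := by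
    rw [← Real.exp_add]
    congr 1
    field_simp
    linear_combination -hCS
  have pow_split : ((x / (2 * S)) ^ 2) ^ m = (x ^ 2 / (2 * S * C)) ^ m * (C / (2 * S)) ^ m := by
    rw [← mul_pow]
    congr 1
    field_simp
  rw [show (2 * m + (a + 1 / 2) + 1) / 2 = m + (a / 2 + 1 / 4) + 1 / 2 by ring,
    show -(2 * m + (a + 1 / 2) + 1) / 2 = -(a / 2 + 1 / 4 + 1 / 2) - m by ring,
    show (m : ℝ) + 2 * (a / 2 + 1 / 4) + 1 / 2 = m + a + 1 by ring, Real.rpow_sub hb,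
    Real.rpow_natCast, gaussian_split, pow_split]
  have : (C / (2 * S)) ^ m ≠ 0 := by positivity
  calc _ = ((2 * S) ^ (-(a + 1)) * x ^ (a + 1 / 2) *
        (C / (2 * S)) ^ (-(a / 2 + 1 / 4 + 1 / 2))) *
        (Real.exp (-S ^ 2 * (x ^ 2 / (2 * S * C))) * Real.exp (-(x ^ 2 / (2 * S * C)))) *
        (x ^ 2 / (2 * S * C)) ^ m * Real.Gamma (m + (a / 2 + 1 / 4) + 1 / 2) /
          ((m.factorial : ℝ) * Real.Gamma (m + a + 1)) := by field
    _ = _ := by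
        rw [laguerreMass_prefactor a hS hC hx]
        ring

lemma lintegral_laguerreKernel1 {a t x : ℝ} (ha : -1 < a) (ht : 0 < t) (hx : 0 < x) :
    ∫⁻ y in Set.Ioi (0 : ℝ), ENNReal.ofReal (laguerreKernel1 a t x y) =
      ENNReal.ofReal (Real.cosh (2 * t) ^ (-1 / 2 : ℝ) * Real.exp (-(Real.sinh (2 * t)) ^ 2 *
        (x ^ 2 / (2 * Real.sinh (2 * t) * Real.cosh (2 * t))))) *
      laguerreMass (a / 2 + 1 / 4) (x ^ 2 / (2 * Real.sinh (2 * t) * Real.cosh (2 * t))) := by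
  have hS : 0 < Real.sinh (2 * t) := Real.sinh_pos_iff.2 (by linarith)
  have hC : 0 < Real.cosh (2 * t) := Real.cosh_pos _
  rw [setLIntegral_congr_fun measurableSet_Ioi fun y hy =>
      ofReal_laguerreKernel1_eq_tsum ha ht hx hy,
    lintegral_tsum fun m => by fun_prop, laguerreMass, ← ENNReal.tsum_mul_left]
  refine tsum_congr fun m => ?_
  have := Gamma_nat_add_pos ha m
  rw [lintegral_const_mul _ (by fun_prop),
    lintegral_rpow_mul_exp_neg_mul_sq (by linarith [m.cast_nonneg (α := ℝ)]) (by positivity),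
    ← ENNReal.ofReal_mul (by positivity), ← ENNReal.ofReal_mul (by positivity),
    laguerreMass_term hS hC (Real.cosh_sq _) hx]

lemma laguerreMass_zero (hw : 0 ≤ w) : laguerreMass 0 w = 1 := by
  have poisson_term (m : ℕ) : Real.exp (-w) * w ^ (0 : ℝ) * (w ^ m * Real.Gamma (m + 0 + 1 / 2) /
      ((m.factorial : ℝ) * Real.Gamma (m + 2 * 0 + 1 / 2))) =
      Real.exp (-w) * (w ^ m / (m.factorial : ℝ)) := by
    have : 0 < Real.Gamma (m + 1 / 2) := Real.Gamma_pos_of_pos (by positivity)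
    rw [mul_zero, add_zero, Real.rpow_zero]
    field_simp
  have poisson_sum := (NormedSpace.expSeries_div_hasSum_exp w).mul_left (Real.exp (-w))
  rw [← Real.exp_eq_exp_ℝ, ← Real.exp_add, neg_add_cancel, Real.exp_zero] at poisson_sum
  simp only [laguerreMass, poisson_term]
  rw [← ENNReal.ofReal_tsum_of_nonneg (fun m => by positivity) poisson_sum.summable,
    poisson_sum.tsum_eq, ENNReal.ofReal_one]

/-- The density of the Gamma distribution of shape `δ` and rate `w`, multiplied by `Γ(δ)`. -/
def gammaWeight (δ w σ : ℝ) : ℝ := w ^ δ * Real.exp (-(w * σ)) * σ ^ (δ - 1)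

lemma gammaWeight_nonneg (δ : ℝ) (hw : 0 ≤ w) {σ : ℝ} (hσ : 0 ≤ σ) : 0 ≤ gammaWeight δ w σ := by
  unfold gammaWeight
  positivity

lemma gammaWeight_add_one (δ : ℝ) (hw : w ≠ 0) {σ : ℝ} (hσ : σ ≠ 0) :
    gammaWeight (δ + 1) w σ = w * σ * gammaWeight δ w σ := by
  rw [gammaWeight, gammaWeight, add_sub_right_comm, Real.rpow_add_one hw, Real.rpow_add_one hσ]
  ring

lemma measurable_gammaWeight (δ w : ℝ) : Measurable (gammaWeight δ w) := by
  unfold gammaWeight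
  fun_prop

lemma integrableOn_gammaWeight (hδ : 0 < δ) (hw : 0 < w) :
    IntegrableOn (gammaWeight δ w) (Set.Ioi 0) := by
  have base := integrableOn_rpow_mul_exp_neg_mul_rpow (p := 1) (s := δ - 1) (b := w) (by linarith)
    one_pos hw
  refine IntegrableOn.congr_fun (base.const_mul (w ^ δ)) (fun σ _ => ?_) measurableSet_Ioi
  simp only [gammaWeight, Real.rpow_one, neg_mul]
  ring

lemma integral_gammaWeight (hδ : 0 < δ) (hw : 0 < w) :
    ∫ σ in Set.Ioi (0 : ℝ), gammaWeight δ w σ = Real.Gamma δ := by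
  simp only [gammaWeight, mul_assoc, integral_const_mul, mul_comm (Real.exp _)]
  rw [Real.integral_rpow_mul_exp_neg_mul_Ioi hδ hw, ← mul_assoc, one_div, Real.inv_rpow hw.le,
    mul_inv_cancel₀ (by positivity), one_mul]

lemma lintegral_gammaWeight (hδ : 0 < δ) (hw : 0 < w) :
    ∫⁻ σ in Set.Ioi (0 : ℝ), ENNReal.ofReal (gammaWeight δ w σ) =
      ENNReal.ofReal (Real.Gamma δ) := by
  rw [← integral_gammaWeight hδ hw,
    ofReal_integral_eq_lintegral_ofReal (integrableOn_gammaWeight hδ hw)]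
  filter_upwards [ae_restrict_mem measurableSet_Ioi] with σ hσ
  exact gammaWeight_nonneg δ hw.le (le_of_lt hσ)

lemma lintegral_rpow_mul_one_sub_rpow {p q : ℝ} (hp : 0 < p) (hq : 0 < q) :
    ∫⁻ σ in Set.Ioo (0 : ℝ) 1, ENNReal.ofReal (σ ^ (p - 1) * (1 - σ) ^ (q - 1)) =
      ENNReal.ofReal (Real.Gamma p * Real.Gamma q / Real.Gamma (p + q)) := by
  have hβ := ProbabilityTheory.beta_pos hp hq
  have normalized := ProbabilityTheory.lintegral_betaPDF_eq_one hp hq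
  simp only [ProbabilityTheory.lintegral_betaPDF, mul_assoc,
    ENNReal.ofReal_mul (one_div_pos.2 hβ).le] at normalized
  rw [lintegral_const_mul _ (by fun_prop)] at normalized
  have scaled := congrArg (ENNReal.ofReal (ProbabilityTheory.beta p q) * ·) normalized
  simp only [← mul_assoc, ← ENNReal.ofReal_mul hβ.le, mul_one_div_cancel hβ.ne',
    ENNReal.ofReal_one, one_mul, mul_one] at scaled
  exact scaled

lemma ofReal_gammaWeight_mul_eq_tsum (hw : 0 < w) {σ : ℝ} (hσ : σ ∈ Set.Ioo (0 : ℝ) 1) :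
    ENNReal.ofReal (gammaWeight δ w σ * (1 - σ) ^ (δ - 1 / 2)) =
      ∑' m : ℕ, ENNReal.ofReal (w ^ δ * Real.exp (-w) * (w ^ m / (m.factorial : ℝ))) *
        ENNReal.ofReal (σ ^ (δ - 1) * (1 - σ) ^ (m + δ + 1 / 2 - 1)) := by
  obtain ⟨hσ0, hσ1⟩ : 0 < σ ∧ 0 < 1 - σ := ⟨hσ.1, sub_pos.2 hσ.2⟩
  have exp_sum := (NormedSpace.expSeries_div_hasSum_exp (w * (1 - σ))).mul_left
    (w ^ δ * Real.exp (-w) * σ ^ (δ - 1) * (1 - σ) ^ (δ - 1 / 2))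
  rw [← Real.exp_eq_exp_ℝ] at exp_sum
  have exp_split : gammaWeight δ w σ * (1 - σ) ^ (δ - 1 / 2) =
      w ^ δ * Real.exp (-w) * σ ^ (δ - 1) * (1 - σ) ^ (δ - 1 / 2) * Real.exp (w * (1 - σ)) := by
    rw [gammaWeight, show -(w * σ) = -w + w * (1 - σ) by ring, Real.exp_add]
    ring
  rw [exp_split, ← exp_sum.tsum_eq,
    ENNReal.ofReal_tsum_of_nonneg (fun m => by positivity) exp_sum.summable]
  refine tsum_congr fun m => ?_
  rw [← ENNReal.ofReal_mul (by positivity), mul_pow,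
    show (m + δ + 1 / 2 - 1 : ℝ) = (m : ℝ) + (δ - 1 / 2) by ring, Real.rpow_add hσ1,
    Real.rpow_natCast]
  congr 1
  ring

/-- The confluent hypergeometric series as an Euler integral: the mass is the expectation of
`(1 - σ)₊ ^ (δ - 1/2)` for a Gamma variable `σ`. -/
lemma laguerreMass_eq_lintegral (hδ : 0 < δ) (hw : 0 < w) :
    laguerreMass δ w = ENNReal.ofReal (Real.Gamma δ)⁻¹ * ∫⁻ σ in Set.Ioo (0 : ℝ) 1,
      ENNReal.ofReal (gammaWeight δ w σ * (1 - σ) ^ (δ - 1 / 2)) := by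
  have : 0 < Real.Gamma δ := Real.Gamma_pos_of_pos hδ
  rw [setLIntegral_congr_fun measurableSet_Ioo fun σ hσ => ofReal_gammaWeight_mul_eq_tsum hw hσ,
    lintegral_tsum fun m => by fun_prop, laguerreMass, ← ENNReal.tsum_mul_left]
  refine tsum_congr fun m => ?_
  rw [lintegral_const_mul _ (by fun_prop), lintegral_rpow_mul_one_sub_rpow hδ (by positivity),
    ← ENNReal.ofReal_mul (by positivity), ← ENNReal.ofReal_mul (by positivity),
    show δ + (m + δ + 1 / 2) = m + 2 * δ + 1 / 2 by ring]
  congr 1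
  field_simp

/-- For `δ = 0` the mass is exactly one; for `1/2 ≤ δ` the integrand `(1 - σ)₊ ^ (δ - 1/2)` is
at most one. -/
lemma laguerreMass_le_one (hδ : δ = 0 ∨ 1 / 2 ≤ δ) (hw : 0 < w) : laguerreMass δ w ≤ 1 := by
  rcases hδ with rfl | hδ
  · exact (laguerreMass_zero hw.le).le
  have hδ0 : 0 < δ := by linarith
  have hΓ : 0 < Real.Gamma δ := Real.Gamma_pos_of_pos hδ0
  calc laguerreMass δ w
      = ENNReal.ofReal (Real.Gamma δ)⁻¹ * ∫⁻ σ in Set.Ioo (0 : ℝ) 1,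
          ENNReal.ofReal (gammaWeight δ w σ * (1 - σ) ^ (δ - 1 / 2)) :=
        laguerreMass_eq_lintegral hδ0 hw
    _ ≤ ENNReal.ofReal (Real.Gamma δ)⁻¹ * ∫⁻ σ in Set.Ioo (0 : ℝ) 1,
          ENNReal.ofReal (gammaWeight δ w σ) := by
        refine mul_le_mul' le_rfl (setLIntegral_mono' measurableSet_Ioo fun σ hσ =>
          ENNReal.ofReal_le_ofReal ?_)
        exact mul_le_of_le_one_right (gammaWeight_nonneg δ hw.le hσ.1.le)
          (Real.rpow_le_one (by linarith [hσ.2]) (by linarith [hσ.1]) (by linarith))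
    _ ≤ ENNReal.ofReal (Real.Gamma δ)⁻¹ * ∫⁻ σ in Set.Ioi (0 : ℝ),
          ENNReal.ofReal (gammaWeight δ w σ) := by
        gcongr
        exact Set.Ioo_subset_Ioi_self
    _ = 1 := by
        rw [lintegral_gammaWeight hδ0 hw, ← ENNReal.ofReal_mul (by positivity),
          inv_mul_cancel₀ hΓ.ne', ENNReal.ofReal_one]

lemma rpow_le_two {x s : ℝ} (hx : 1 / 2 ≤ x) (hs : -1 ≤ s) (hs0 : s ≤ 0) : x ^ s ≤ 2 :=
  calc x ^ s ≤ (1 / 2) ^ s := Real.rpow_le_rpow_of_nonpos (by norm_num) hx hs0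
    _ ≤ (1 / 2) ^ (-1 : ℝ) :=
        Real.rpow_le_rpow_of_exponent_ge (by norm_num) (by norm_num) hs
    _ = 2 := by rw [Real.rpow_neg_one]; norm_num

lemma rpow_mul_exp_neg_half_le_three (hδ : 0 ≤ δ) (hδ1 : δ ≤ 1) (hw : 0 < w) :
    w ^ δ * Real.exp (-(w / 2)) ≤ 3 := by
  have rpow_le : w ^ δ ≤ 1 + w := by
    rcases le_total w 1 with hw1 | hw1
    · linarith [Real.rpow_le_one hw.le hw1 hδ]
    · linarith [Real.rpow_le_self_of_one_le hw1 hδ1]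
  have one_add_le : 1 + w ≤ 3 * Real.exp (w / 2) := by
    linarith [Real.add_one_le_exp (w / 2), Real.exp_pos (w / 2)]
  calc w ^ δ * Real.exp (-(w / 2)) ≤ 3 * Real.exp (w / 2) * Real.exp (-(w / 2)) := by
        gcongr
        exact rpow_le.trans one_add_le
    _ = 3 := by rw [mul_assoc, ← Real.exp_add, add_neg_cancel, Real.exp_zero, mul_one]

/-- Near `0` the second factor is bounded, near `1` the first. -/
lemma gammaWeight_mul_one_sub_rpow_le (hδ : 0 ≤ δ) (hδ1 : δ ≤ 1 / 2) (hw : 0 < w) {σ : ℝ}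
    (hσ : σ ∈ Set.Ioo (0 : ℝ) 1) :
    gammaWeight δ w σ * (1 - σ) ^ (δ - 1 / 2) ≤
      2 * gammaWeight δ w σ + 8 * (1 - σ) ^ (δ - 1 / 2) := by
  obtain ⟨hσ0, hσ1⟩ : 0 < σ ∧ 0 < 1 - σ := ⟨hσ.1, sub_pos.2 hσ.2⟩
  have weight_nonneg := gammaWeight_nonneg δ hw.le hσ0.le
  have rpow_nonneg : 0 ≤ (1 - σ) ^ (δ - 1 / 2) := by positivity
  rcases le_total σ (1 / 2) with near_zero | near_one
  · have := rpow_le_two (x := 1 - σ) (s := δ - 1 / 2) (by linarith) (by linarith) (by linarith)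
    nlinarith
  · have weight_le : gammaWeight δ w σ ≤ 3 * 2 :=
      calc gammaWeight δ w σ ≤ w ^ δ * Real.exp (-(w / 2)) * σ ^ (δ - 1) := by
            unfold gammaWeight
            gcongr
            nlinarith
        _ ≤ 3 * 2 := by
            gcongr
            · exact rpow_mul_exp_neg_half_le_three hδ (by linarith) hw
            · exact rpow_le_two near_one (by linarith) (by linarith)
    nlinarith

lemma exists_laguerreMass_le (hδ : 0 ≤ δ) :
    ∃ c : ℝ, 1 ≤ c ∧ ∀ w, 0 < w → laguerreMass δ w ≤ ENNReal.ofReal c := by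
  by_cases h : δ = 0 ∨ 1 / 2 ≤ δ
  · exact ⟨1, le_rfl, fun w hw => by simpa using laguerreMass_le_one h hw⟩
  push Not at h
  have hδ0 : 0 < δ := lt_of_le_of_ne hδ h.1.symm
  have : 0 < Real.Gamma δ := Real.Gamma_pos_of_pos hδ0
  let B := Real.Gamma 1 * Real.Gamma (δ + 1 / 2) / Real.Gamma (1 + (δ + 1 / 2))
  have : 0 < B := ProbabilityTheory.beta_pos one_pos (by linarith)
  have integral_singular : ∫⁻ σ in Set.Ioo (0 : ℝ) 1,
      ENNReal.ofReal ((1 - σ) ^ (δ - 1 / 2)) = ENNReal.ofReal B := by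
    rw [← lintegral_rpow_mul_one_sub_rpow one_pos (by linarith)]
    simp only [sub_self, Real.rpow_zero, one_mul, show δ + 1 / 2 - 1 = δ - 1 / 2 by ring]
  refine ⟨1 + (Real.Gamma δ)⁻¹ * (2 * Real.Gamma δ + 8 * B),
    le_add_of_nonneg_right (by positivity), fun w hw => ?_⟩
  calc laguerreMass δ w
      = ENNReal.ofReal (Real.Gamma δ)⁻¹ * ∫⁻ σ in Set.Ioo (0 : ℝ) 1,
          ENNReal.ofReal (gammaWeight δ w σ * (1 - σ) ^ (δ - 1 / 2)) :=
        laguerreMass_eq_lintegral hδ0 hw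
    _ ≤ ENNReal.ofReal (Real.Gamma δ)⁻¹ * ∫⁻ σ in Set.Ioo (0 : ℝ) 1,
          (ENNReal.ofReal 2 * ENNReal.ofReal (gammaWeight δ w σ) +
            ENNReal.ofReal 8 * ENNReal.ofReal ((1 - σ) ^ (δ - 1 / 2))) := by
        refine mul_le_mul' le_rfl (setLIntegral_mono' measurableSet_Ioo fun σ hσ => ?_)
        have hσ1 : 0 < 1 - σ := sub_pos.2 hσ.2
        have := gammaWeight_nonneg δ hw.le hσ.1.le
        rw [← ENNReal.ofReal_mul (by norm_num), ← ENNReal.ofReal_mul (by norm_num),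
          ← ENNReal.ofReal_add (by positivity) (by positivity)]
        exact ENNReal.ofReal_le_ofReal (gammaWeight_mul_one_sub_rpow_le hδ h.2.le hw hσ)
    _ ≤ ENNReal.ofReal (Real.Gamma δ)⁻¹ *
          (ENNReal.ofReal 2 * ENNReal.ofReal (Real.Gamma δ) +
            ENNReal.ofReal 8 * ENNReal.ofReal B) := by
        rw [lintegral_add_left ((measurable_gammaWeight δ w).ennreal_ofReal.const_mul _),
          lintegral_const_mul _ (measurable_gammaWeight δ w).ennreal_ofReal,
          lintegral_const_mul _ (by fun_prop), integral_singular, ← lintegral_gammaWeight hδ0 hw]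
        gcongr
        exact Set.Ioo_subset_Ioi_self
    _ ≤ ENNReal.ofReal (1 + (Real.Gamma δ)⁻¹ * (2 * Real.Gamma δ + 8 * B)) := by
        rw [← ENNReal.ofReal_mul (by norm_num), ← ENNReal.ofReal_mul (by norm_num),
          ← ENNReal.ofReal_add (by positivity) (by positivity),
          ← ENNReal.ofReal_mul (by positivity)]
        exact ENNReal.ofReal_le_ofReal (by linarith)

lemma gammaWeight_mul_quadratic (δ A B : ℝ) (hw : w ≠ 0) {σ : ℝ} (hσ : σ ≠ 0) :
    gammaWeight δ w σ * (1 + A * σ - B * σ ^ 2) = gammaWeight δ w σ +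
      A / w * gammaWeight (δ + 1) w σ - B / w ^ 2 * gammaWeight (δ + 1 + 1) w σ := by
  rw [gammaWeight_add_one (δ + 1) hw hσ, gammaWeight_add_one δ hw hσ]
  field

lemma integrableOn_gammaWeight_mul_quadratic (hδ : 0 < δ) (hw : 0 < w) (A B : ℝ) :
    IntegrableOn (fun σ => gammaWeight δ w σ * (1 + A * σ - B * σ ^ 2)) (Set.Ioi 0) :=
  (((integrableOn_gammaWeight hδ hw).add
    ((integrableOn_gammaWeight (by linarith) hw).const_mul (A / w))).sub
    ((integrableOn_gammaWeight (by linarith) hw).const_mul (B / w ^ 2))).congr_fun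
    (fun _ hσ => (gammaWeight_mul_quadratic δ A B hw.ne' (ne_of_gt hσ)).symm) measurableSet_Ioi

lemma integral_gammaWeight_mul_quadratic (hδ : 0 < δ) (hw : 0 < w) (A B : ℝ) :
    ∫ σ in Set.Ioi (0 : ℝ), gammaWeight δ w σ * (1 + A * σ - B * σ ^ 2) =
      Real.Gamma δ * (1 + A * δ / w - B * (δ * (δ + 1)) / w ^ 2) := by
  have int_zero := integrableOn_gammaWeight hδ hw
  have int_one := (integrableOn_gammaWeight (δ := δ + 1) (by linarith) hw).const_mul (A / w)
  have int_two := (integrableOn_gammaWeight (δ := δ + 1 + 1) (by linarith) hw).const_mul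
    (B / w ^ 2)
  have int_zero_one : IntegrableOn
      (fun σ => gammaWeight δ w σ + A / w * gammaWeight (δ + 1) w σ) (Set.Ioi 0) :=
    int_zero.add int_one
  rw [setIntegral_congr_fun measurableSet_Ioi fun σ hσ =>
      gammaWeight_mul_quadratic δ A B hw.ne' (ne_of_gt hσ),
    integral_sub int_zero_one int_two, integral_add int_zero int_one,
    integral_const_mul, integral_const_mul, integral_gammaWeight hδ hw,
    integral_gammaWeight (by linarith) hw, integral_gammaWeight (by linarith) hw,
    Real.Gamma_add_one (s := δ + 1) (by linarith), Real.Gamma_add_one hδ.ne']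
  field

lemma ofReal_integral_le_lintegral_ofReal {X : Type*} [MeasurableSpace X] {μ : Measure X}
    {f : X → ℝ} (hf : Integrable f μ) :
    ENNReal.ofReal (∫ x, f x ∂μ) ≤ ∫⁻ x, ENNReal.ofReal (f x) ∂μ := by
  rw [integral_eq_lintegral_pos_part_sub_lintegral_neg_part hf]
  exact (ENNReal.ofReal_le_ofReal (sub_le_self _ ENNReal.toReal_nonneg)).trans
    ENNReal.ofReal_toReal_le

/-- A quadratic minorant of `(1 - σ)₊ ^ (δ - 1/2)` bounds the mass from below by its expectation
under the Gamma distribution. -/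
lemma le_laguerreMass_of_quadratic_le {A B : ℝ} (hδ : 0 < δ) (hw : 0 < w)
    (le_rpow : ∀ σ ∈ Set.Ioo (0 : ℝ) 1, 1 + A * σ - B * σ ^ 2 ≤ (1 - σ) ^ (δ - 1 / 2))
    (nonpos : ∀ σ, 1 ≤ σ → 1 + A * σ - B * σ ^ 2 ≤ 0) :
    ENNReal.ofReal (1 + A * δ / w - B * (δ * (δ + 1)) / w ^ 2) ≤ laguerreMass δ w := by
  have hΓ : 0 < Real.Gamma δ := Real.Gamma_pos_of_pos hδ
  have zero_beyond_one : ∫⁻ σ in Set.Ici (1 : ℝ),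
      ENNReal.ofReal (gammaWeight δ w σ * (1 + A * σ - B * σ ^ 2)) = 0 :=
    setLIntegral_eq_zero measurableSet_Ici fun σ hσ => ENNReal.ofReal_of_nonpos
      (mul_nonpos_of_nonneg_of_nonpos (gammaWeight_nonneg δ hw.le (zero_le_one.trans hσ))
        (nonpos σ hσ))
  calc ENNReal.ofReal (1 + A * δ / w - B * (δ * (δ + 1)) / w ^ 2)
      = ENNReal.ofReal (Real.Gamma δ)⁻¹ * ENNReal.ofReal (∫ σ in Set.Ioi (0 : ℝ),
          gammaWeight δ w σ * (1 + A * σ - B * σ ^ 2)) := by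
        rw [integral_gammaWeight_mul_quadratic hδ hw, ← ENNReal.ofReal_mul (by positivity),
          inv_mul_cancel_left₀ hΓ.ne']
    _ ≤ ENNReal.ofReal (Real.Gamma δ)⁻¹ * ∫⁻ σ in Set.Ioi (0 : ℝ),
          ENNReal.ofReal (gammaWeight δ w σ * (1 + A * σ - B * σ ^ 2)) := by
        gcongr
        exact ofReal_integral_le_lintegral_ofReal
          (integrableOn_gammaWeight_mul_quadratic hδ hw A B)
    _ = ENNReal.ofReal (Real.Gamma δ)⁻¹ * ∫⁻ σ in Set.Ioo (0 : ℝ) 1,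
          ENNReal.ofReal (gammaWeight δ w σ * (1 + A * σ - B * σ ^ 2)) := by
        rw [← Set.Ioo_union_Ici_eq_Ioi one_pos, lintegral_union measurableSet_Ici
          (Set.disjoint_left.2 fun σ hσ => not_le.2 hσ.2), zero_beyond_one, add_zero]
    _ ≤ ENNReal.ofReal (Real.Gamma δ)⁻¹ * ∫⁻ σ in Set.Ioo (0 : ℝ) 1,
          ENNReal.ofReal (gammaWeight δ w σ * (1 - σ) ^ (δ - 1 / 2)) :=
        mul_le_mul' le_rfl (setLIntegral_mono' measurableSet_Ioo fun σ hσ =>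
          ENNReal.ofReal_le_ofReal
            (mul_le_mul_of_nonneg_left (le_rpow σ hσ) (gammaWeight_nonneg δ hw.le hσ.1.le)))
    _ = laguerreMass δ w := (laguerreMass_eq_lintegral hδ hw).symm

lemma quadratic_le_one_sub_rpow_neg {q σ : ℝ} (hq : 0 ≤ q) (hσ : σ < 1) :
    1 + q * σ - (1 + q) * σ ^ 2 ≤ (1 - σ) ^ (-q) := by
  have hσ1 : 0 < 1 - σ := sub_pos.2 hσ
  have exp_le : Real.exp (q * σ) ≤ (1 - σ) ^ (-q) := by
    rw [Real.rpow_def_of_pos hσ1, Real.exp_le_exp]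
    nlinarith [Real.log_le_sub_one_of_pos hσ1]
  nlinarith [Real.add_one_le_exp (q * σ), mul_nonneg (by linarith : 0 ≤ 1 + q) (sq_nonneg σ)]

/-- With `q = 1/2 - δ` the minorant `1 + qσ - (1 + q)σ²` has expectation
`1 + qδ/w - (1 + q)δ(δ + 1)/w²`, which exceeds one for large `w`. -/
lemma exists_one_lt_laguerreMass (hδ : 0 < δ) (hδ' : δ < 1 / 2) :
    ∃ W : ℝ, 0 < W ∧ ∃ η : ℝ, 0 < η ∧ ∀ w ∈ Set.Icc W (W + 1),
      ENNReal.ofReal (1 + η) ≤ laguerreMass δ w := by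
  obtain ⟨q, rfl⟩ : ∃ q, δ = 1 / 2 - q := ⟨1 / 2 - δ, by ring⟩
  have hq : 0 < q := by linarith
  generalize hD : 1 / 2 - q = δ at hδ
  let W := 2 * (1 + q) * (δ + 1) / q
  have hW : 0 < W := by positivity
  refine ⟨W, hW, q * δ / (2 * (W + 1)), by positivity, fun w hw => ?_⟩
  have hw0 : 0 < w := hW.trans_le hw.1
  refine (ENNReal.ofReal_le_ofReal ?_).trans
    (le_laguerreMass_of_quadratic_le (A := q) (B := 1 + q) hδ hw0 (fun σ hσ => ?_) fun σ hσ => ?_)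
  · have quadratic_term_le : (1 + q) * (δ * (δ + 1)) / w ^ 2 ≤ q * δ / (2 * w) := by
      have : 2 * (1 + q) * (δ + 1) ≤ q * w := by
        linarith [(div_le_iff₀ hq).1 hw.1]
      rw [div_le_div_iff₀ (by positivity) (by positivity)]
      nlinarith [mul_le_mul_of_nonneg_left this (by positivity : 0 ≤ δ * w)]
    have gain_le : q * δ / (2 * (W + 1)) ≤ q * δ / (2 * w) := by
      gcongr
      exact hw.2
    have halves : q * δ / w = q * δ / (2 * w) + q * δ / (2 * w) := by field
    linarith
  · rw [← hD, show 1 / 2 - q - 1 / 2 = -q by ring]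
    exact quadratic_le_one_sub_rpow_neg hq.le hσ.2
  · nlinarith [mul_nonneg (by linarith : 0 ≤ σ - 1) (by positivity : 0 ≤ 1 + (1 + q) * σ)]

/-- For `1/2 ≤ δ` Bernoulli's inequality gives the minorant `1 - (δ + 1)σ`. -/
lemma le_laguerreMass_of_half_le (hδ : 1 / 2 ≤ δ) (hw : 0 < w) :
    ENNReal.ofReal (1 - (δ + 1) * δ / w) ≤ laguerreMass δ w := by
  have bernoulli (σ : ℝ) (hσ : σ ∈ Set.Ioo (0 : ℝ) 1) :
      1 + -(δ + 1) * σ - 0 * σ ^ 2 ≤ (1 - σ) ^ (δ - 1 / 2) :=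
    calc 1 + -(δ + 1) * σ - 0 * σ ^ 2 = 1 + (δ + 1) * -σ := by ring
      _ ≤ (1 + -σ) ^ (δ + 1) :=
          one_add_mul_self_le_rpow_one_add (by linarith [hσ.2]) (by linarith)
      _ ≤ (1 + -σ) ^ (δ - 1 / 2) :=
          Real.rpow_le_rpow_of_exponent_ge (by linarith [hσ.2]) (by linarith [hσ.1]) (by linarith)
      _ = (1 - σ) ^ (δ - 1 / 2) := by rw [← sub_eq_add_neg]
  refine (ENNReal.ofReal_le_ofReal (le_of_eq ?_)).trans
    (le_laguerreMass_of_quadratic_le (by linarith) hw bernoulli fun σ hσ => by nlinarith)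
  ring

lemma exists_laguerreMass_ge {ε : ℝ} (hδ : 0 ≤ δ) (hε : 0 < ε) :
    ∃ W : ℝ, 0 < W ∧ ∀ w ∈ Set.Icc W (W + 1), ENNReal.ofReal (1 - ε) ≤ laguerreMass δ w := by
  rcases hδ.eq_or_lt with rfl | hδ0
  · refine ⟨1, one_pos, fun w hw => ?_⟩
    rw [laguerreMass_zero (zero_le_one.trans hw.1)]
    simpa using hε.le
  rcases lt_or_ge δ (1 / 2) with small | large
  · obtain ⟨W, hW, η, hη, mass_ge⟩ := exists_one_lt_laguerreMass hδ0 small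
    exact ⟨W, hW, fun w hw => (ENNReal.ofReal_le_ofReal (by linarith)).trans (mass_ge w hw)⟩
  · refine ⟨(δ + 1) * δ / ε, by positivity, fun w hw => ?_⟩
    have hw0 : 0 < w := lt_of_lt_of_le (by positivity) hw.1
    exact (ENNReal.ofReal_le_ofReal (sub_le_sub_left ((div_le_comm₀ hε hw0).1 hw.1) 1)).trans
      (le_laguerreMass_of_half_le large hw0)

end Mass

/-! ### Integral operators with positive kernels -/

section PositiveKernel

/-- Jensen's inequality for the measure with density `k`. -/
lemma rpow_lintegral_mul_le {X : Type*} [MeasurableSpace X] {μ : Measure X} {k g : X → ℝ≥0∞}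
    (hk : AEMeasurable k μ) (hg : AEMeasurable g μ) {r : ℝ} (hr : 1 ≤ r) :
    (∫⁻ x, k x * g x ∂μ) ^ r ≤ (∫⁻ x, k x ∂μ) ^ (r - 1) * ∫⁻ x, k x * g x ^ r ∂μ := by
  have hr0 : 0 < r := by linarith
  have jensen := eLpNorm'_le_eLpNorm'_mul_rpow_measure_univ (μ := μ.withDensity k) one_pos hr
    (hg.mono_ac (withDensity_absolutelyContinuous μ k)).aestronglyMeasurable
  simp only [eLpNorm', enorm_eq_self, ENNReal.rpow_one, div_one] at jensen
  rw [lintegral_withDensity_eq_lintegral_mul₀ hk hg,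
    lintegral_withDensity_eq_lintegral_mul₀ hk (hg.pow_const r),
    withDensity_apply _ MeasurableSet.univ, Measure.restrict_univ] at jensen
  calc (∫⁻ x, k x * g x ∂μ) ^ r
      ≤ ((∫⁻ x, k x * g x ^ r ∂μ) ^ (1 / r) * (∫⁻ x, k x ∂μ) ^ (1 - 1 / r)) ^ r :=
        ENNReal.rpow_le_rpow jensen hr0.le
    _ = (∫⁻ x, k x ∂μ) ^ (r - 1) * ∫⁻ x, k x * g x ^ r ∂μ := by
        rw [ENNReal.mul_rpow_of_nonneg _ _ hr0.le, ← ENNReal.rpow_mul, ← ENNReal.rpow_mul,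
          one_div_mul_cancel hr0.ne', ENNReal.rpow_one, sub_mul, one_mul,
          one_div_mul_cancel hr0.ne', mul_comm]

section Schur

variable {X Y : Type*} [MeasurableSpace X] [MeasurableSpace Y] {μ : Measure X} {ν : Measure Y}
  [SFinite μ] [SFinite ν] {k : X → Y → ℝ≥0∞} {A B : ℝ≥0∞} {g : Y → ℝ≥0∞}

lemma lintegral_rpow_lintegral_mul_le (hk : Measurable (Function.uncurry k))
    (rows : ∀ᵐ x ∂μ, ∫⁻ y, k x y ∂ν ≤ A) (columns : ∀ᵐ y ∂ν, ∫⁻ x, k x y ∂μ ≤ B)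
    (hg : AEMeasurable g ν) {r : ℝ} (hr : 1 ≤ r) :
    ∫⁻ x, (∫⁻ y, k x y * g y ∂ν) ^ r ∂μ ≤ A ^ (r - 1) * B * ∫⁻ y, g y ^ r ∂ν := by
  have measurable_integrand :
      AEMeasurable (Function.uncurry fun x y => k x y * g y ^ r) (μ.prod ν) :=
    hk.aemeasurable.mul (hg.pow_const r).comp_snd
  have measurable_inner : AEMeasurable (fun x => ∫⁻ y, k x y * g y ^ r ∂ν) μ :=
    measurable_integrand.lintegral_prod_right'
  calc ∫⁻ x, (∫⁻ y, k x y * g y ∂ν) ^ r ∂μ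
      ≤ ∫⁻ x, A ^ (r - 1) * ∫⁻ y, k x y * g y ^ r ∂ν ∂μ := by
        refine lintegral_mono_ae (rows.mono fun x hx => ?_)
        have hkx : Measurable (k x) := hk.comp measurable_prodMk_left
        exact (rpow_lintegral_mul_le hkx.aemeasurable hg hr).trans
          (mul_le_mul' (ENNReal.rpow_le_rpow hx (by linarith)) le_rfl)
    _ = A ^ (r - 1) * ∫⁻ y, ∫⁻ x, k x y * g y ^ r ∂μ ∂ν := by
        rw [lintegral_const_mul'' _ measurable_inner,
          lintegral_lintegral_swap measurable_integrand]
    _ ≤ A ^ (r - 1) * ∫⁻ y, B * g y ^ r ∂ν := by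
        refine mul_le_mul' le_rfl (lintegral_mono_ae (columns.mono fun y hy => ?_))
        have hky : Measurable fun x => k x y := hk.comp measurable_prodMk_right
        rw [lintegral_mul_const _ hky]
        exact mul_le_mul' hy le_rfl
    _ = A ^ (r - 1) * B * ∫⁻ y, g y ^ r ∂ν := by
        rw [lintegral_const_mul'' _ (hg.pow_const r), mul_assoc]

/-- Schur's test; for `p = ∞` the exponents are `1` and `0`, since `1 / ∞.toReal = 0`. -/
lemma eLpNorm_lintegral_mul_le (hk : Measurable (Function.uncurry k))
    (rows : ∀ᵐ x ∂μ, ∫⁻ y, k x y ∂ν ≤ A) (columns : ∀ᵐ y ∂ν, ∫⁻ x, k x y ∂μ ≤ B)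
    (hg : AEMeasurable g ν) {p : ℝ≥0∞} (hp : 1 ≤ p) :
    eLpNorm (fun x => ∫⁻ y, k x y * g y ∂ν) p μ ≤
      A ^ (1 - 1 / p.toReal) * B ^ (1 / p.toReal) * eLpNorm g p ν := by
  rcases eq_or_ne p ∞ with rfl | p_ne_top
  · simp only [ENNReal.toReal_top, div_zero, sub_zero, ENNReal.rpow_one, ENNReal.rpow_zero,
      mul_one, eLpNorm_exponent_top]
    refine eLpNormEssSup_le_of_ae_enorm_bound (rows.mono fun x hx => ?_)
    have hkx : Measurable (k x) := hk.comp measurable_prodMk_left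
    calc ∫⁻ y, k x y * g y ∂ν ≤ ∫⁻ y, k x y * eLpNormEssSup g ν ∂ν :=
          lintegral_mono_ae (ae_le_eLpNormEssSup.mono fun y hy => mul_le_mul' le_rfl hy)
      _ ≤ A * eLpNormEssSup g ν := by
          rw [lintegral_mul_const _ hkx]
          exact mul_le_mul' hx le_rfl
  have p_ne_zero : p ≠ 0 := (one_pos.trans_le hp).ne'
  have hr : 1 ≤ p.toReal := ENNReal.toReal_one ▸ ENNReal.toReal_mono p_ne_top hp
  have hr0 : 0 < p.toReal := by linarith
  simp only [eLpNorm_eq_lintegral_rpow_enorm_toReal p_ne_zero p_ne_top, enorm_eq_self]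
  calc (∫⁻ x, (∫⁻ y, k x y * g y ∂ν) ^ p.toReal ∂μ) ^ (1 / p.toReal)
      ≤ (A ^ (p.toReal - 1) * B * ∫⁻ y, g y ^ p.toReal ∂ν) ^ (1 / p.toReal) :=
        ENNReal.rpow_le_rpow (lintegral_rpow_lintegral_mul_le hk rows columns hg hr)
          (by positivity)
    _ = A ^ (1 - 1 / p.toReal) * B ^ (1 / p.toReal) *
          (∫⁻ y, g y ^ p.toReal ∂ν) ^ (1 / p.toReal) := by
        rw [ENNReal.mul_rpow_of_nonneg _ _ (by positivity),
          ENNReal.mul_rpow_of_nonneg _ _ (by positivity), ← ENNReal.rpow_mul, sub_mul, one_mul,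
          mul_one_div_cancel hr0.ne']

end Schur

variable {X 𝕜 : Type*} [MeasurableSpace X] [RCLike 𝕜] {μ : Measure X} {K : X → X → ℝ} {M : ℝ}
  {f g : X → 𝕜} {p : ℝ≥0∞}

/-- The integral operator with real kernel `K`, acting on real or complex functions; the integral
is `0` at the points where it does not converge. -/
def kernelOp (μ : Measure X) (K : X → X → ℝ) (f : X → 𝕜) (x : X) : 𝕜 := ∫ y, K x y • f y ∂μ

lemma kernelOp_congr (K : X → X → ℝ) (h : f =ᵐ[μ] g) : kernelOp μ K f = kernelOp μ K g :=
  funext fun _ => integral_congr_ae (h.mono fun y hy => by simp only [hy])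

lemma kernelOp_ofReal (K : X → X → ℝ) (f : X → ℝ) (x : X) :
    kernelOp μ K (fun y => (f y : 𝕜)) x = ((∫ y, K x y * f y ∂μ : ℝ) : 𝕜) := by
  rw [kernelOp, ← integral_ofReal]
  simp only [RCLike.real_smul_eq_coe_mul, RCLike.ofReal_mul]

lemma kernelOp_nonneg (hK : ∀ x y, 0 ≤ K x y) (hf : ∀ᵐ x ∂μ, 0 ≤ f x) (x : X) :
    0 ≤ kernelOp μ K f x := by
  have real_valued : f =ᵐ[μ] fun y => ((RCLike.re (f y) : ℝ) : 𝕜) :=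
    hf.mono fun y hy => (RCLike.conj_eq_iff_re.1
      (RCLike.conj_eq_iff_im.2 (RCLike.nonneg_iff.1 hy).2)).symm
  rw [kernelOp_congr K real_valued, kernelOp_ofReal]
  exact RCLike.ofReal_nonneg.2 (integral_nonneg_of_ae
    (hf.mono fun y hy => mul_nonneg (hK x y) (RCLike.nonneg_iff.1 hy).1))

lemma enorm_kernelOp_le (K : X → X → ℝ) (f : X → 𝕜) (x : X) :
    ‖kernelOp μ K f x‖ₑ ≤ ∫⁻ y, ‖K x y‖ₑ * ‖f y‖ₑ ∂μ :=
  (enorm_integral_le_lintegral_enorm _).trans_eq (by simp only [enorm_smul])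

variable [SFinite μ]

lemma aestronglyMeasurable_kernelOp (hK : Measurable (Function.uncurry K))
    (hf : AEStronglyMeasurable f μ) : AEStronglyMeasurable (kernelOp μ K f) μ :=
  AEStronglyMeasurable.integral_prod_right' (f := fun z : X × X => K z.1 z.2 • f z.2)
    (hK.aestronglyMeasurable.smul hf.comp_snd)

lemma eLpNorm_lintegral_enorm_mul_le (hK : Measurable (Function.uncurry K))
    (symm : ∀ x y, K x y = K y x) (mass : ∀ᵐ x ∂μ, ∫⁻ y, ‖K x y‖ₑ ∂μ ≤ ENNReal.ofReal M)
    (hf : AEStronglyMeasurable f μ) (hp : 1 ≤ p) :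
    eLpNorm (fun x => ∫⁻ y, ‖K x y‖ₑ * ‖f y‖ₑ ∂μ) p μ ≤ ENNReal.ofReal M * eLpNorm f p μ := by
  have schur := eLpNorm_lintegral_mul_le hK.enorm mass
    (mass.mono fun y hy => by simpa only [symm _ y] using hy) hf.enorm hp
  have exponent_le_one : 1 / p.toReal ≤ 1 := by
    rcases eq_or_ne p ∞ with rfl | p_ne_top
    · simp only [ENNReal.toReal_top, div_zero, zero_le_one]
    · have hr : 1 ≤ p.toReal := ENNReal.toReal_one ▸ ENNReal.toReal_mono p_ne_top hp
      exact div_le_one_of_le₀ hr (zero_le_one.trans hr)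
  rwa [eLpNorm_enorm, ← ENNReal.rpow_add_of_nonneg _ _ (sub_nonneg.2 exponent_le_one)
    (by positivity), sub_add_cancel, ENNReal.rpow_one] at schur

lemma lpOpNormLE_kernelOp (hK : Measurable (Function.uncurry K))
    (symm : ∀ x y, K x y = K y x) (mass : ∀ᵐ x ∂μ, ∫⁻ y, ‖K x y‖ₑ ∂μ ≤ ENNReal.ofReal M)
    (hp : 1 ≤ p) : LpOpNormLE μ p (kernelOp (𝕜 := 𝕜) μ K) M := by
  intro f hf
  have norm_le : eLpNorm (kernelOp μ K f) p μ ≤ ENNReal.ofReal M * eLpNorm f p μ :=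
    (eLpNorm_mono_enorm fun x => (enorm_kernelOp_le K f x).trans_eq (enorm_eq_self _).symm).trans
      (eLpNorm_lintegral_enorm_mul_le hK symm mass hf.aestronglyMeasurable hp)
  exact ⟨⟨aestronglyMeasurable_kernelOp hK hf.aestronglyMeasurable,
    norm_le.trans_lt (ENNReal.mul_lt_top ENNReal.ofReal_lt_top hf.eLpNorm_lt_top)⟩, norm_le⟩

lemma integrable_kernel_smul_mul (hK : Measurable (Function.uncurry K))
    (symm : ∀ x y, K x y = K y x) (mass : ∀ᵐ x ∂μ, ∫⁻ y, ‖K x y‖ₑ ∂μ ≤ ENNReal.ofReal M)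
    (hf : MemLp f 2 μ) (hg : MemLp g 2 μ) :
    Integrable (Function.uncurry fun x y => K x y • (f y * g x)) (μ.prod μ) := by
  have hfm := hf.aestronglyMeasurable
  have hgm := hg.aestronglyMeasurable
  have measurable_integrand :
      AEStronglyMeasurable (Function.uncurry fun x y => K x y • (f y * g x)) (μ.prod μ) :=
    hK.aestronglyMeasurable.smul (hfm.comp_snd.mul hgm.comp_fst)
  have measurable_inner : AEMeasurable (fun x => ∫⁻ y, ‖K x y‖ₑ * ‖f y‖ₑ ∂μ) μ :=
    AEMeasurable.lintegral_prod_right' (f := fun z : X × X => ‖K z.1 z.2‖ₑ * ‖f z.2‖ₑ)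
      (hK.enorm.aemeasurable.mul hfm.comp_snd.enorm)
  have inner_lt_top := (eLpNorm_lintegral_enorm_mul_le hK symm mass hfm one_le_two).trans_lt
    (ENNReal.mul_lt_top ENNReal.ofReal_lt_top hf.eLpNorm_lt_top)
  have norm_lt_top := hg.eLpNorm_lt_top
  rw [eLpNorm_eq_lintegral_rpow_enorm_toReal two_ne_zero ENNReal.ofNat_ne_top,
    ENNReal.toReal_ofNat] at inner_lt_top norm_lt_top
  refine ⟨measurable_integrand, ?_⟩
  calc ∫⁻ z, ‖Function.uncurry (fun x y => K x y • (f y * g x)) z‖ₑ ∂μ.prod μ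
      = ∫⁻ x, (∫⁻ y, ‖K x y‖ₑ * ‖f y‖ₑ ∂μ) * ‖g x‖ₑ ∂μ := by
        rw [lintegral_prod _ measurable_integrand.enorm]
        simp only [Function.uncurry, enorm_smul, enorm_mul, ← mul_assoc]
        exact lintegral_congr fun x => lintegral_mul_const' _ _ enorm_ne_top
    _ < ∞ := (ENNReal.lintegral_mul_le_Lp_mul_Lq μ Real.HolderConjugate.two_two measurable_inner
        hgm.enorm).trans_lt (ENNReal.mul_lt_top inner_lt_top norm_lt_top)

lemma integral_conj_kernelOp_mul (hK : Measurable (Function.uncurry K))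
    (symm : ∀ x y, K x y = K y x) (mass : ∀ᵐ x ∂μ, ∫⁻ y, ‖K x y‖ₑ ∂μ ≤ ENNReal.ofReal M)
    (hf : MemLp f 2 μ) (hg : MemLp g 2 μ) :
    ∫ x, conj (kernelOp μ K f x) * g x ∂μ = ∫ x, conj (f x) * kernelOp μ K g x ∂μ := by
  calc ∫ x, conj (kernelOp μ K f x) * g x ∂μ
      = ∫ x, ∫ y, K x y • (conj (f y) * g x) ∂μ ∂μ := by
        refine integral_congr_ae (Eventually.of_forall fun x => ?_)
        simp only [kernelOp, ← integral_conj, ← integral_mul_const, RCLike.real_smul_eq_coe_mul,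
          map_mul, RCLike.conj_ofReal, mul_assoc]
    _ = ∫ y, ∫ x, K x y • (conj (f y) * g x) ∂μ ∂μ :=
        integral_integral_swap (integrable_kernel_smul_mul hK symm mass hf.star hg)
    _ = ∫ x, conj (f x) * kernelOp μ K g x ∂μ := by
        refine integral_congr_ae (Eventually.of_forall fun y => ?_)
        simp only [kernelOp, ← integral_const_mul, symm _ y, mul_smul_comm]

/-- Composition of integral operators with nonnegative kernels. -/
lemma kernelOp_kernelOp {K' K'' : X → X → ℝ} (hK : Measurable (Function.uncurry K))
    (hK' : Measurable (Function.uncurry K')) (K_nonneg : ∀ x y, 0 ≤ K x y)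
    (K'_nonneg : ∀ x y, 0 ≤ K' x y) (hf : AEStronglyMeasurable f μ) (x : X)
    (comp : ∀ᵐ y ∂μ, Integrable (fun z => K x z * K' z y) μ ∧ ∫ z, K x z * K' z y ∂μ = K'' x y)
    (integrable : Integrable (fun y => K'' x y • f y) μ) :
    kernelOp μ K'' f x = kernelOp μ K (kernelOp μ K' f) x := by
  have measurable_integrand :
      AEStronglyMeasurable (Function.uncurry fun y z => (K x z * K' z y) • f y) (μ.prod μ) := by
    have : Measurable fun q : X × X => K x q.2 * K' q.2 q.1 :=
      (hK.comp (measurable_const.prodMk measurable_snd)).mul (hK'.comp measurable_swap)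
    exact this.aestronglyMeasurable.smul hf.comp_fst
  have integrable_integrand :
      Integrable (Function.uncurry fun y z => (K x z * K' z y) • f y) (μ.prod μ) := by
    refine ⟨measurable_integrand, ?_⟩
    rw [HasFiniteIntegral, lintegral_prod _ measurable_integrand.enorm]
    refine lt_of_eq_of_lt (lintegral_congr_ae (comp.mono fun y hy => ?_)) integrable.2
    have nonneg (z : X) : 0 ≤ K x z * K' z y := mul_nonneg (K_nonneg _ _) (K'_nonneg _ _)
    simp only [Function.uncurry, enorm_smul]
    rw [lintegral_mul_const' _ _ enorm_ne_top, ← hy.2,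
      Real.enorm_of_nonneg (integral_nonneg nonneg),
      ofReal_integral_eq_lintegral_ofReal hy.1 (Eventually.of_forall nonneg)]
    simp only [Real.enorm_of_nonneg (nonneg _)]
  calc kernelOp μ K'' f x = ∫ y, ∫ z, (K x z * K' z y) • f y ∂μ ∂μ :=
        integral_congr_ae (comp.mono fun y hy => by simp only [integral_smul_const, hy.2])
    _ = ∫ z, ∫ y, (K x z * K' z y) • f y ∂μ ∂μ := integral_integral_swap integrable_integrand
    _ = kernelOp μ K (kernelOp μ K' f) x := by
        simp only [kernelOp, ← smul_smul, integral_smul]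

end PositiveKernel

section LpOperators

variable {X 𝕜 : Type*} [MeasurableSpace X] [RCLike 𝕜] {μ : Measure X} {p : ℝ≥0∞} {f : X → 𝕜}
  {S S' : (X → 𝕜) → X → 𝕜} {C C' : ℝ}

lemma LpOpNormLE.congr (h : LpOpNormLE μ p S C) (hS : ∀ f, S f =ᵐ[μ] S' f) :
    LpOpNormLE μ p S' C := fun f hf =>
  ⟨(h f hf).1.ae_eq (hS f), (eLpNorm_congr_ae (hS f)).symm.trans_le (h f hf).2⟩

lemma LpOpNormLE.mono (h : LpOpNormLE μ p S C) (hC : C ≤ C') : LpOpNormLE μ p S C' := fun f hf =>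
  ⟨(h f hf).1, (h f hf).2.trans (mul_le_mul_left (ENNReal.ofReal_le_ofReal hC) _)⟩

lemma LpOpNormLE.id (p : ℝ≥0∞) : LpOpNormLE μ p (fun f : X → 𝕜 => f) 1 := fun f hf =>
  ⟨hf, by simp⟩

lemma MemL1AddLinfty.aestronglyMeasurable (hf : MemL1AddLinfty μ f) :
    AEStronglyMeasurable f μ := by
  obtain ⟨g, h, hg, hh, rfl⟩ := hf
  exact hg.aestronglyMeasurable.add hh.aestronglyMeasurable

/-- Cut `f` at height one. -/
lemma memL1AddLinfty_of_memLp (hp : 1 ≤ p) (hf : MemLp f p μ) : MemL1AddLinfty μ f := by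
  rcases eq_or_ne p ∞ with rfl | p_ne_top
  · exact ⟨0, f, MemLp.zero, hf, (zero_add f).symm⟩
  have p_ne_zero : p ≠ 0 := (one_pos.trans_le hp).ne'
  have hr : 1 ≤ p.toReal := ENNReal.toReal_one ▸ ENNReal.toReal_mono p_ne_top hp
  have hm := hf.aestronglyMeasurable
  let s := {x | 1 < ‖hm.mk f x‖}
  have hs : MeasurableSet s :=
    measurableSet_lt measurable_const hm.stronglyMeasurable_mk.norm.measurable
  refine ⟨s.indicator f, sᶜ.indicator f, ⟨hm.indicator hs, ?_⟩,
    memLp_top_of_bound (hm.indicator hs.compl) 1 ?_, (Set.indicator_self_add_compl s f).symm⟩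
  · rw [eLpNorm_one_eq_lintegral_enorm]
    refine lt_of_le_of_lt (lintegral_mono_ae (hm.ae_eq_mk.mono fun x hx => ?_))
      (lintegral_rpow_enorm_lt_top_of_eLpNorm_lt_top p_ne_zero p_ne_top hf.eLpNorm_lt_top)
    by_cases hxs : x ∈ s
    · have one_le : 1 ≤ ‖f x‖ₑ := by
        rw [hx, ← ofReal_norm, ENNReal.one_le_ofReal]
        exact le_of_lt hxs
      simpa only [Set.indicator_of_mem hxs, ENNReal.rpow_one] using
        ENNReal.rpow_le_rpow_of_exponent_le one_le hr
    · simp [Set.indicator_of_notMem hxs]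
  · filter_upwards [hm.ae_eq_mk] with x hx
    by_cases hxs : x ∈ s
    · simp [hxs]
    · rw [Set.indicator_of_mem (Set.mem_compl hxs), hx]
      exact not_lt.1 hxs

end LpOperators

/-! ### The heat kernel on the orthant -/

section PiProd

variable {d : ℕ} {κ R : Type*} [NormedCommRing R] {f : Fin d → κ → R}

lemma summable_norm_prod_pi (hf : ∀ i, Summable fun n => ‖f i n‖) :
    Summable fun k : Fin d → κ => ‖∏ i, f i (k i)‖ := by
  induction d with
  | zero => exact Summable.of_finite
  | succ d ih =>
    rw [← (Fin.consEquiv fun _ => κ).summable_iff]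
    refine ((hf 0).mul_norm (ih fun i => hf i.succ)).congr fun p => ?_
    simp [Fin.consEquiv, Fin.prod_univ_succ]

lemma hasSum_prod_pi [CompleteSpace R] {g : Fin d → R} (hf : ∀ i, Summable fun n => ‖f i n‖)
    (hg : ∀ i, HasSum (f i) (g i)) :
    HasSum (fun k : Fin d → κ => ∏ i, f i (k i)) (∏ i, g i) := by
  induction d with
  | zero =>
    simp only [Finset.univ_eq_empty, Finset.prod_empty]
    exact hasSum_unique fun _ : Fin 0 → κ => (1 : R)
  | succ d ih =>
    rw [← (Fin.consEquiv fun _ => κ).hasSum_iff, Fin.prod_univ_succ]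
    have product_summable := summable_mul_of_summable_norm (hf 0)
      (summable_norm_prod_pi fun i : Fin d => hf i.succ)
    refine ((hg 0).mul (ih (fun i => hf i.succ) fun i => hg i.succ) product_summable).congr_fun
      fun p => ?_
    simp [Fin.consEquiv, Fin.prod_univ_succ]

end PiProd

section Orthant

lemma orthant_eq_pi (d : ℕ) : orthant d = Set.univ.pi fun _ => Set.Ioi 0 := by
  ext x
  simp [orthant]

lemma orthantMeasure_eq_pi (d : ℕ) :
    orthantMeasure d = Measure.pi fun _ : Fin d => volume.restrict (Set.Ioi (0 : ℝ)) := by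
  rw [← Measure.restrict_pi_pi, orthantMeasure, volume_pi, orthant_eq_pi]

instance (d : ℕ) : SigmaFinite (orthantMeasure d) := by
  unfold orthantMeasure
  infer_instance

lemma measurableSet_orthant (d : ℕ) : MeasurableSet (orthant d) := by
  rw [orthant_eq_pi]
  exact MeasurableSet.univ_pi fun _ => measurableSet_Ioi

lemma ae_mem_orthant (d : ℕ) : ∀ᵐ x ∂orthantMeasure d, x ∈ orthant d :=
  ae_restrict_mem (measurableSet_orthant d)

end Orthant

section OrthantKernel

variable {d : ℕ} {α : Fin d → ℝ} {t : ℝ} {x y : Fin d → ℝ}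

lemma exp_neg_mul_laguerreEigenvalue (α : Fin d → ℝ) (t : ℝ) (k : Fin d → ℕ) :
    Real.exp (-t * laguerreEigenvalue α k) =
      ∏ i, Real.exp (-t * (4 * k i + 2 * α i + 2)) := by
  rw [← Real.exp_sum, laguerreEigenvalue, ← Finset.mul_sum, Finset.sum_add_distrib,
    Finset.sum_add_distrib, ← Finset.mul_sum, ← Finset.mul_sum, Finset.sum_const,
    Finset.card_univ, Fintype.card_fin, nsmul_eq_mul, mul_comm (d : ℝ)]

lemma laguerreKernelTerm_eq_prod (α : Fin d → ℝ) (t : ℝ) (x y : Fin d → ℝ) (k : Fin d → ℕ) :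
    laguerreKernelTerm α t x y k = ∏ i, (Real.exp (-t * (4 * k i + 2 * α i + 2)) *
      laguerreHermite1 (k i) (α i) (x i) * laguerreHermite1 (k i) (α i) (y i)) := by
  rw [laguerreKernelTerm, exp_neg_mul_laguerreEigenvalue, laguerreHermite, laguerreHermite,
    Finset.prod_mul_distrib, Finset.prod_mul_distrib]

/-- The closed form of the heat kernel on the orthant, given by the Hille-Hardy formula. It agrees
with `laguerreHeatKernel` at the points of the orthant, and is nonnegative everywhere. -/
def laguerreKernel (α : Fin d → ℝ) (t : ℝ) (x y : Fin d → ℝ) : ℝ :=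
  ∏ i, laguerreKernel1 (α i) t (x i) (y i)

lemma hasSum_laguerreKernelTerm (hα : ∀ i, -1 < α i) (ht : 0 < t) (hx : x ∈ orthant d)
    (hy : y ∈ orthant d) : HasSum (laguerreKernelTerm α t x y) (laguerreKernel α t x y) := by
  have factor (i : Fin d) := hasSum_laguerreKernel1 (hα i) ht (hx i) (hy i)
  exact (hasSum_prod_pi (fun i => (factor i).summable.norm) factor).congr_fun
    fun k => laguerreKernelTerm_eq_prod α t x y k

lemma laguerreHeatKernel_eq (hα : ∀ i, -1 < α i) (ht : 0 < t) (hx : x ∈ orthant d)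
    (hy : y ∈ orthant d) : laguerreHeatKernel α t x y = laguerreKernel α t x y :=
  (hasSum_laguerreKernelTerm hα ht hx hy).tsum_eq

lemma laguerreKernel_nonneg (hα : ∀ i, -1 < α i) (ht : 0 ≤ t) (x y : Fin d → ℝ) :
    0 ≤ laguerreKernel α t x y :=
  Finset.prod_nonneg fun i _ => laguerreKernel1_nonneg (hα i) ht _ _

lemma laguerreKernel_comm (α : Fin d → ℝ) (t : ℝ) (x y : Fin d → ℝ) :
    laguerreKernel α t x y = laguerreKernel α t y x :=
  Finset.prod_congr rfl fun i _ => laguerreKernel1_comm (α i) t (x i) (y i)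

lemma measurable_laguerreKernel (α : Fin d → ℝ) (t : ℝ) :
    Measurable (Function.uncurry (laguerreKernel α t)) := by
  have factor (i : Fin d) : Measurable fun p : (Fin d → ℝ) × (Fin d → ℝ) =>
      laguerreKernel1 (α i) t (p.1 i) (p.2 i) :=
    (measurable_laguerreKernel1 (α i) t).comp
      (f := fun p : (Fin d → ℝ) × (Fin d → ℝ) => (p.1 i, p.2 i)) (by fun_prop)
  exact Finset.measurable_fun_prod Finset.univ fun i _ => factor i

lemma neg_one_lt_of_neg_half_le (hα : ∀ i, -1 / 2 ≤ α i) (i : Fin d) : -1 < α i := by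
  linarith [hα i]

lemma exists_laguerreKernel_le (hα : ∀ i, -1 / 2 ≤ α i) (ht : 0 < t) (hx : x ∈ orthant d) :
    ∃ C : ℝ, ∀ y ∈ orthant d, laguerreKernel α t x y ≤ C := by
  choose C hC using fun i => exists_laguerreKernel1_le (hα i) ht (hx i)
  exact ⟨∏ i, C i, fun y hy => Finset.prod_le_prod
    (fun i _ => laguerreKernel1_nonneg (neg_one_lt_of_neg_half_le hα i) ht.le _ _)
    fun i _ => hC i (y i) (hy i)⟩

lemma integrableOn_laguerreKernel1 {a u : ℝ} (ha : -1 / 2 ≤ a) (ht : 0 < t) (hu : 0 < u) :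
    IntegrableOn (laguerreKernel1 a t u) (Set.Ioi 0) := by
  have : 0 < Real.sinh (2 * t) := Real.sinh_pos_iff.2 (by linarith)
  have : 0 < Real.cosh (2 * t) := Real.cosh_pos _
  have measurable_kernel : Measurable (laguerreKernel1 a t u) :=
    Measurable.of_uncurry_left (f := laguerreKernel1 a t) (measurable_laguerreKernel1 a t)
  have kernel_nonneg (v : ℝ) : 0 ≤ laguerreKernel1 a t u v :=
    laguerreKernel1_nonneg (by linarith) ht.le u v
  refine ⟨measurable_kernel.aestronglyMeasurable, ?_⟩
  rw [hasFiniteIntegral_iff_ofReal (Eventually.of_forall kernel_nonneg),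
    lintegral_laguerreKernel1 (by linarith) ht hu]
  obtain ⟨c, -, mass_le⟩ := exists_laguerreMass_le (δ := a / 2 + 1 / 4) (by linarith)
  exact ENNReal.mul_lt_top ENNReal.ofReal_lt_top
    ((mass_le _ (by positivity)).trans_lt ENNReal.ofReal_lt_top)

lemma integrable_laguerreKernel (hα : ∀ i, -1 / 2 ≤ α i) (ht : 0 < t) (hx : x ∈ orthant d) :
    Integrable (laguerreKernel α t x) (orthantMeasure d) := by
  rw [orthantMeasure_eq_pi]
  exact Integrable.fintype_prod (f := fun i => laguerreKernel1 (α i) t (x i))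
    fun i => integrableOn_laguerreKernel1 (hα i) ht (hx i)

lemma lintegral_laguerreKernel (hα : ∀ i, -1 / 2 ≤ α i) (ht : 0 < t) (hx : x ∈ orthant d) :
    ∫⁻ y, ENNReal.ofReal (laguerreKernel α t x y) ∂orthantMeasure d =
      ∏ i, ∫⁻ u in Set.Ioi (0 : ℝ), ENNReal.ofReal (laguerreKernel1 (α i) t (x i) u) := by
  have hα' := neg_one_lt_of_neg_half_le hα
  have factor_nonneg (i u) : 0 ≤ laguerreKernel1 (α i) t (x i) u :=
    laguerreKernel1_nonneg (hα' i) ht.le _ _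
  have factor_integral (i : Fin d) := ofReal_integral_eq_lintegral_ofReal
    (integrableOn_laguerreKernel1 (hα i) ht (hx i)) (Eventually.of_forall (factor_nonneg i))
  rw [← ofReal_integral_eq_lintegral_ofReal (integrable_laguerreKernel hα ht hx)
    (Eventually.of_forall (laguerreKernel_nonneg hα' ht.le x)), orthantMeasure_eq_pi]
  unfold laguerreKernel
  rw [integral_fintype_prod_eq_prod fun i => laguerreKernel1 (α i) t (x i),
    ENNReal.ofReal_prod_of_nonneg fun i _ => integral_nonneg (factor_nonneg i)]
  exact Finset.prod_congr rfl fun i _ => factor_integral i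

lemma ae_norm_laguerreKernel_le (hα : ∀ i, -1 / 2 ≤ α i) (ht : 0 < t) (hx : x ∈ orthant d) :
    ∃ C : ℝ, ∀ᵐ y ∂orthantMeasure d, ‖laguerreKernel α t x y‖ ≤ C := by
  obtain ⟨C, kernel_le⟩ := exists_laguerreKernel_le hα ht hx
  refine ⟨C, (ae_mem_orthant d).mono fun y hy => ?_⟩
  rw [Real.norm_of_nonneg (laguerreKernel_nonneg (neg_one_lt_of_neg_half_le hα) ht.le x y)]
  exact kernel_le y hy

lemma integrable_laguerreKernel_smul {𝕜 : Type*} [RCLike 𝕜] (hα : ∀ i, -1 / 2 ≤ α i)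
    (ht : 0 < t) {f : (Fin d → ℝ) → 𝕜} (hf : MemL1AddLinfty (orthantMeasure d) f)
    (hx : x ∈ orthant d) :
    Integrable (fun y => laguerreKernel α t x y • f y) (orthantMeasure d) := by
  obtain ⟨g, h, hg, hh, rfl⟩ := hf
  have integrable_kernel := integrable_laguerreKernel hα ht hx
  obtain ⟨C, kernel_le⟩ := ae_norm_laguerreKernel_le hα ht hx
  have integrable_L1_part : Integrable (laguerreKernel α t x • g) (orthantMeasure d) :=
    (memLp_one_iff_integrable.1 hg).bdd_smul C integrable_kernel.aestronglyMeasurable kernel_le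
  have integrable_Linfty_part : Integrable (laguerreKernel α t x • h) (orthantMeasure d) := by
    refine integrable_kernel.smul_bdd (eLpNorm h ∞ (orthantMeasure d)).toReal
      hh.aestronglyMeasurable ?_
    filter_upwards [ae_le_eLpNormEssSup (f := h) (μ := orthantMeasure d)] with y hy
    rw [← toReal_enorm]
    exact ENNReal.toReal_mono hh.eLpNorm_ne_top hy
  exact (integrable_L1_part.add integrable_Linfty_part).congr
    (Eventually.of_forall fun y => by simp only [Pi.add_apply, Pi.smul_apply', smul_add])

lemma memLp_two_laguerreKernel (hα : ∀ i, -1 / 2 ≤ α i) (ht : 0 < t) (hx : x ∈ orthant d) :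
    MemLp (laguerreKernel α t x) 2 (orthantMeasure d) := by
  have integrable_kernel := integrable_laguerreKernel hα ht hx
  obtain ⟨C, kernel_le⟩ := ae_norm_laguerreKernel_le hα ht hx
  rw [memLp_two_iff_integrable_sq integrable_kernel.aestronglyMeasurable]
  simp only [sq]
  exact integrable_kernel.bdd_mul integrable_kernel.aestronglyMeasurable kernel_le

end OrthantKernel

section Coefficients

variable {d : ℕ} {α : Fin d → ℝ} {s t : ℝ} {x y : Fin d → ℝ}

lemma summable_exp_mul_abs_laguerreHermite1 {a : ℝ} (ha : -1 < a) (ht : 0 < t) (u : ℝ) :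
    Summable fun n : ℕ => ‖Real.exp (-t * (4 * n + 2 * a + 2)) * laguerreHermite1 n a u‖ := by
  refine ((summable_abs_laguerreHermite1_mul_pow ha (Real.exp_nonneg (-4 * t))
    (Real.exp_lt_one_iff.2 (by linarith)) u).mul_left (Real.exp (-t * (2 * a + 2)))).congr
    fun n => ?_
  rw [norm_mul, Real.norm_eq_abs, Real.norm_eq_abs, Real.abs_exp, ← Real.exp_nat_mul,
    mul_comm |_| (Real.exp _), ← mul_assoc, ← Real.exp_add]
  ring_nf

lemma summable_exp_mul_abs_laguerreHermite (hα : ∀ i, -1 < α i) (ht : 0 < t) (x : Fin d → ℝ) :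
    Summable fun k : Fin d → ℕ =>
      |Real.exp (-t * laguerreEigenvalue α k) * laguerreHermite α k x| := by
  refine (summable_norm_prod_pi fun i =>
    summable_exp_mul_abs_laguerreHermite1 (hα i) ht (x i)).congr fun k => ?_
  rw [Finset.prod_mul_distrib, ← exp_neg_mul_laguerreEigenvalue, Real.norm_eq_abs, laguerreHermite]

lemma integral_laguerreHermite_mul (hα : ∀ i, -1 < α i) (k l : Fin d → ℕ) :
    ∫ x, laguerreHermite α k x * laguerreHermite α l x ∂orthantMeasure d =
      if k = l then 1 else 0 := by
  simp only [laguerreHermite, ← Finset.prod_mul_distrib]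
  rw [orthantMeasure_eq_pi, integral_fintype_prod_eq_prod fun i u =>
    laguerreHermite1 (k i) (α i) u * laguerreHermite1 (l i) (α i) u]
  simp only [fun i => integral_laguerreHermite1_mul (hα i) (k i) (l i), Finset.prod_ite_zero,
    Finset.prod_const_one, Finset.mem_univ, true_implies, funext_iff]

lemma measurable_laguerreHermite (α : Fin d → ℝ) (k : Fin d → ℕ) :
    Measurable (laguerreHermite α k) :=
  Finset.measurable_fun_prod _ fun i _ =>
    (measurable_laguerreHermite1 (k i) (α i)).comp (measurable_pi_apply i)

lemma memLp_laguerreHermite (hα : ∀ i, -1 < α i) (k : Fin d → ℕ) :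
    MemLp (laguerreHermite α k) 2 (orthantMeasure d) := by
  rw [memLp_two_iff_integrable_sq (measurable_laguerreHermite α k).aestronglyMeasurable]
  simp only [laguerreHermite, sq, ← Finset.prod_mul_distrib]
  rw [orthantMeasure_eq_pi]
  exact Integrable.fintype_prod (f := fun i u => laguerreHermite1 (k i) (α i) u *
    laguerreHermite1 (k i) (α i) u) fun i => integrableOn_laguerreHermite1_mul (hα i) _ _

variable {𝕜 : Type*} [RCLike 𝕜] {f : (Fin d → ℝ) → 𝕜}

lemma integrable_laguerreHermite_smul (hα : ∀ i, -1 < α i) (k : Fin d → ℕ)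
    (hf : MemLp f 2 (orthantMeasure d)) :
    Integrable (fun x => laguerreHermite α k x • f x) (orthantMeasure d) := by
  simp only [RCLike.real_smul_eq_coe_mul]
  exact (memLp_laguerreHermite hα k).ofReal.integrable_mul hf

lemma integral_norm_laguerreHermite_smul_le (hα : ∀ i, -1 < α i) (k : Fin d → ℕ)
    (hf : MemLp f 2 (orthantMeasure d)) :
    ∫ x, ‖laguerreHermite α k x • f x‖ ∂orthantMeasure d ≤
      1 + ∫ x, ‖f x‖ ^ 2 ∂orthantMeasure d := by
  have sq_integral : ∫ x, laguerreHermite α k x ^ 2 ∂orthantMeasure d = 1 := by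
    simpa only [sq, if_true] using integral_laguerreHermite_mul hα k k
  have integrable_sq := (memLp_laguerreHermite hα k).integrable_sq
  have integrable_norm_sq := (memLp_two_iff_integrable_sq_norm hf.aestronglyMeasurable).1 hf
  rw [← sq_integral, ← integral_add integrable_sq integrable_norm_sq]
  refine integral_mono (integrable_laguerreHermite_smul hα k hf).norm
    (integrable_sq.add integrable_norm_sq) fun x => ?_
  simp only
  rw [norm_smul, Real.norm_eq_abs, ← sq_abs (laguerreHermite α k x)]
  nlinarith [two_mul_le_add_sq |laguerreHermite α k x| ‖f x‖,
    mul_nonneg (abs_nonneg (laguerreHermite α k x)) (norm_nonneg (f x))]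

lemma hasSum_smul_laguerreCoeff (hα : ∀ i, -1 < α i) {A : (Fin d → ℕ) → ℝ}
    {B : (Fin d → ℝ) → ℝ} (hA : Summable fun k => |A k|)
    (hB : ∀ y ∈ orthant d, HasSum (fun k => A k * laguerreHermite α k y) (B y))
    (hf : MemLp f 2 (orthantMeasure d)) :
    HasSum (fun k => A k • laguerreCoeff α f k) (∫ y, B y • f y ∂orthantMeasure d) := by
  have integrable_term (k) :
      Integrable (fun y => A k • (laguerreHermite α k y • f y)) (orthantMeasure d) :=
    (integrable_laguerreHermite_smul hα k hf).smul (A k)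
  have summable_norms : Summable fun k =>
      ∫ y, ‖A k • (laguerreHermite α k y • f y)‖ ∂orthantMeasure d := by
    refine Summable.of_nonneg_of_le (fun k => integral_nonneg fun y => norm_nonneg _)
      (fun k => ?_) (hA.mul_right (1 + ∫ x, ‖f x‖ ^ 2 ∂orthantMeasure d))
    simp only [fun y => norm_smul (A k) (laguerreHermite α k y • f y)]
    rw [integral_const_mul, Real.norm_eq_abs]
    exact mul_le_mul_of_nonneg_left (integral_norm_laguerreHermite_smul_le hα k hf)
      (abs_nonneg _)
  have series_eq : ∫ y, ∑' k, A k • (laguerreHermite α k y • f y) ∂orthantMeasure d =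
      ∫ y, B y • f y ∂orthantMeasure d := by
    refine integral_congr_ae ((ae_mem_orthant d).mono fun y hy => ?_)
    simp only [smul_smul]
    exact ((hB y hy).smul_const (f y)).tsum_eq
  rw [← series_eq]
  exact (hasSum_integral_of_summable_integral_norm integrable_term summable_norms).congr_fun
    fun k => (integral_smul (A k) _).symm

lemma hasSum_kernelOp_laguerreKernel (hα : ∀ i, -1 < α i) (ht : 0 < t)
    (hf : MemLp f 2 (orthantMeasure d)) (hx : x ∈ orthant d) :
    HasSum (fun k => (Real.exp (-t * laguerreEigenvalue α k) * laguerreHermite α k x) •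
      laguerreCoeff α f k) (kernelOp (orthantMeasure d) (laguerreKernel α t) f x) :=
  hasSum_smul_laguerreCoeff hα (summable_exp_mul_abs_laguerreHermite hα ht x)
    (fun _ hy => hasSum_laguerreKernelTerm hα ht hx hy) hf

lemma laguerreCoeff_laguerreHermite (hα : ∀ i, -1 < α i) (k l : Fin d → ℕ) :
    laguerreCoeff α (fun x => ((laguerreHermite α l x : ℝ) : 𝕜)) k = if k = l then 1 else 0 := by
  simp only [laguerreCoeff, RCLike.real_smul_eq_coe_mul, ← RCLike.ofReal_mul]
  rw [integral_ofReal, integral_laguerreHermite_mul hα]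
  split_ifs <;> simp

lemma kernelOp_laguerreHermite (hα : ∀ i, -1 < α i) (ht : 0 < t) (l : Fin d → ℕ)
    (hx : x ∈ orthant d) :
    kernelOp (orthantMeasure d) (laguerreKernel α t)
      (fun y => ((laguerreHermite α l y : ℝ) : 𝕜)) x =
      ((Real.exp (-t * laguerreEigenvalue α l) * laguerreHermite α l x : ℝ) : 𝕜) := by
  refine (hasSum_kernelOp_laguerreKernel hα ht (memLp_laguerreHermite hα l).ofReal hx).unique
    ((hasSum_ite_eq l _).congr_fun fun k => ?_)
  rw [laguerreCoeff_laguerreHermite hα]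
  split_ifs with hkl
  · rw [hkl, RCLike.real_smul_eq_coe_mul, mul_one]
  · rw [smul_zero]

lemma laguerreCoeff_laguerreKernel (hα : ∀ i, -1 < α i) (ht : 0 < t) (hy : y ∈ orthant d)
    (k : Fin d → ℕ) : laguerreCoeff α (laguerreKernel α t y) k =
      Real.exp (-t * laguerreEigenvalue α k) * laguerreHermite α k y := by
  have eigen := kernelOp_laguerreHermite (𝕜 := ℝ) hα ht k hy
  simp only [kernelOp, RCLike.ofReal_real_eq_id, id_eq, smul_eq_mul] at eigen
  simp only [laguerreCoeff, smul_eq_mul, mul_comm (laguerreHermite α k _), eigen]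

lemma integrable_laguerreKernel_mul (hα : ∀ i, -1 / 2 ≤ α i) (hs : 0 < s) (ht : 0 < t)
    (hx : x ∈ orthant d) (hy : y ∈ orthant d) :
    Integrable (fun z => laguerreKernel α s x z * laguerreKernel α t z y) (orthantMeasure d) := by
  simp only [laguerreKernel_comm α t _ y]
  exact (memLp_two_laguerreKernel hα hs hx).integrable_mul (memLp_two_laguerreKernel hα ht hy)

/-- The Chapman-Kolmogorov equation. -/
lemma integral_laguerreKernel_mul (hα : ∀ i, -1 / 2 ≤ α i) (hs : 0 < s) (ht : 0 < t)
    (hx : x ∈ orthant d) (hy : y ∈ orthant d) :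
    ∫ z, laguerreKernel α s x z * laguerreKernel α t z y ∂orthantMeasure d =
      laguerreKernel α (s + t) x y := by
  have hα' := neg_one_lt_of_neg_half_le hα
  simp only [laguerreKernel_comm α t _ y]
  have expansion := hasSum_kernelOp_laguerreKernel hα' hs (memLp_two_laguerreKernel hα ht hy) hx
  simp only [laguerreCoeff_laguerreKernel hα' ht hy] at expansion
  refine expansion.unique
    ((hasSum_laguerreKernelTerm hα' (add_pos hs ht) hx hy).congr_fun fun k => ?_)
  rw [laguerreKernelTerm, neg_add, add_mul, Real.exp_add, smul_eq_mul]
  ring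

end Coefficients

/-! ### Completeness of the Laguerre functions -/

section Moments

open BoundedContinuousFunction

variable {E : Type*} [TopologicalSpace E] [MeasurableSpace E] [BorelSpace E] {μ : Measure E}
  {h : E → ℝ}

lemma integral_mul_eq_zero_of_mem_adjoin [SecondCountableTopology E] {s : Set (E →ᵇ ℝ)}
    (hh : Integrable h μ) (h0 : ∀ g ∈ Submonoid.closure s, ∫ x, h x * g x ∂μ = 0) {g : E →ᵇ ℝ}
    (hg : g ∈ Algebra.adjoin ℝ s) : ∫ x, h x * g x ∂μ = 0 := by
  have integrable_mul (g : E →ᵇ ℝ) : Integrable (fun x => h x * g x) μ :=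
    hh.mul_bdd g.continuous.aestronglyMeasurable (Eventually.of_forall g.norm_coe_le_norm)
  rw [← Subalgebra.mem_toSubmodule, Algebra.adjoin_eq_span] at hg
  induction hg using Submodule.span_induction with
  | mem g hg => exact h0 g hg
  | zero => simp only [coe_zero, Pi.zero_apply, mul_zero, integral_zero]
  | add g₁ g₂ _ _ ih₁ ih₂ =>
    simp only [coe_add, Pi.add_apply, mul_add]
    rw [integral_add (integrable_mul g₁) (integrable_mul g₂), ih₁, ih₂, add_zero]
  | smul c g _ ih =>
    simp only [coe_smul, smul_eq_mul, mul_left_comm _ c]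
    rw [integral_const_mul, ih, mul_zero]

/-- The positive and negative parts of `h` are the densities of two finite measures, which the
subalgebra does not distinguish. -/
lemma ae_eq_zero_of_forall_mem_integral_mul_eq_zero [PolishSpace E]
    {A : StarSubalgebra ℝ (E →ᵇ ℝ)} (hA : (A.map (toContinuousMapStarₐ ℝ)).SeparatesPoints)
    (hh : Integrable h μ) (h0 : ∀ g ∈ A, ∫ x, h x * g x ∂μ = 0) : h =ᵐ[μ] 0 := by
  have finite_density {u : E → ℝ} (hu : Integrable u μ) :
      IsFiniteMeasure (μ.withDensity fun x => ENNReal.ofReal (u x)) :=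
    isFiniteMeasure_withDensity hu.lintegral_lt_top.ne
  have integral_density {u : E → ℝ} (hu : Integrable u μ) (g : E →ᵇ ℝ) :
      ∫ x, g x ∂μ.withDensity (fun x => ENNReal.ofReal (u x)) = ∫ x, max (u x) 0 * g x ∂μ := by
    rw [integral_withDensity_eq_integral_toReal_smul₀ hu.aemeasurable.ennreal_ofReal
      (Eventually.of_forall fun x => ENNReal.ofReal_lt_top)]
    simp only [ENNReal.toReal_ofReal', smul_eq_mul]
  have integrable_mul {u : E → ℝ} (hu : Integrable u μ) (g : E →ᵇ ℝ) :
      Integrable (fun x => max (u x) 0 * g x) μ :=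
    hu.pos_part.mul_bdd g.continuous.aestronglyMeasurable (Eventually.of_forall g.norm_coe_le_norm)
  have neg_integrable : Integrable (fun x => -h x) μ := hh.neg
  have := finite_density hh
  have := finite_density neg_integrable
  have densities_eq : (μ.withDensity fun x => ENNReal.ofReal (h x)) =
      μ.withDensity fun x => ENNReal.ofReal (-h x) := by
    refine ext_of_forall_mem_subalgebra_integral_eq_of_polish hA fun g hg => ?_
    rw [integral_density hh, integral_density neg_integrable, ← sub_eq_zero,
      ← integral_sub (integrable_mul hh g) (integrable_mul neg_integrable g)]
    simpa only [← sub_mul, max_zero_sub_max_neg_zero_eq_self] using h0 g hg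
  filter_upwards [(withDensity_eq_iff hh.aemeasurable.ennreal_ofReal
    neg_integrable.aemeasurable.ennreal_ofReal hh.lintegral_lt_top.ne).1 densities_eq] with x hx
  have max_eq : max (h x) 0 = max (-h x) 0 := by
    simpa only [ENNReal.toReal_ofReal'] using congrArg ENNReal.toReal hx
  rw [Pi.zero_apply, ← max_zero_sub_max_neg_zero_eq_self (h x), max_eq, sub_self]

lemma ae_eq_zero_of_forall_integral_mul_prod_pow_eq_zero {ι : Type*} [Fintype ι] [PolishSpace E]
    {θ : ι → E →ᵇ ℝ} (hθ : ∀ x y, (∀ i, θ i x = θ i y) → x = y) (hh : Integrable h μ)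
    (h0 : ∀ n : ι → ℕ, ∫ x, h x * ∏ i, θ i x ^ n i ∂μ = 0) : h =ᵐ[μ] 0 := by
  have star_eq (g : E →ᵇ ℝ) : star g = g :=
    BoundedContinuousFunction.ext fun x => star_trivial (g x)
  let A : StarSubalgebra ℝ (E →ᵇ ℝ) :=
    { Algebra.adjoin ℝ (Set.range θ) with star_mem' := fun {g} hg => (star_eq g).symm ▸ hg }
  have separates : (A.map (toContinuousMapStarₐ ℝ)).SeparatesPoints := by
    intro x y hxy
    by_contra! same_values
    refine hxy (hθ x y fun i => same_values (θ i) ⟨(θ i).toContinuousMap, ⟨θ i, ?_, rfl⟩, rfl⟩)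
    exact Algebra.subset_adjoin ⟨i, rfl⟩
  refine ae_eq_zero_of_forall_mem_integral_mul_eq_zero separates hh fun g hg =>
    integral_mul_eq_zero_of_mem_adjoin hh (fun m hm => ?_) hg
  obtain ⟨n, rfl⟩ := Submonoid.exists_of_mem_closure_range θ m hm
  simpa only [coe_prod, Finset.prod_apply, coe_pow, Pi.pow_apply] using h0 n

end Moments

section Gaussian

/-- A bounded injective continuous function on the line that extends `exp (-x ^ 2)` from the
half-line `0 < x`. -/
def gaussExtension : BoundedContinuousFunction ℝ ℝ :=
  BoundedContinuousFunction.ofNormedAddCommGroup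
    (fun x => Real.exp (-(max x 0) ^ 2) + (1 - Real.exp (-(min x 0) ^ 2))) (by fun_prop) 2
    (fun x => by
      have exp_le_one (y : ℝ) : Real.exp (-y ^ 2) ≤ 1 := Real.exp_le_one_iff.2 (by nlinarith)
      rw [Real.norm_eq_abs, abs_le]
      constructor <;> linarith [exp_le_one (max x 0), exp_le_one (min x 0),
        Real.exp_pos (-(max x 0) ^ 2), Real.exp_pos (-(min x 0) ^ 2)])

lemma gaussExtension_of_pos {x : ℝ} (hx : 0 < x) : gaussExtension x = Real.exp (-x ^ 2) := by
  simp [gaussExtension, hx.le]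

lemma strictAnti_gaussExtension : StrictAnti gaussExtension := by
  intro x y hxy
  have positive_part : max x 0 ≤ max y 0 := max_le_max_right 0 hxy.le
  have negative_part : min x 0 ≤ min y 0 := min_le_min_right 0 hxy.le
  have part_lt : max x 0 < max y 0 ∨ min x 0 < min y 0 := by
    rcases le_or_gt 0 x with hx | hx
    · exact Or.inl (by rwa [max_eq_left hx, max_eq_left (hx.trans hxy.le)])
    · exact Or.inr (by rw [min_eq_left hx.le]; exact lt_min hxy hx)
  simp only [gaussExtension, BoundedContinuousFunction.coe_ofNormedAddCommGroup]
  have sq_max_le : max x 0 ^ 2 ≤ max y 0 ^ 2 := by gcongr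
  have sq_min_le : min y 0 ^ 2 ≤ min x 0 ^ 2 := by nlinarith [min_le_right y 0]
  rcases part_lt with hlt | hlt
  · refine add_lt_add_of_lt_of_le (Real.exp_lt_exp.2 (neg_lt_neg ?_))
      (sub_le_sub_left (Real.exp_le_exp.2 (neg_le_neg sq_min_le)) 1)
    gcongr
  · refine add_lt_add_of_le_of_lt (Real.exp_le_exp.2 (neg_le_neg sq_max_le))
      (sub_lt_sub_left (Real.exp_lt_exp.2 (neg_lt_neg ?_)) 1)
    nlinarith [min_le_right y 0]

variable {a r : ℝ}

lemma laguerreReduced_zero_left (a X : ℝ) : laguerreReduced a 0 X = 1 / Real.Gamma (a + 1) := by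
  simp [laguerreReduced]

lemma laguerreReduced_zero_right (a : ℝ) (n : ℕ) :
    laguerreReduced a n 0 = 1 / Real.Gamma (a + 1) := by
  rw [laguerreReduced, Finset.sum_eq_single 0 (fun j _ hj => by simp [hj]) (by simp)]
  simp

lemma laguerreHermite1_zero_pos (ha : -1 < a) {u : ℝ} (hu : 0 < u) :
    0 < laguerreHermite1 0 a u := by
  have := laguerreWeight_pos ha 0
  have : 0 < Real.Gamma (a + 1) := Real.Gamma_pos_of_pos (by linarith)
  rw [laguerreHermite1_eq, laguerreReduced_zero_left]
  positivity

lemma summable_sqrt_laguerreWeight_mul_pow (ha : -1 < a) (hr0 : 0 ≤ r) (hr1 : r < 1) :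
    Summable fun n : ℕ => √(laguerreWeight a n) * r ^ n := by
  have hΓ : 0 < Real.Gamma (a + 1) := Real.Gamma_pos_of_pos (by linarith)
  have at_zero := summable_sqrt_laguerreWeight_mul_abs_laguerreReduced ha hr0 hr1 0
  simp only [laguerreReduced_zero_right, abs_of_pos (one_div_pos.2 hΓ)] at at_zero
  refine (at_zero.mul_left (Real.Gamma (a + 1))).congr fun n => ?_
  field_simp

lemma hasSum_laguerreHermite1_generating (ha : -1 < a) (hr : |r| < 1) (u : ℝ) :
    HasSum (fun n : ℕ => √(laguerreWeight a n) * r ^ n * laguerreHermite1 n a u)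
      (√2 * (1 - r) ^ (-(a + 1)) * Real.exp (-u ^ 2 * r / (1 - r)) * u ^ (a + 1 / 2) *
        Real.exp (-u ^ 2 / 2)) := by
  rw [show √2 * (1 - r) ^ (-(a + 1)) * Real.exp (-u ^ 2 * r / (1 - r)) * u ^ (a + 1 / 2) *
      Real.exp (-u ^ 2 / 2) = √2 * u ^ (a + 1 / 2) * Real.exp (-u ^ 2 / 2) *
      ((1 - r) ^ (-(a + 1)) * Real.exp (-u ^ 2 * r / (1 - r))) by ring]
  refine ((hasSum_laguerre_generating ha hr (u ^ 2)).mul_left _).congr_fun fun n => ?_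
  rw [laguerreHermite1_eq]
  linear_combination √2 * u ^ (a + 1 / 2) * Real.exp (-u ^ 2 / 2) *
    laguerreReduced a n (u ^ 2) * r ^ n * Real.mul_self_sqrt (laguerreWeight_pos ha n).le

/-- The generating function at `r = n / (n + 1)`, where `r / (1 - r) = n`. -/
lemma exists_hasSum_exp_mul_laguerreHermite1_zero (ha : -1 < a) (n : ℕ) :
    ∃ A : ℕ → ℝ, Summable (fun k => ‖A k‖) ∧ ∀ u, HasSum (fun k => A k * laguerreHermite1 k a u)
      (laguerreHermite1 0 a u * Real.exp (-u ^ 2) ^ n) := by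
  obtain ⟨r, hr⟩ : ∃ r : ℝ, r = n / (n + 1) := ⟨_, rfl⟩
  have hr0 : 0 ≤ r := hr ▸ by positivity
  have one_sub : 1 - r = 1 / (n + 1) := by rw [hr]; field_simp; ring
  have one_sub_pos : 0 < 1 - r := one_sub ▸ by positivity
  have hr1 : r < 1 := by linarith
  let K : ℝ := √(laguerreWeight a 0) * (1 / Real.Gamma (a + 1)) / (1 - r) ^ (-(a + 1))
  refine ⟨fun k => K * (√(laguerreWeight a k) * r ^ k),
    ((summable_sqrt_laguerreWeight_mul_pow ha hr0 hr1).mul_left K).norm, fun u => ?_⟩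
  have value_eq : laguerreHermite1 0 a u * Real.exp (-u ^ 2) ^ n =
      K * (√2 * (1 - r) ^ (-(a + 1)) * Real.exp (-u ^ 2 * r / (1 - r)) * u ^ (a + 1 / 2) *
        Real.exp (-u ^ 2 / 2)) := by
    have rpow_ne_zero : (1 - r) ^ (-(a + 1)) ≠ 0 := (Real.rpow_pos_of_pos one_sub_pos _).ne'
    have exponent_eq : -u ^ 2 * r / (1 - r) = n * -u ^ 2 := by
      rw [one_sub, hr]
      field_simp
    rw [laguerreHermite1_eq, laguerreReduced_zero_left, exponent_eq, Real.exp_nat_mul]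
    simp only [K]
    field_simp
  rw [value_eq]
  exact ((hasSum_laguerreHermite1_generating ha (by rwa [abs_of_nonneg hr0]) u).mul_left
    K).congr_fun fun k => by ring

end Gaussian

section Completeness

variable {d : ℕ} {α : Fin d → ℝ}

lemma exists_hasSum_exp_mul_laguerreHermite_zero (hα : ∀ i, -1 < α i) (n : Fin d → ℕ) :
    ∃ A : (Fin d → ℕ) → ℝ, (Summable fun k => |A k|) ∧ ∀ x,
      HasSum (fun k => A k * laguerreHermite α k x)
        (laguerreHermite α 0 x * ∏ i, Real.exp (-x i ^ 2) ^ n i) := by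
  choose A hA expansion using fun i => exists_hasSum_exp_mul_laguerreHermite1_zero (hα i) (n i)
  refine ⟨fun k => ∏ i, A i (k i), (summable_norm_prod_pi hA).congr fun k => Real.norm_eq_abs _,
    fun x => ?_⟩
  have product_expansion :=
    hasSum_prod_pi (fun i => (expansion i (x i)).summable.norm) fun i => expansion i (x i)
  rw [Finset.prod_mul_distrib] at product_expansion
  exact product_expansion.congr_fun fun k => Finset.prod_mul_distrib.symm

lemma integral_laguerreHermite_zero_mul_exp_eq_zero (hα : ∀ i, -1 < α i) {f : (Fin d → ℝ) → ℝ}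
    (hf : MemLp f 2 (orthantMeasure d)) (h0 : ∀ k, laguerreCoeff α f k = 0) (n : Fin d → ℕ) :
    ∫ x, (laguerreHermite α 0 x * ∏ i, Real.exp (-x i ^ 2) ^ n i) • f x ∂orthantMeasure d = 0 := by
  obtain ⟨A, hA, expansion⟩ := exists_hasSum_exp_mul_laguerreHermite_zero hα n
  have coefficient_sum := hasSum_smul_laguerreCoeff hα hA (fun y _ => expansion y) hf
  simp only [h0, smul_zero] at coefficient_sum
  exact coefficient_sum.unique hasSum_zero

lemma ae_eq_zero_of_laguerreCoeff_eq_zero_real (hα : ∀ i, -1 < α i) {f : (Fin d → ℝ) → ℝ}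
    (hf : MemLp f 2 (orthantMeasure d)) (h0 : ∀ k, laguerreCoeff α f k = 0) :
    f =ᵐ[orthantMeasure d] 0 := by
  let θ (i : Fin d) : BoundedContinuousFunction (Fin d → ℝ) ℝ :=
    gaussExtension.compContinuous ⟨fun x => x i, continuous_apply i⟩
  have moments (n : Fin d → ℕ) : ∫ x, laguerreHermite α 0 x • f x * ∏ i, θ i x ^ n i
      ∂orthantMeasure d = 0 := by
    rw [← integral_laguerreHermite_zero_mul_exp_eq_zero hα hf h0 n]
    refine integral_congr_ae ((ae_mem_orthant d).mono fun x hx => ?_)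
    have θ_eq (i : Fin d) : θ i x = Real.exp (-x i ^ 2) := gaussExtension_of_pos (hx i)
    simp only [θ_eq, smul_eq_mul, mul_right_comm]
  filter_upwards [ae_eq_zero_of_forall_integral_mul_prod_pow_eq_zero
    (fun x y hxy => funext fun i => strictAnti_gaussExtension.injective (hxy i))
    (integrable_laguerreHermite_smul hα 0 hf) moments, ae_mem_orthant d] with x hx hx_mem
  exact (smul_eq_zero.1 hx).resolve_left
    (Finset.prod_pos fun i _ => laguerreHermite1_zero_pos (hα i) (hx_mem i)).ne'

variable {𝕜 : Type*} [RCLike 𝕜] {f g : (Fin d → ℝ) → 𝕜}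

lemma laguerreCoeff_re (hα : ∀ i, -1 < α i) (hf : MemLp f 2 (orthantMeasure d)) (k : Fin d → ℕ) :
    laguerreCoeff α (fun x => RCLike.re (f x)) k = RCLike.re (laguerreCoeff α f k) := by
  rw [laguerreCoeff, laguerreCoeff, ← integral_re (integrable_laguerreHermite_smul hα k hf)]
  simp only [RCLike.smul_re, smul_eq_mul]

lemma laguerreCoeff_im (hα : ∀ i, -1 < α i) (hf : MemLp f 2 (orthantMeasure d)) (k : Fin d → ℕ) :
    laguerreCoeff α (fun x => RCLike.im (f x)) k = RCLike.im (laguerreCoeff α f k) := by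
  rw [laguerreCoeff, laguerreCoeff, ← integral_im (integrable_laguerreHermite_smul hα k hf)]
  simp only [RCLike.smul_im, smul_eq_mul]

lemma ae_eq_zero_of_laguerreCoeff_eq_zero (hα : ∀ i, -1 < α i)
    (hf : MemLp f 2 (orthantMeasure d)) (h0 : ∀ k, laguerreCoeff α f k = 0) :
    f =ᵐ[orthantMeasure d] 0 := by
  filter_upwards
    [ae_eq_zero_of_laguerreCoeff_eq_zero_real hα hf.re fun k => by
      rw [laguerreCoeff_re hα hf, h0, map_zero],
    ae_eq_zero_of_laguerreCoeff_eq_zero_real hα hf.im fun k => by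
      rw [laguerreCoeff_im hα hf, h0, map_zero]] with x re_eq im_eq
  exact RCLike.ext (re_eq.trans RCLike.zero_re.symm) (im_eq.trans RCLike.zero_im.symm)

/-- The Laguerre functions as elements of `L²`. -/
def laguerreLp (𝕜 : Type*) [RCLike 𝕜] (hα : ∀ i, -1 < α i) (k : Fin d → ℕ) :
    Lp 𝕜 2 (orthantMeasure d) :=
  (memLp_laguerreHermite hα k).ofReal.toLp fun x => ((laguerreHermite α k x : ℝ) : 𝕜)

lemma coeFn_laguerreLp (hα : ∀ i, -1 < α i) (k : Fin d → ℕ) :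
    laguerreLp 𝕜 hα k =ᵐ[orthantMeasure d] fun x => ((laguerreHermite α k x : ℝ) : 𝕜) :=
  MemLp.coeFn_toLp _

lemma inner_laguerreLp (hα : ∀ i, -1 < α i) (k : Fin d → ℕ) (f : Lp 𝕜 2 (orthantMeasure d)) :
    inner 𝕜 (laguerreLp 𝕜 hα k) f = laguerreCoeff α f k := by
  rw [L2.inner_def, laguerreCoeff]
  refine integral_congr_ae ((coeFn_laguerreLp (𝕜 := 𝕜) hα k).mono fun x hx => ?_)
  simp only [hx, RCLike.inner_apply, RCLike.conj_ofReal, RCLike.real_smul_eq_coe_mul, mul_comm]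

lemma laguerreCoeff_congr (h : f =ᵐ[orthantMeasure d] g) (k : Fin d → ℕ) :
    laguerreCoeff α f k = laguerreCoeff α g k :=
  integral_congr_ae (h.mono fun x hx => by simp only [hx])

lemma orthonormal_laguerreLp (hα : ∀ i, -1 < α i) : Orthonormal 𝕜 (laguerreLp 𝕜 hα) := by
  classical
  rw [orthonormal_iff_ite]
  intro k l
  rw [inner_laguerreLp, laguerreCoeff_congr (coeFn_laguerreLp (𝕜 := 𝕜) hα l),
    laguerreCoeff_laguerreHermite hα]

lemma orthogonal_span_laguerreLp (hα : ∀ i, -1 < α i) :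
    (Submodule.span 𝕜 (Set.range (laguerreLp 𝕜 hα)))ᗮ = ⊥ := by
  rw [Submodule.eq_bot_iff]
  intro f hf
  rw [Lp.eq_zero_iff_ae_eq_zero]
  refine ae_eq_zero_of_laguerreCoeff_eq_zero hα (Lp.memLp f) fun k => ?_
  rw [← inner_laguerreLp hα]
  exact (Submodule.mem_orthogonal _ _).1 hf _ (Submodule.subset_span ⟨k, rfl⟩)

/-- The Laguerre functions as a Hilbert basis of `L²`. -/
def laguerreBasis (𝕜 : Type*) [RCLike 𝕜] (hα : ∀ i, -1 < α i) :
    HilbertBasis (Fin d → ℕ) 𝕜 (Lp 𝕜 2 (orthantMeasure d)) :=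
  HilbertBasis.mkOfOrthogonalEqBot (orthonormal_laguerreLp hα) (orthogonal_span_laguerreLp hα)

lemma laguerreBasis_apply (hα : ∀ i, -1 < α i) (k : Fin d → ℕ) :
    laguerreBasis 𝕜 hα k = laguerreLp 𝕜 hα k := by
  rw [laguerreBasis, HilbertBasis.coe_mkOfOrthogonalEqBot]

lemma laguerreBasis_repr_toLp (hα : ∀ i, -1 < α i) (hf : MemLp f 2 (orthantMeasure d))
    (k : Fin d → ℕ) : (laguerreBasis 𝕜 hα).repr (hf.toLp f) k = laguerreCoeff α f k := by
  rw [HilbertBasis.repr_apply_apply, laguerreBasis_apply, inner_laguerreLp,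
    laguerreCoeff_congr hf.coeFn_toLp]

lemma coeFn_sum_laguerreLp (hα : ∀ i, -1 < α i) (c : (Fin d → ℕ) → 𝕜)
    (s : Finset (Fin d → ℕ)) : ⇑(∑ k ∈ s, c k • laguerreLp 𝕜 hα k) =ᵐ[orthantMeasure d]
      fun x => ∑ k ∈ s, laguerreHermite α k x • c k := by
  have terms : ∀ᵐ x ∂orthantMeasure d, ∀ k ∈ s,
      (c k • laguerreLp 𝕜 hα k) x = laguerreHermite α k x • c k := by
    refine (eventually_all_finset s).2 fun k _ => ?_
    filter_upwards [Lp.coeFn_smul (c k) (laguerreLp 𝕜 hα k),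
      coeFn_laguerreLp (𝕜 := 𝕜) hα k] with x h1 h2
    rw [h1, Pi.smul_apply, h2, smul_eq_mul, RCLike.real_smul_eq_coe_mul, mul_comm]
  filter_upwards [Lp.coeFn_finsetSum s fun k => c k • laguerreLp 𝕜 hα k, terms] with x h1 h2
  rw [h1, Finset.sum_apply, Finset.sum_congr rfl h2]

lemma tendsto_eLpNorm_sub_laguerre_sum (hα : ∀ i, -1 < α i) (hf : MemLp f 2 (orthantMeasure d)) :
    Tendsto (fun s : Finset (Fin d → ℕ) => eLpNorm (fun x => f x - ∑ k ∈ s,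
      laguerreHermite α k x • laguerreCoeff α f k) 2 (orthantMeasure d)) atTop (𝓝 0) := by
  have expansion := (laguerreBasis 𝕜 hα).hasSum_repr (hf.toLp f)
  simp only [laguerreBasis_apply, laguerreBasis_repr_toLp] at expansion
  rw [HasSum, SummationFilter.unconditional_filter, tendsto_iff_edist_tendsto_0] at expansion
  refine expansion.congr fun s => ?_
  rw [edist_comm, Lp.edist_def]
  refine eLpNorm_congr_ae ?_
  filter_upwards [coeFn_sum_laguerreLp hα (laguerreCoeff α f) s, hf.coeFn_toLp] with x h1 h2
  rw [Pi.sub_apply, h1, h2]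

end Completeness

/-! ### Mass of the kernel -/

section KernelMass

variable {a b c t W : ℝ}

lemma cosh_rpow_nonneg (t s : ℝ) : 0 ≤ Real.cosh (2 * t) ^ s :=
  Real.rpow_nonneg (Real.cosh_pos _).le _

lemma lintegral_laguerreKernel1_le (ha : -1 < a) (ht : 0 < t) (hc : 0 ≤ c)
    (mass_le : ∀ w, 0 < w → laguerreMass (a / 2 + 1 / 4) w ≤ ENNReal.ofReal c) {u : ℝ}
    (hu : 0 < u) : ∫⁻ v in Set.Ioi (0 : ℝ), ENNReal.ofReal (laguerreKernel1 a t u v) ≤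
      ENNReal.ofReal (c * Real.cosh (2 * t) ^ (-1 / 2 : ℝ)) := by
  have : 0 < Real.sinh (2 * t) := Real.sinh_pos_iff.2 (by linarith)
  have : 0 < Real.cosh (2 * t) := Real.cosh_pos _
  rw [lintegral_laguerreKernel1 ha ht hu, mul_comm c,
    ENNReal.ofReal_mul' (p := Real.cosh (2 * t) ^ (-1 / 2 : ℝ)) hc]
  refine mul_le_mul' (ENNReal.ofReal_le_ofReal ?_) (mass_le _ (by positivity))
  refine mul_le_of_le_one_right (cosh_rpow_nonneg t _) (Real.exp_le_one_iff.2 ?_)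
  rw [neg_mul]
  exact neg_nonpos.2 (by positivity)

/-- The points `u` at which the mass of the one-dimensional kernel at time `t` is governed by the
values of `laguerreMass` on `(W, W + 1)`. -/
def laguerreWindow (W t : ℝ) : Set ℝ :=
  {u | 0 < u ∧ u ^ 2 / (2 * Real.sinh (2 * t) * Real.cosh (2 * t)) ∈ Set.Ioo W (W + 1)}

lemma isOpen_laguerreWindow (W t : ℝ) : IsOpen (laguerreWindow W t) :=
  isOpen_Ioi.inter (isOpen_Ioo.preimage (by fun_prop))

lemma laguerreWindow_nonempty (hW : 0 < W) (ht : 0 < t) : (laguerreWindow W t).Nonempty := by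
  have : 0 < Real.sinh (2 * t) := Real.sinh_pos_iff.2 (by linarith)
  have : 0 < Real.cosh (2 * t) := Real.cosh_pos _
  have scale_pos : 0 < 2 * Real.sinh (2 * t) * Real.cosh (2 * t) := by positivity
  refine ⟨√((W + 1 / 2) * (2 * Real.sinh (2 * t) * Real.cosh (2 * t))), by positivity, ?_⟩
  rw [Real.sq_sqrt (by positivity), mul_div_cancel_right₀ _ scale_pos.ne']
  exact ⟨by linarith, by linarith⟩

lemma tendsto_cosh_rpow_mul_exp_neg_sinh_sq (w : ℝ) :
    Tendsto (fun t => Real.cosh (2 * t) ^ (-1 / 2 : ℝ) * Real.exp (-(Real.sinh (2 * t)) ^ 2 * w))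
      (𝓝[>] 0) (𝓝 1) := by
  have continuous_cosh_rpow : Continuous fun t : ℝ => Real.cosh (2 * t) ^ (-1 / 2 : ℝ) :=
    (Real.continuous_cosh.comp (continuous_const_mul 2)).rpow_const
      fun t => Or.inl (Real.cosh_pos _).ne'
  have continuous_factor : Continuous fun t : ℝ =>
      Real.cosh (2 * t) ^ (-1 / 2 : ℝ) * Real.exp (-(Real.sinh (2 * t)) ^ 2 * w) :=
    continuous_cosh_rpow.mul (by fun_prop)
  exact (continuous_factor.tendsto' 0 1 (by simp)).mono_left nhdsWithin_le_nhds

lemma eventually_le_lintegral_laguerreKernel1 (ha : -1 < a) (hc : 0 < c) (hbc : b < c)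
    (mass_ge : ∀ w ∈ Set.Icc W (W + 1), ENNReal.ofReal c ≤ laguerreMass (a / 2 + 1 / 4) w) :
    ∀ᶠ t in 𝓝[>] 0, ∀ u ∈ laguerreWindow W t, ENNReal.ofReal b ≤
      ∫⁻ v in Set.Ioi (0 : ℝ), ENNReal.ofReal (laguerreKernel1 a t u v) := by
  have factor_gt := (tendsto_cosh_rpow_mul_exp_neg_sinh_sq (W + 1)).eventually
    (lt_mem_nhds ((div_lt_one hc).2 hbc))
  filter_upwards [factor_gt, self_mem_nhdsWithin] with t factor_gt ht u hu
  rw [lintegral_laguerreKernel1 ha ht hu.1]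
  calc ENNReal.ofReal b
      ≤ ENNReal.ofReal (Real.cosh (2 * t) ^ (-1 / 2 : ℝ) *
          Real.exp (-(Real.sinh (2 * t)) ^ 2 * (W + 1)) * c) :=
        ENNReal.ofReal_le_ofReal ((div_le_iff₀ hc).1 factor_gt.le)
    _ = ENNReal.ofReal (Real.cosh (2 * t) ^ (-1 / 2 : ℝ) *
          Real.exp (-(Real.sinh (2 * t)) ^ 2 * (W + 1))) * ENNReal.ofReal c :=
        ENNReal.ofReal_mul' hc.le
    _ ≤ _ := by
        refine mul_le_mul' (ENNReal.ofReal_le_ofReal ?_) (mass_ge _ (Set.Ioo_subset_Icc_self hu.2))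
        refine mul_le_mul_of_nonneg_left (Real.exp_le_exp.2 ?_) (cosh_rpow_nonneg t _)
        rw [neg_mul, neg_mul]
        exact neg_le_neg (mul_le_mul_of_nonneg_left hu.2.2.le (sq_nonneg _))

lemma exists_eventually_le_lintegral_laguerreKernel1 (ha : -1 / 2 ≤ a) (hb : b < 1) :
    ∃ W, 0 < W ∧ ∀ᶠ t in 𝓝[>] 0, ∀ u ∈ laguerreWindow W t, ENNReal.ofReal b ≤
      ∫⁻ v in Set.Ioi (0 : ℝ), ENNReal.ofReal (laguerreKernel1 a t u v) := by
  obtain ⟨c, hbc, hc⟩ := exists_between (max_lt hb zero_lt_one)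
  obtain ⟨W, hW, mass_ge⟩ := exists_laguerreMass_ge (δ := a / 2 + 1 / 4) (ε := 1 - c)
    (by linarith) (by linarith)
  rw [sub_sub_cancel] at mass_ge
  exact ⟨W, hW, eventually_le_lintegral_laguerreKernel1 (by linarith)
    ((le_max_right _ _).trans_lt hbc) ((le_max_left _ _).trans_lt hbc) mass_ge⟩

lemma exists_one_lt_eventually_le_lintegral_laguerreKernel1 (ha : -1 / 2 < a) (ha' : a < 1 / 2) :
    ∃ b, 1 < b ∧ ∃ W, 0 < W ∧ ∀ᶠ t in 𝓝[>] 0, ∀ u ∈ laguerreWindow W t, ENNReal.ofReal b ≤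
      ∫⁻ v in Set.Ioi (0 : ℝ), ENNReal.ofReal (laguerreKernel1 a t u v) := by
  obtain ⟨W, hW, η, hη, mass_ge⟩ := exists_one_lt_laguerreMass (δ := a / 2 + 1 / 4)
    (by linarith) (by linarith)
  exact ⟨1 + η / 2, by linarith, W, hW, eventually_le_lintegral_laguerreKernel1 (by linarith)
    (by linarith) (by linarith) mass_ge⟩

lemma exists_one_lt_mul_pow (hb : 1 < b) (n : ℕ) : ∃ r < 1, 0 < r ∧ 1 < b * r ^ n := by
  have limit : Tendsto (fun r : ℝ => b * r ^ n) (𝓝[<] 1) (𝓝 b) :=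
    (Continuous.tendsto' (by fun_prop) 1 b (by simp)).mono_left nhdsWithin_le_nhds
  have near_one : ∀ᶠ r : ℝ in 𝓝[<] 1, r ∈ Set.Ioo 0 1 := Ioo_mem_nhdsLT zero_lt_one
  obtain ⟨r, hr, one_lt⟩ := (near_one.and (limit.eventually (lt_mem_nhds hb))).exists
  exact ⟨r, hr.2, hr.1, one_lt⟩

variable {d : ℕ} {α : Fin d → ℝ} {x : Fin d → ℝ}

lemma lintegral_laguerreKernel_le (hα : ∀ i, -1 / 2 ≤ α i) {c : Fin d → ℝ} (hc : ∀ i, 0 ≤ c i)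
    (mass_le : ∀ i w, 0 < w → laguerreMass (α i / 2 + 1 / 4) w ≤ ENNReal.ofReal (c i))
    (ht : 0 < t) (hx : x ∈ orthant d) :
    ∫⁻ y, ENNReal.ofReal (laguerreKernel α t x y) ∂orthantMeasure d ≤
      ENNReal.ofReal ((∏ i, c i) * Real.cosh (2 * t) ^ (-(d : ℝ) / 2)) := by
  have prod_eq : (∏ i, c i) * Real.cosh (2 * t) ^ (-(d : ℝ) / 2) =
      ∏ i, c i * Real.cosh (2 * t) ^ (-1 / 2 : ℝ) := by
    rw [Finset.prod_mul_distrib, Finset.prod_const, Finset.card_univ, Fintype.card_fin,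
      ← Real.rpow_mul_natCast (Real.cosh_pos _).le]
    congr 2
    ring
  rw [lintegral_laguerreKernel hα ht hx, prod_eq,
    ENNReal.ofReal_prod_of_nonneg fun i _ => mul_nonneg (hc i) (cosh_rpow_nonneg t _)]
  exact Finset.prod_le_prod' fun i _ =>
    lintegral_laguerreKernel1_le (neg_one_lt_of_neg_half_le hα i) ht (hc i) (mass_le i) (hx i)

lemma exists_lintegral_laguerreKernel_le (hα : ∀ i, -1 / 2 ≤ α i) :
    ∃ c : ℝ, 1 < c ∧ ∀ t, 0 < t → ∀ x ∈ orthant d,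
      ∫⁻ y, ENNReal.ofReal (laguerreKernel α t x y) ∂orthantMeasure d ≤
        ENNReal.ofReal (c * Real.cosh (2 * t) ^ (-(d : ℝ) / 2)) := by
  choose c one_le mass_le using fun i => exists_laguerreMass_le (δ := α i / 2 + 1 / 4)
    (by linarith [hα i])
  have c_nonneg (i : Fin d) : 0 ≤ c i := zero_le_one.trans (one_le i)
  refine ⟨(∏ i, c i) + 1, lt_add_of_pos_left 1 (Finset.prod_pos fun i _ =>
    zero_lt_one.trans_le (one_le i)), fun t ht x hx =>
    (lintegral_laguerreKernel_le hα c_nonneg mass_le ht hx).trans (ENNReal.ofReal_le_ofReal ?_)⟩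
  exact mul_le_mul_of_nonneg_right (lt_add_one _).le (cosh_rpow_nonneg t _)

lemma neg_half_le_of_contractive (hα : ∀ i, α i = -1 / 2 ∨ 1 / 2 ≤ α i) (i : Fin d) :
    -1 / 2 ≤ α i := by
  rcases hα i with h | h <;> linarith

lemma lintegral_laguerreKernel_le_of_contractive (hα : ∀ i, α i = -1 / 2 ∨ 1 / 2 ≤ α i)
    (ht : 0 < t) (hx : x ∈ orthant d) :
    ∫⁻ y, ENNReal.ofReal (laguerreKernel α t x y) ∂orthantMeasure d ≤
      ENNReal.ofReal (Real.cosh (2 * t) ^ (-(d : ℝ) / 2)) := by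
  have mass_le (i : Fin d) (w : ℝ) (hw : 0 < w) :
      laguerreMass (α i / 2 + 1 / 4) w ≤ ENNReal.ofReal 1 := by
    rw [ENNReal.ofReal_one]
    refine laguerreMass_le_one ((hα i).imp (fun h => ?_) fun h => ?_) hw <;> linarith
  simpa only [Finset.prod_const_one, one_mul] using lintegral_laguerreKernel_le
    (neg_half_le_of_contractive hα) (fun _ => zero_le_one) mass_le ht hx

/-- One coordinate has mass bounded below by some `b > 1`, and the mass of each of the others can
be brought arbitrarily close to one. -/
lemma exists_one_lt_lintegral_laguerreKernel (hα : ∀ i, -1 / 2 ≤ α i)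
    (hα' : ∃ i, -1 / 2 < α i ∧ α i < 1 / 2) :
    ∃ t : ℝ, 0 < t ∧ ∃ U ⊆ orthant d, IsOpen U ∧ U.Nonempty ∧
      ∀ x ∈ U, 1 < ∫⁻ y, ENNReal.ofReal (laguerreKernel α t x y) ∂orthantMeasure d := by
  obtain ⟨i₀, lower, upper⟩ := hα'
  obtain ⟨b, hb, W₀, hW₀, mass_ge₀⟩ :=
    exists_one_lt_eventually_le_lintegral_laguerreKernel1 lower upper
  obtain ⟨r, hr, r_pos, one_lt⟩ := exists_one_lt_mul_pow hb (Finset.univ \ {i₀}).card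
  let B : Fin d → ℝ := Function.update (fun _ => r) i₀ b
  have mass_ge (i : Fin d) : ∃ W, 0 < W ∧ ∀ᶠ t in 𝓝[>] 0, ∀ u ∈ laguerreWindow W t,
      ENNReal.ofReal (B i) ≤
        ∫⁻ v in Set.Ioi (0 : ℝ), ENNReal.ofReal (laguerreKernel1 (α i) t u v) := by
    rcases eq_or_ne i i₀ with rfl | hi
    · exact ⟨W₀, hW₀, by simpa only [B, Function.update_self] using mass_ge₀⟩
    · simpa only [B, Function.update_of_ne hi] using
        exists_eventually_le_lintegral_laguerreKernel1 (hα i) hr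
  choose W hW mass_ge using mass_ge
  have eventually_pos : ∀ᶠ t : ℝ in 𝓝[>] 0, 0 < t := self_mem_nhdsWithin
  obtain ⟨t, ht, mass_ge⟩ := (eventually_pos.and (eventually_all.2 mass_ge)).exists
  have window_mem {x : Fin d → ℝ} (hx : x ∈ Set.univ.pi fun i => laguerreWindow (W i) t)
      (i : Fin d) : x i ∈ laguerreWindow (W i) t := hx i (Set.mem_univ i)
  refine ⟨t, ht, _, fun x hx i => (window_mem hx i).1,
    isOpen_set_pi Set.finite_univ fun i _ => isOpen_laguerreWindow (W i) t,
    Set.univ_pi_nonempty_iff.2 fun i => laguerreWindow_nonempty (hW i) ht, fun x hx => ?_⟩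
  rw [lintegral_laguerreKernel hα ht fun i => (window_mem hx i).1]
  calc (1 : ℝ≥0∞) < ENNReal.ofReal (∏ i, B i) := by
        rwa [ENNReal.one_lt_ofReal, Finset.prod_update_of_mem (Finset.mem_univ i₀),
          Finset.prod_const]
    _ = ∏ i, ENNReal.ofReal (B i) := ENNReal.ofReal_prod_of_nonneg fun i _ => by
        rcases eq_or_ne i i₀ with rfl | hi
        · simpa only [B, Function.update_self] using zero_le_one.trans hb.le
        · simpa only [B, Function.update_of_ne hi] using r_pos.le
    _ ≤ _ := Finset.prod_le_prod' fun i _ => mass_ge i (x i) (window_mem hx i)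

end KernelMass

/-! ### The semigroup -/

section LaguerreSemigroup

variable {𝕜 : Type*} [RCLike 𝕜] {d : ℕ} {α : Fin d → ℝ} {t : ℝ≥0} {f g : (Fin d → ℝ) → 𝕜}
  {x : Fin d → ℝ} {p : ℝ≥0∞} {C : ℝ}

lemma laguerreSemigroup_zero (α : Fin d → ℝ) (f : (Fin d → ℝ) → 𝕜) :
    laguerreSemigroup α 0 f = f :=
  funext fun _ => if_pos rfl

lemma laguerreSemigroup_eq_kernelOp (hα : ∀ i, -1 < α i) (ht : 0 < t) (f : (Fin d → ℝ) → 𝕜)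
    (hx : x ∈ orthant d) :
    laguerreSemigroup α t f x = kernelOp (orthantMeasure d) (laguerreKernel α t) f x := by
  rw [laguerreSemigroup, if_neg ht.ne', kernelOp]
  refine integral_congr_ae ((ae_mem_orthant d).mono fun y hy => ?_)
  simp only [laguerreHeatKernel_eq hα (NNReal.coe_pos.2 ht) hx hy]

lemma laguerreSemigroup_ae_eq (hα : ∀ i, -1 < α i) (ht : 0 < t) (f : (Fin d → ℝ) → 𝕜) :
    laguerreSemigroup α t f =ᵐ[orthantMeasure d]
      kernelOp (orthantMeasure d) (laguerreKernel α t) f :=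
  (ae_mem_orthant d).mono fun _ hx => laguerreSemigroup_eq_kernelOp hα ht f hx

lemma integrable_laguerreHeatKernel_smul (hα : ∀ i, -1 / 2 ≤ α i) {t : ℝ} (ht : 0 < t)
    (hf : MemL1AddLinfty (orthantMeasure d) f) (hx : x ∈ orthant d) :
    Integrable (fun y => laguerreHeatKernel α t x y • f y) (orthantMeasure d) := by
  refine (integrable_laguerreKernel_smul hα ht hf hx).congr
    ((ae_mem_orthant d).mono fun y hy => ?_)
  simp only [laguerreHeatKernel_eq (neg_one_lt_of_neg_half_le hα) ht hx hy]

lemma laguerreSemigroup_congr (α : Fin d → ℝ) (t : ℝ≥0) (h : f =ᵐ[orthantMeasure d] g) :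
    laguerreSemigroup α t f =ᵐ[orthantMeasure d] laguerreSemigroup α t g := by
  rcases eq_or_ne t 0 with rfl | ht
  · rwa [laguerreSemigroup_zero, laguerreSemigroup_zero]
  · refine Eventually.of_forall fun x => ?_
    rw [laguerreSemigroup, laguerreSemigroup, if_neg ht, if_neg ht]
    exact integral_congr_ae (h.mono fun y hy => by simp only [hy])

lemma laguerreSemigroup_const_smul (α : Fin d → ℝ) (t : ℝ≥0) (c : 𝕜) (f : (Fin d → ℝ) → 𝕜) :
    laguerreSemigroup α t (c • f) = c • laguerreSemigroup α t f := by
  funext x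
  rw [Pi.smul_apply, laguerreSemigroup, laguerreSemigroup, smul_ite, ← integral_smul]
  simp only [Pi.smul_apply, smul_comm c]

lemma laguerreSemigroup_add (hα : ∀ i, -1 / 2 ≤ α i) (t : ℝ≥0)
    (hf : MemL1AddLinfty (orthantMeasure d) f) (hg : MemL1AddLinfty (orthantMeasure d) g)
    (hx : x ∈ orthant d) :
    laguerreSemigroup α t (f + g) x = laguerreSemigroup α t f x + laguerreSemigroup α t g x := by
  rcases eq_zero_or_pos t with rfl | ht
  · simp only [laguerreSemigroup_zero, Pi.add_apply]
  · simp only [laguerreSemigroup, if_neg ht.ne', Pi.add_apply, smul_add]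
    exact integral_add (integrable_laguerreHeatKernel_smul hα (NNReal.coe_pos.2 ht) hf hx)
      (integrable_laguerreHeatKernel_smul hα (NNReal.coe_pos.2 ht) hg hx)

lemma aestronglyMeasurable_laguerreSemigroup (hα : ∀ i, -1 < α i) (t : ℝ≥0)
    (hf : AEStronglyMeasurable f (orthantMeasure d)) :
    AEStronglyMeasurable (laguerreSemigroup α t f) (orthantMeasure d) := by
  rcases eq_zero_or_pos t with rfl | ht
  · rwa [laguerreSemigroup_zero]
  · exact (aestronglyMeasurable_kernelOp (measurable_laguerreKernel α t) hf).congr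
      (laguerreSemigroup_ae_eq hα ht f).symm

lemma laguerreSemigroup_add_time (hα : ∀ i, -1 / 2 ≤ α i) (s t : ℝ≥0)
    (hf : MemL1AddLinfty (orthantMeasure d) f) :
    laguerreSemigroup α (s + t) f =ᵐ[orthantMeasure d]
      laguerreSemigroup α s (laguerreSemigroup α t f) := by
  rcases eq_zero_or_pos s with rfl | hs
  · rw [zero_add, laguerreSemigroup_zero]
  rcases eq_zero_or_pos t with rfl | ht
  · rw [add_zero, laguerreSemigroup_zero]
  have hα' := neg_one_lt_of_neg_half_le hα
  have hs' : (0 : ℝ) < s := NNReal.coe_pos.2 hs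
  have ht' : (0 : ℝ) < t := NNReal.coe_pos.2 ht
  filter_upwards [ae_mem_orthant d] with x hx
  rw [laguerreSemigroup_eq_kernelOp hα' (add_pos hs ht) f hx,
    laguerreSemigroup_eq_kernelOp hα' hs _ hx, kernelOp_congr _ (laguerreSemigroup_ae_eq hα' ht f),
    NNReal.coe_add]
  exact kernelOp_kernelOp (measurable_laguerreKernel α s) (measurable_laguerreKernel α t)
    (laguerreKernel_nonneg hα' hs'.le) (laguerreKernel_nonneg hα' ht'.le) hf.aestronglyMeasurable x
    ((ae_mem_orthant d).mono fun y hy => ⟨integrable_laguerreKernel_mul hα hs' ht' hx hy,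
      integral_laguerreKernel_mul hα hs' ht' hx hy⟩)
    (integrable_laguerreKernel_smul hα (add_pos hs' ht') hf hx)

lemma isPositiveFamily_laguerreSemigroup (hα : ∀ i, -1 < α i) :
    IsPositiveFamily (orthantMeasure d) (laguerreSemigroup (𝕜 := 𝕜) α) := by
  intro t f _ f_nonneg
  rcases eq_zero_or_pos t with rfl | ht
  · rwa [laguerreSemigroup_zero]
  · filter_upwards [laguerreSemigroup_ae_eq hα ht f] with x hx
    rw [hx]
    exact kernelOp_nonneg (laguerreKernel_nonneg hα t.coe_nonneg) f_nonneg x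

/-! ### Norm bounds and self-adjointness -/

lemma cosh_rpow_le_one (d : ℕ) (t : ℝ) : Real.cosh (2 * t) ^ (-(d : ℝ) / 2) ≤ 1 :=
  Real.rpow_le_one_of_one_le_of_nonpos (Real.one_le_cosh _)
    (div_nonpos_of_nonpos_of_nonneg (neg_nonpos.2 d.cast_nonneg) zero_le_two)

lemma ae_lintegral_enorm_laguerreKernel_le (hα : ∀ i, -1 < α i) {t : ℝ} (ht : 0 ≤ t)
    (mass_le : ∀ x ∈ orthant d,
      ∫⁻ y, ENNReal.ofReal (laguerreKernel α t x y) ∂orthantMeasure d ≤ ENNReal.ofReal C) :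
    ∀ᵐ x ∂orthantMeasure d,
      ∫⁻ y, ‖laguerreKernel α t x y‖ₑ ∂orthantMeasure d ≤ ENNReal.ofReal C := by
  simp only [Real.enorm_of_nonneg (laguerreKernel_nonneg hα ht _ _)]
  exact (ae_mem_orthant d).mono mass_le

lemma lpOpNormLE_laguerreSemigroup (hα : ∀ i, -1 < α i) (ht : 0 < t)
    (mass_le : ∀ x ∈ orthant d,
      ∫⁻ y, ENNReal.ofReal (laguerreKernel α t x y) ∂orthantMeasure d ≤ ENNReal.ofReal C)
    (hp : 1 ≤ p) : LpOpNormLE (orthantMeasure d) p (laguerreSemigroup (𝕜 := 𝕜) α t) C :=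
  (lpOpNormLE_kernelOp (measurable_laguerreKernel α t) (laguerreKernel_comm α t)
    (ae_lintegral_enorm_laguerreKernel_le hα t.coe_nonneg mass_le) hp).congr
    fun f => (laguerreSemigroup_ae_eq hα ht f).symm

lemma lpOpNormLE_laguerreSemigroup_of_contractive (hα : ∀ i, α i = -1 / 2 ∨ 1 / 2 ≤ α i)
    (ht : 0 < t) (hp : 1 ≤ p) :
    LpOpNormLE (orthantMeasure d) p (laguerreSemigroup (𝕜 := 𝕜) α t)
      (Real.cosh (2 * t) ^ (-(d : ℝ) / 2)) :=
  lpOpNormLE_laguerreSemigroup (neg_one_lt_of_neg_half_le (neg_half_le_of_contractive hα)) ht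
    (fun _ hx => lintegral_laguerreKernel_le_of_contractive hα (NNReal.coe_pos.2 ht) hx) hp

lemma lpOpNormLE_laguerreSemigroup_one (hα : ∀ i, α i = -1 / 2 ∨ 1 / 2 ≤ α i) (t : ℝ≥0)
    (hp : 1 ≤ p) : LpOpNormLE (orthantMeasure d) p (laguerreSemigroup (𝕜 := 𝕜) α t) 1 := by
  rcases eq_zero_or_pos t with rfl | ht
  · exact (LpOpNormLE.id p).congr fun f => by rw [laguerreSemigroup_zero]
  · exact (lpOpNormLE_laguerreSemigroup_of_contractive hα ht hp).mono (cosh_rpow_le_one d t)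

lemma exists_lpOpNormLE_laguerreSemigroup (𝕜 : Type*) [RCLike 𝕜] (hα : ∀ i, -1 / 2 ≤ α i) :
    ∃ c : ℝ, 1 < c ∧ ∀ p : ℝ≥0∞, 1 ≤ p → ∀ t : ℝ≥0, 0 < t →
      LpOpNormLE (orthantMeasure d) p (laguerreSemigroup (𝕜 := 𝕜) α t)
        (c * Real.cosh (2 * t) ^ (-(d : ℝ) / 2)) := by
  obtain ⟨c, hc, mass_le⟩ := exists_lintegral_laguerreKernel_le hα
  exact ⟨c, hc, fun p hp t ht => lpOpNormLE_laguerreSemigroup (neg_one_lt_of_neg_half_le hα) ht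
    (mass_le t (NNReal.coe_pos.2 ht)) hp⟩

lemma exists_lpOpNormLE_laguerreSemigroup_uniform (𝕜 : Type*) [RCLike 𝕜]
    (hα : ∀ i, -1 / 2 ≤ α i) : ∃ C : ℝ, ∀ p : ℝ≥0∞, 1 ≤ p → ∀ t : ℝ≥0,
      LpOpNormLE (orthantMeasure d) p (laguerreSemigroup (𝕜 := 𝕜) α t) C := by
  obtain ⟨c, hc, norm_le⟩ := exists_lpOpNormLE_laguerreSemigroup 𝕜 hα
  refine ⟨c, fun p hp t => ?_⟩
  rcases eq_zero_or_pos t with rfl | ht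
  · exact ((LpOpNormLE.id p).congr fun f => by rw [laguerreSemigroup_zero]).mono hc.le
  · exact (norm_le p hp t ht).mono
      (mul_le_of_le_one_right (zero_le_one.trans hc.le) (cosh_rpow_le_one d t))

lemma integral_conj_laguerreSemigroup_mul (hα : ∀ i, -1 / 2 ≤ α i) (t : ℝ≥0)
    (hf : MemLp f 2 (orthantMeasure d)) (hg : MemLp g 2 (orthantMeasure d)) :
    ∫ x, conj (laguerreSemigroup α t f x) * g x ∂orthantMeasure d =
      ∫ x, conj (f x) * laguerreSemigroup α t g x ∂orthantMeasure d := by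
  rcases eq_zero_or_pos t with rfl | ht
  · simp only [laguerreSemigroup_zero]
  have hα' := neg_one_lt_of_neg_half_le hα
  obtain ⟨c, -, mass_le⟩ := exists_lintegral_laguerreKernel_le hα
  have kernel_symm := integral_conj_kernelOp_mul (measurable_laguerreKernel α t)
    (laguerreKernel_comm α t) (ae_lintegral_enorm_laguerreKernel_le hα' t.coe_nonneg
      (mass_le t (NNReal.coe_pos.2 ht))) hf hg
  refine Eq.trans (integral_congr_ae ?_) (kernel_symm.trans (integral_congr_ae ?_))
  · exact (laguerreSemigroup_ae_eq hα' ht f).mono fun x hx => by simp only [hx]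
  · exact (laguerreSemigroup_ae_eq hα' ht g).mono fun x hx => by simp only [hx]

/-! ### Spectral expansion and strong continuity -/

/-- The partial sum over `s` of the expansion of `exp (-tL) f` in Laguerre functions. -/
def laguerrePartialFlow (α : Fin d → ℝ) (s : Finset (Fin d → ℕ)) (f : (Fin d → ℝ) → 𝕜) (t : ℝ)
    (x : Fin d → ℝ) : 𝕜 :=
  ∑ k ∈ s, (Real.exp (-t * laguerreEigenvalue α k) * laguerreHermite α k x) • laguerreCoeff α f k

lemma laguerrePartialFlow_zero (α : Fin d → ℝ) (s : Finset (Fin d → ℕ)) (f : (Fin d → ℝ) → 𝕜) :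
    laguerrePartialFlow α s f 0 =
      fun x => ∑ k ∈ s, laguerreHermite α k x • laguerreCoeff α f k := by
  funext x
  simp only [laguerrePartialFlow, neg_zero, zero_mul, Real.exp_zero, one_mul]

lemma memLp_laguerreHermite_smul (hα : ∀ i, -1 < α i) (k : Fin d → ℕ) (c : 𝕜) :
    MemLp (fun x => laguerreHermite α k x • c) 2 (orthantMeasure d) := by
  simp only [RCLike.real_smul_eq_coe_mul]
  exact (memLp_laguerreHermite hα k).ofReal.mul_const c

lemma memLp_laguerrePartialFlow (hα : ∀ i, -1 < α i) (s : Finset (Fin d → ℕ))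
    (f : (Fin d → ℝ) → 𝕜) (t : ℝ) : MemLp (laguerrePartialFlow α s f t) 2 (orthantMeasure d) := by
  refine memLp_finsetSum _ fun k _ => ?_
  simp only [mul_smul]
  exact (memLp_laguerreHermite_smul hα k (laguerreCoeff α f k)).const_smul
    (Real.exp (-t * laguerreEigenvalue α k))

lemma kernelOp_laguerrePartialFlow (hα : ∀ i, -1 / 2 ≤ α i) {t : ℝ} (ht : 0 < t)
    (s : Finset (Fin d → ℕ)) (f : (Fin d → ℝ) → 𝕜) (hx : x ∈ orthant d) :
    kernelOp (orthantMeasure d) (laguerreKernel α t) (laguerrePartialFlow α s f 0) x =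
      laguerrePartialFlow α s f t x := by
  have integrable_term (k : Fin d → ℕ) : Integrable (fun y =>
      (laguerreKernel α t x y * laguerreHermite α k y) • laguerreCoeff α f k)
      (orthantMeasure d) :=
    (integrable_laguerreKernel_smul hα ht (memL1AddLinfty_of_memLp one_le_two
      (memLp_laguerreHermite (neg_one_lt_of_neg_half_le hα) k)) hx).smul_const _
  simp only [kernelOp, laguerrePartialFlow_zero, Finset.smul_sum, smul_smul]
  rw [integral_finsetSum _ fun k _ => integrable_term k]
  refine Finset.sum_congr rfl fun k _ => ?_
  rw [integral_smul_const]
  exact congrArg (· • laguerreCoeff α f k)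
    (kernelOp_laguerreHermite (𝕜 := ℝ) (neg_one_lt_of_neg_half_le hα) ht k hx)

lemma laguerreSemigroup_sub_laguerrePartialFlow (hα : ∀ i, -1 / 2 ≤ α i) (t : ℝ≥0)
    (hf : MemLp f 2 (orthantMeasure d)) (s : Finset (Fin d → ℕ)) (hx : x ∈ orthant d) :
    laguerreSemigroup α t (f - laguerrePartialFlow α s f 0) x =
      laguerreSemigroup α t f x - laguerrePartialFlow α s f t x := by
  rcases eq_zero_or_pos t with rfl | ht
  · simp only [laguerreSemigroup_zero, Pi.sub_apply, NNReal.coe_zero]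
  have hα' := neg_one_lt_of_neg_half_le hα
  have ht' : (0 : ℝ) < t := NNReal.coe_pos.2 ht
  have integrable_smul {g : (Fin d → ℝ) → 𝕜} (hg : MemLp g 2 (orthantMeasure d)) :=
    integrable_laguerreKernel_smul hα ht' (memL1AddLinfty_of_memLp one_le_two hg) hx
  rw [laguerreSemigroup_eq_kernelOp hα' ht _ hx, laguerreSemigroup_eq_kernelOp hα' ht _ hx,
    ← kernelOp_laguerrePartialFlow hα ht' s f hx]
  simp only [kernelOp, Pi.sub_apply, smul_sub]
  exact integral_sub (integrable_smul hf) (integrable_smul (memLp_laguerrePartialFlow hα' s f 0))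

lemma eLpNorm_laguerreSemigroup_sub_laguerrePartialFlow_le (hα : ∀ i, -1 / 2 ≤ α i)
    (norm_le : LpOpNormLE (orthantMeasure d) 2 (laguerreSemigroup (𝕜 := 𝕜) α t) C)
    (hf : MemLp f 2 (orthantMeasure d)) (s : Finset (Fin d → ℕ)) :
    eLpNorm (laguerreSemigroup α t f - laguerrePartialFlow α s f t) 2 (orthantMeasure d) ≤
      ENNReal.ofReal C * eLpNorm (f - laguerrePartialFlow α s f 0) 2 (orthantMeasure d) := by
  have remainder := hf.sub (memLp_laguerrePartialFlow (neg_one_lt_of_neg_half_le hα) s f 0)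
  refine (eLpNorm_congr_ae ?_).trans_le (norm_le _ remainder).2
  exact (ae_mem_orthant d).mono fun x hx =>
    (laguerreSemigroup_sub_laguerrePartialFlow hα t hf s hx).symm

lemma tendsto_const_mul_eLpNorm_sub_laguerrePartialFlow (hα : ∀ i, -1 < α i)
    (hf : MemLp f 2 (orthantMeasure d)) {c : ℝ≥0∞} (hc : c ≠ ∞) :
    Tendsto (fun s => c * eLpNorm (f - laguerrePartialFlow α s f 0) 2 (orthantMeasure d)) atTop
      (𝓝 0) := by
  have limit := ENNReal.Tendsto.const_mul (tendsto_eLpNorm_sub_laguerre_sum hα hf) (Or.inr hc)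
  rw [mul_zero] at limit
  simp only [laguerrePartialFlow_zero]
  exact limit

lemma isSpectralHeatFlow_laguerreSemigroup (hα : ∀ i, -1 / 2 ≤ α i) (t : ℝ≥0)
    (hf : MemLp f 2 (orthantMeasure d)) :
    IsSpectralHeatFlow α t f (laguerreSemigroup α t f) := by
  obtain ⟨C, norm_le⟩ := exists_lpOpNormLE_laguerreSemigroup_uniform 𝕜 hα
  have norm_le_two := norm_le 2 one_le_two t
  exact ⟨(norm_le_two f hf).1, tendsto_of_tendsto_of_tendsto_of_le_of_le tendsto_const_nhds
    (tendsto_const_mul_eLpNorm_sub_laguerrePartialFlow (neg_one_lt_of_neg_half_le hα) hf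
      ENNReal.ofReal_ne_top)
    (fun _ => zero_le) fun s =>
      eLpNorm_laguerreSemigroup_sub_laguerrePartialFlow_le hα norm_le_two hf s⟩

lemma tendsto_eLpNorm_laguerrePartialFlow_sub (hα : ∀ i, -1 < α i) (s : Finset (Fin d → ℕ))
    (f : (Fin d → ℝ) → 𝕜) :
    Tendsto (fun t => eLpNorm (laguerrePartialFlow α s f t - laguerrePartialFlow α s f 0) 2
      (orthantMeasure d)) (𝓝 0) (𝓝 0) := by
  let u (k : Fin d → ℕ) (x : Fin d → ℝ) : 𝕜 := laguerreHermite α k x • laguerreCoeff α f k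
  have hu (k : Fin d → ℕ) : MemLp (u k) 2 (orthantMeasure d) := memLp_laguerreHermite_smul hα k _
  have sub_eq (t : ℝ) : laguerrePartialFlow α s f t - laguerrePartialFlow α s f 0 =
      ∑ k ∈ s, (Real.exp (-t * laguerreEigenvalue α k) - 1) • u k := by
    funext x
    simp only [laguerrePartialFlow_zero, laguerrePartialFlow, u, Pi.sub_apply, Finset.sum_apply,
      Pi.smul_apply, sub_smul, one_smul, mul_smul, Finset.sum_sub_distrib]
  have norm_le (t : ℝ) :
      eLpNorm (laguerrePartialFlow α s f t - laguerrePartialFlow α s f 0) 2 (orthantMeasure d) ≤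
        ∑ k ∈ s, ‖Real.exp (-t * laguerreEigenvalue α k) - 1‖ₑ *
          eLpNorm (u k) 2 (orthantMeasure d) := by
    rw [sub_eq]
    refine (eLpNorm_sum_le (fun k _ => ((hu k).const_smul _).aestronglyMeasurable)
      one_le_two).trans_eq (Finset.sum_congr rfl fun k _ => eLpNorm_const_smul ..)
  have bound_tendsto : Tendsto (fun t : ℝ => ∑ k ∈ s,
      ‖Real.exp (-t * laguerreEigenvalue α k) - 1‖ₑ * eLpNorm (u k) 2 (orthantMeasure d))
      (𝓝 0) (𝓝 (∑ k ∈ s, 0 * eLpNorm (u k) 2 (orthantMeasure d))) := by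
    refine tendsto_finsetSum _ fun k _ =>
      ENNReal.Tendsto.mul_const ?_ (Or.inr (hu k).eLpNorm_ne_top)
    exact Continuous.tendsto' (by fun_prop) 0 0 (by simp)
  simp only [zero_mul, Finset.sum_const_zero] at bound_tendsto
  exact tendsto_of_tendsto_of_tendsto_of_le_of_le tendsto_const_nhds bound_tendsto
    (fun _ => zero_le) norm_le

lemma eLpNorm_laguerreSemigroup_sub_le (hα : ∀ i, -1 / 2 ≤ α i)
    (norm_le : LpOpNormLE (orthantMeasure d) 2 (laguerreSemigroup (𝕜 := 𝕜) α t) C)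
    (hf : MemLp f 2 (orthantMeasure d)) (s : Finset (Fin d → ℕ)) :
    eLpNorm (laguerreSemigroup α t f - f) 2 (orthantMeasure d) ≤
      (ENNReal.ofReal C + 1) * eLpNorm (f - laguerrePartialFlow α s f 0) 2 (orthantMeasure d) +
        eLpNorm (laguerrePartialFlow α s f t - laguerrePartialFlow α s f 0) 2
          (orthantMeasure d) := by
  have partialFlow_memLp :=
    memLp_laguerrePartialFlow (𝕜 := 𝕜) (neg_one_lt_of_neg_half_le hα) s f
  have semigroup_remainder := (norm_le f hf).1.sub (partialFlow_memLp t)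
  have remainder := hf.sub (partialFlow_memLp 0)
  have partialFlow_sub := (partialFlow_memLp t).sub (partialFlow_memLp 0)
  have decomposition : laguerreSemigroup α t f - f =
      (laguerreSemigroup α t f - laguerrePartialFlow α s f t) -
        (f - laguerrePartialFlow α s f 0) +
        (laguerrePartialFlow α s f t - laguerrePartialFlow α s f 0) := by abel
  rw [decomposition, add_mul, one_mul]
  refine (eLpNorm_add_le (semigroup_remainder.sub remainder).aestronglyMeasurable
    partialFlow_sub.aestronglyMeasurable one_le_two).trans ?_
  gcongr
  refine (eLpNorm_sub_le semigroup_remainder.aestronglyMeasurable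
    remainder.aestronglyMeasurable one_le_two).trans ?_
  gcongr
  exact eLpNorm_laguerreSemigroup_sub_laguerrePartialFlow_le hα norm_le hf s

lemma tendsto_eLpNorm_laguerreSemigroup_sub (hα : ∀ i, -1 / 2 ≤ α i)
    (hf : MemLp f 2 (orthantMeasure d)) :
    Tendsto (fun t : ℝ≥0 => eLpNorm (laguerreSemigroup α t f - f) 2 (orthantMeasure d))
      (𝓝 0) (𝓝 0) := by
  have hα' := neg_one_lt_of_neg_half_le hα
  obtain ⟨C, norm_le⟩ := exists_lpOpNormLE_laguerreSemigroup_uniform 𝕜 hα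
  rw [ENNReal.tendsto_nhds_zero]
  intro ε hε
  have half_pos : 0 < ε / 2 := ENNReal.half_pos hε.ne'
  obtain ⟨s, remainder_le⟩ := (ENNReal.tendsto_nhds_zero.1
    (tendsto_const_mul_eLpNorm_sub_laguerrePartialFlow hα' hf
      (ENNReal.add_ne_top.2 ⟨ENNReal.ofReal_ne_top (r := C), ENNReal.one_ne_top⟩)) _
      half_pos).exists
  have partialFlow_tendsto := (tendsto_eLpNorm_laguerrePartialFlow_sub hα' s f).comp
    (NNReal.continuous_coe.tendsto' 0 0 NNReal.coe_zero)
  filter_upwards [ENNReal.tendsto_nhds_zero.1 partialFlow_tendsto _ half_pos] with t ht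
  exact (eLpNorm_laguerreSemigroup_sub_le hα (norm_le 2 one_le_two t) hf s).trans
    ((add_le_add remainder_le ht).trans_eq (ENNReal.add_halves ε))

/-! ### Submarkovian and non-contractive ranges -/

lemma isSymmetricDiffusionSemigroup_laguerreSemigroup (hα : ∀ i, α i = -1 / 2 ∨ 1 / 2 ≤ α i) :
    IsSymmetricDiffusionSemigroup (orthantMeasure d) (laguerreSemigroup (𝕜 := 𝕜) α) := by
  have hα' := neg_half_le_of_contractive hα
  exact {
    measurable t f hf := aestronglyMeasurable_laguerreSemigroup (neg_one_lt_of_neg_half_le hα') t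
      hf.aestronglyMeasurable
    congr t f g _ h := laguerreSemigroup_congr α t h
    map_add t f g hf hg :=
      (ae_mem_orthant d).mono fun x hx => laguerreSemigroup_add hα' t hf hg hx
    map_smul t c f _ := (laguerreSemigroup_const_smul α t c f).eventuallyEq
    map_zero_time f _ := (laguerreSemigroup_zero α f).eventuallyEq
    contraction p hp t := lpOpNormLE_laguerreSemigroup_one hα t hp
    semigroup p hp s t f hf :=
      laguerreSemigroup_add_time hα' s t (memL1AddLinfty_of_memLp hp hf)
    selfAdjoint t f g hf hg := integral_conj_laguerreSemigroup_mul hα' t hf hg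
    strongContinuity f hf :=
      (tendsto_eLpNorm_laguerreSemigroup_sub hα' hf).mono_left nhdsWithin_le_nhds }

lemma lintegral_laguerreKernel_eq_ofReal_integral (hα : ∀ i, -1 / 2 ≤ α i) {t : ℝ} (ht : 0 < t)
    (hx : x ∈ orthant d) :
    ∫⁻ y, ENNReal.ofReal (laguerreKernel α t x y) ∂orthantMeasure d =
      ENNReal.ofReal (∫ y, laguerreKernel α t x y ∂orthantMeasure d) :=
  (ofReal_integral_eq_lintegral_ofReal (integrable_laguerreKernel hα ht hx) (Eventually.of_forall
    fun y => laguerreKernel_nonneg (neg_one_lt_of_neg_half_le hα) ht.le x y)).symm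

lemma integral_laguerreKernel_le (hα : ∀ i, α i = -1 / 2 ∨ 1 / 2 ≤ α i) {t : ℝ} (ht : 0 < t)
    (hx : x ∈ orthant d) :
    ∫ y, laguerreKernel α t x y ∂orthantMeasure d ≤ Real.cosh (2 * t) ^ (-(d : ℝ) / 2) := by
  rw [← ENNReal.ofReal_le_ofReal_iff (cosh_rpow_nonneg t _),
    ← lintegral_laguerreKernel_eq_ofReal_integral (neg_half_le_of_contractive hα) ht hx]
  exact lintegral_laguerreKernel_le_of_contractive hα ht hx

lemma laguerreSemigroup_indicator_one (hα : ∀ i, -1 < α i) (ht : 0 < t) (hx : x ∈ orthant d)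
    {s : Set (Fin d → ℝ)} (hs : MeasurableSet s) :
    laguerreSemigroup α t (s.indicator fun _ => (1 : 𝕜)) x =
      ((∫ y in s, laguerreKernel α t x y ∂orthantMeasure d : ℝ) : 𝕜) := by
  rw [laguerreSemigroup_eq_kernelOp hα ht _ hx, ← integral_indicator hs, kernelOp,
    ← integral_ofReal]
  refine integral_congr_ae (Eventually.of_forall fun y => ?_)
  by_cases hy : y ∈ s <;> simp [hy, RCLike.real_smul_eq_coe_mul]

lemma laguerreSemigroup_one (hα : ∀ i, -1 < α i) (ht : 0 < t) (hx : x ∈ orthant d) :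
    laguerreSemigroup α t (fun _ => (1 : 𝕜)) x =
      ((∫ y, laguerreKernel α t x y ∂orthantMeasure d : ℝ) : 𝕜) := by
  simpa only [Set.indicator_univ, setIntegral_univ] using
    laguerreSemigroup_indicator_one hα ht hx MeasurableSet.univ

lemma isSubmarkovianSemigroup_laguerreSemigroup (hα : ∀ i, α i = -1 / 2 ∨ 1 / 2 ≤ α i) :
    IsSubmarkovianSemigroup (orthantMeasure d) (laguerreSemigroup (𝕜 := 𝕜) α) := by
  have hα' := neg_one_lt_of_neg_half_le (neg_half_le_of_contractive hα)
  refine ⟨isSymmetricDiffusionSemigroup_laguerreSemigroup hα,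
    isPositiveFamily_laguerreSemigroup hα', fun t => ?_⟩
  rcases eq_zero_or_pos t with rfl | ht
  · simp only [laguerreSemigroup_zero, le_refl, Eventually.of_forall, implies_true]
  · filter_upwards [ae_mem_orthant d] with x hx
    rw [laguerreSemigroup_one hα' ht hx, ← RCLike.ofReal_one (K := 𝕜), RCLike.ofReal_le_ofReal]
    exact (integral_laguerreKernel_le hα (NNReal.coe_pos.2 ht) hx).trans (cosh_rpow_le_one d t)

lemma exists_mem_of_ae_orthantMeasure {U : Set (Fin d → ℝ)} (hU : IsOpen U) (ne : U.Nonempty)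
    (subset : U ⊆ orthant d) {P : (Fin d → ℝ) → Prop} (h : ∀ᵐ x ∂orthantMeasure d, P x) :
    ∃ x ∈ U, P x := by
  by_contra! not_P
  have null : orthantMeasure d U = 0 := measure_mono_null (fun x hx => not_P x hx) (ae_iff.1 h)
  rw [orthantMeasure, Measure.restrict_eq_self _ subset] at null
  exact (hU.measure_pos volume ne).ne' null

lemma isOpen_orthant (d : ℕ) : IsOpen (orthant d) := by
  rw [orthant_eq_pi]
  exact isOpen_set_pi Set.finite_univ fun _ _ => isOpen_Ioi

lemma orthant_nonempty (d : ℕ) : (orthant d).Nonempty := ⟨fun _ => 1, fun _ => one_pos⟩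

lemma not_isMarkovianSemigroup_laguerreSemigroup (hd : 1 ≤ d)
    (hα : ∀ i, α i = -1 / 2 ∨ 1 / 2 ≤ α i) :
    ¬ IsMarkovianSemigroup (orthantMeasure d) (laguerreSemigroup (𝕜 := 𝕜) α) := by
  rintro ⟨-, -, conservative⟩
  obtain ⟨x, hx, mass_eq⟩ := exists_mem_of_ae_orthantMeasure (isOpen_orthant d) (orthant_nonempty d)
    subset_rfl (conservative 1)
  rw [laguerreSemigroup_one (neg_one_lt_of_neg_half_le (neg_half_le_of_contractive hα)) one_pos hx,
    ← RCLike.ofReal_one (K := 𝕜), RCLike.ofReal_inj, NNReal.coe_one] at mass_eq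
  have mass_le := integral_laguerreKernel_le hα one_pos hx
  have exponent_neg : -(d : ℝ) / 2 < 0 :=
    div_neg_of_neg_of_pos (neg_neg_of_pos (Nat.cast_pos.2 hd)) two_pos
  have cosh_lt_one : Real.cosh (2 * 1) ^ (-(d : ℝ) / 2) < 1 :=
    Real.rpow_lt_one_of_one_lt_of_neg (Real.one_lt_cosh.2 (by norm_num)) exponent_neg
  linarith

lemma ae_norm_apply_indicator_le_one {X : Type*} [MeasurableSpace X] {μ : Measure X}
    {T : ℝ≥0 → (X → 𝕜) → X → 𝕜} (h : IsLpContractiveSemigroup μ T) (t : ℝ≥0) {s : Set X}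
    (hs : MeasurableSet s) (hμs : μ s ≠ ∞) :
    ∀ᵐ x ∂μ, ‖T t (s.indicator fun _ => 1) x‖ ≤ 1 := by
  have memLp (p : ℝ≥0∞) : MemLp (s.indicator fun _ => (1 : 𝕜)) p μ :=
    memLp_indicator_const p hs 1 (Or.inr hμs)
  have norm_le : eLpNorm (T t (s.indicator fun _ => 1)) ∞ μ ≤ 1 :=
    (h ∞ le_top t _ (memLp 2) (memLp ∞)).trans
      ((eLpNorm_indicator_const_le (1 : 𝕜) ∞).trans (by simp))
  rw [eLpNorm_exponent_top] at norm_le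
  filter_upwards [ae_le_eLpNormEssSup (f := T t (s.indicator fun _ => 1)) (μ := μ)] with x hx
  rw [← ENNReal.ofReal_le_one, ofReal_norm]
  exact hx.trans norm_le

lemma integral_le_of_forall_spanningSets {X : Type*} [MeasurableSpace X] {μ : Measure X}
    [SigmaFinite μ] {u : X → ℝ} (hu : Integrable u μ)
    (h : ∀ n, ∫ x in spanningSets μ n, u x ∂μ ≤ C) : ∫ x, u x ∂μ ≤ C := by
  have limit := tendsto_setIntegral_of_monotone (measurableSet_spanningSets μ)
    (monotone_spanningSets μ) hu.integrableOn
  rw [iUnion_spanningSets, setIntegral_univ] at limit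
  exact le_of_tendsto' limit h

/-- Contractivity on `L^∞` is tested on the indicators of an exhaustion by sets of finite measure,
since it only constrains functions in `L² ∩ L^∞`. -/
lemma ae_integral_laguerreKernel_le_one (hα : ∀ i, -1 / 2 ≤ α i)
    (h : IsLpContractiveSemigroup (orthantMeasure d) (laguerreSemigroup (𝕜 := 𝕜) α))
    (ht : 0 < t) :
    ∀ᵐ x ∂orthantMeasure d, ∫ y, laguerreKernel α t x y ∂orthantMeasure d ≤ 1 := by
  have norm_le : ∀ᵐ x ∂orthantMeasure d, ∀ n, ‖laguerreSemigroup α t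
      ((spanningSets (orthantMeasure d) n).indicator fun _ => (1 : 𝕜)) x‖ ≤ 1 :=
    ae_all_iff.2 fun n => ae_norm_apply_indicator_le_one h t (measurableSet_spanningSets _ n)
      (measure_spanningSets_lt_top _ n).ne
  filter_upwards [norm_le, ae_mem_orthant d] with x norm_le hx
  refine integral_le_of_forall_spanningSets
    (integrable_laguerreKernel hα (NNReal.coe_pos.2 ht) hx) fun n => ?_
  have bound := norm_le n
  rw [laguerreSemigroup_indicator_one (neg_one_lt_of_neg_half_le hα) ht hx
    (measurableSet_spanningSets _ n), RCLike.norm_ofReal] at bound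
  exact (le_abs_self _).trans bound

lemma not_isLpContractiveSemigroup_laguerreSemigroup (hα : ∀ i, -1 / 2 ≤ α i)
    (hα' : ∃ i, -1 / 2 < α i ∧ α i < 1 / 2) :
    ¬ IsLpContractiveSemigroup (orthantMeasure d) (laguerreSemigroup (𝕜 := 𝕜) α) := by
  intro h
  obtain ⟨t, ht, U, subset, hU, ne, one_lt⟩ := exists_one_lt_lintegral_laguerreKernel hα hα'
  lift t to ℝ≥0 using ht.le
  obtain ⟨x, hx, le_one⟩ := exists_mem_of_ae_orthantMeasure hU ne subset
    (ae_integral_laguerreKernel_le_one hα h (NNReal.coe_pos.1 ht))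
  have gt_one := one_lt x hx
  rw [lintegral_laguerreKernel_eq_ofReal_integral hα ht (subset hx),
    ENNReal.one_lt_ofReal] at gt_one
  exact gt_one.not_ge le_one

end LaguerreSemigroup

end

theorem mainTheorem1 {𝕜 : Type*} [RCLike 𝕜] {d : ℕ} (hd : 1 ≤ d) (α : Fin d → ℝ)
    (hα : ∀ i, -1 / 2 ≤ α i) :
    -- the operators are well defined on `L¹ + L^∞` and coincide with `exp(-tL)` on `L²`
    (∀ t : ℝ≥0, 0 < t → ∀ x ∈ orthant d, ∀ y ∈ orthant d,
      Summable (laguerreKernelTerm α t x y)) ∧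
    (∀ t : ℝ≥0, 0 < t → ∀ f : (Fin d → ℝ) → 𝕜, MemL1AddLinfty (orthantMeasure d) f →
      ∀ x ∈ orthant d,
        Integrable (fun y => laguerreHeatKernel α t x y • f y) (orthantMeasure d)) ∧
    (∀ t : ℝ≥0, ∀ f : (Fin d → ℝ) → 𝕜, MemLp f 2 (orthantMeasure d) →
      IsSpectralHeatFlow α t f (laguerreSemigroup α t f)) ∧
    -- contractive range
    ((∀ i, α i = -1 / 2 ∨ 1 / 2 ≤ α i) →
      IsSubmarkovianSemigroup (orthantMeasure d) (laguerreSemigroup (𝕜 := 𝕜) α) ∧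
      ¬ IsMarkovianSemigroup (orthantMeasure d) (laguerreSemigroup (𝕜 := 𝕜) α) ∧
      ∀ p : ℝ≥0∞, 1 ≤ p → ∀ t : ℝ≥0, 0 < t →
        LpOpNormLE (orthantMeasure d) p (laguerreSemigroup (𝕜 := 𝕜) α t)
          (Real.cosh (2 * t) ^ (-(d : ℝ) / 2))) ∧
    -- non-contractive range
    ((∃ i, -1 / 2 < α i ∧ α i < 1 / 2) →
      ¬ IsLpContractiveSemigroup (orthantMeasure d) (laguerreSemigroup (𝕜 := 𝕜) α) ∧
      ∃ c : ℝ, 1 < c ∧ ∀ p : ℝ≥0∞, 1 ≤ p → ∀ t : ℝ≥0, 0 < t →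
        LpOpNormLE (orthantMeasure d) p (laguerreSemigroup (𝕜 := 𝕜) α t)
          (c * Real.cosh (2 * t) ^ (-(d : ℝ) / 2))) := by
  have hα1 := neg_one_lt_of_neg_half_le hα
  refine ⟨fun t ht x hx y hy =>
      (hasSum_laguerreKernelTerm hα1 (NNReal.coe_pos.2 ht) hx hy).summable,
    fun t ht f hf x hx => integrable_laguerreHeatKernel_smul hα (NNReal.coe_pos.2 ht) hf hx,
    fun t f hf => isSpectralHeatFlow_laguerreSemigroup hα t hf,
    fun hα' => ⟨?submarkovian, ?notMarkovian, ?contractionBound⟩,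
    fun hi => ⟨?notContractive, ?bound⟩⟩
  case submarkovian => exact isSubmarkovianSemigroup_laguerreSemigroup hα'
  case notMarkovian => exact not_isMarkovianSemigroup_laguerreSemigroup hd hα'
  case contractionBound =>
    exact fun p hp t ht => lpOpNormLE_laguerreSemigroup_of_contractive hα' ht hp
  case notContractive => exact not_isLpContractiveSemigroup_laguerreSemigroup hα hi
  case bound => exact exists_lpOpNormLE_laguerreSemigroup 𝕜 hα
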